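/- Let $\mathcal P$ be the ring of combinatorial convex polytopes: the free abelian group on the combinatorial equivalence classes of (nonempty) convex polytopes, with multiplication given by the direct product of polytopes and with the point as unit. For $k\ge 0$ let $d_k\in\mathrm{Hom}_{\mathbb Z}(\mathcal P,\mathcal P)$ be the operator that sends a polytope $P$ of dimension $n$ to the sum of all its $(n-k)$-dimensional faces (so $d_0=\mathrm{id}$, and $d_kP=0$ if $k>n$), and let $\mathcal D$ be the subring of $\mathrm{Hom}_{\mathbb Z}(\mathcal P,\mathcal P)$, with composition as multiplication, generated by the $d_k$, $k\ge 1$. A Leibnitz–Hopf algebra over $\mathbb Z$ is a Hopf algebra $\mathcal H$ over $\mathbb Z$ together with a sequence $H_1,H_2,\dots$ that generates $\mathcal H$ as an algebra and satisfies $\Delta H_n=\sum_{i+j=n}H_i\otimes H_j$ for all $n\ge 1$, where $H_0=1$. Let $\mathcal Z=\mathbb Z\langle Z_1,Z_2,\dots\rangle$ be the free associative algebra with the Leibnitz–Hopf algebra structure $\Delta Z_n=\sum_{i+j=n}Z_i\otimes Z_j$, $Z_0=1$, and let $J_{\mathcal D}\subset\mathcal Z$ be the two-sided ideal generated by the elements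 $\sum_{i+j=n}(-1)^iZ_iZ_j$, $n\ge 1$ (equivalently, by the relation $\Phi(-t)\Phi(t)=1$ with $\Phi(t)=\sum_{k\ge 0}Z_kt^k$). It is a Hopf ideal, so that $\mathcal Z/J_{\mathcal D}$ is a Hopf algebra. Theorem. The ring $\mathcal D$ has a (unique) Hopf algebra structure over $\mathbb Z$ with $\Delta d_k=\sum_{i+j=k}d_i\otimes d_j$ for all $k$, that is, one that makes $\mathcal D$ with the sequence $d_1,d_2,\dots$ a Leibnitz–Hopf algebra. With this structure: (a) if $D\in\mathcal D$ and $\Delta D=\sum D'\otimes D''$, then $D(pq)=\sum D'(p)\,D''(q)$ for all $p,q\in\mathcal P$; (b) the map $Z_k\mapsto d_k$ induces an isomorphism of Hopf algebras $\mathcal Z/J_{\mathcal D}\cong\mathcal D$; (c) the antipode of $\mathcal D$ satisfies $\chi(d_k)=(-1)^kd_k$ for all $k$; (d) $\mathcal D$ is universal among the Leibnitz–Hopf algebras over $\mathbb Z$ with this property: for every Leibnitz–Hopf algebra $(\mathcal H,(H_i))$ over $\mathbb Z$ whose antipode satisfies $\chi(H_i)=(-1)^iH_i$ for all $i$, there is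 a unique homomorphism of Hopf algebras $\mathcal D\to\mathcal H$ with $d_i\mapsto H_i$ for all $i$. -/

import Mathlib

open scoped TensorProduct
open Finset.HasAntidiagonal (antidiagonal)

namespace PolytopeAlgebra

/-! ### Leibnitz-Hopf algebras -/

/-- `H` together with the sequence `h 1, h 2, …` (and `h 0 = 1`) is a Leibnitz-Hopf algebra over
`R`: the `h n` generate the algebra `H`, and `Δ (h n) = ∑_{i + j = n} h i ⊗ h j`. -/
structure IsLeibnitzHopf (R H : Type*) [CommRing R] [Ring H] [HopfAlgebra R H] (h : ℕ → H) :
    Prop where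
  zero : h 0 = 1
  adjoin_eq_top : Algebra.adjoin R (h '' {n | 1 ≤ n}) = ⊤
  comul : ∀ n, Coalgebra.comul (R := R) (h n) =
    ∑ p ∈ antidiagonal n, h p.1 ⊗ₜ[R] h p.2

/-- Homomorphisms of Hopf algebras over `R`. (A bialgebra homomorphism between Hopf algebras
commutes with the antipodes.) -/
abbrev HopfHom (R A B : Type*) [CommRing R] [Ring A] [Ring B] [HopfAlgebra R A]
    [HopfAlgebra R B] : Type _ := A →ₐc[R] B

/-- Isomorphisms of Hopf algebras over `R`. -/
abbrev HopfEquiv (R A B : Type*) [CommRing R] [Ring A] [Ring B] [HopfAlgebra R A]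
    [HopfAlgebra R B] : Type _ := A ≃ₐc[R] B

/-- An action of a Hopf algebra `X` on a ring `M` satisfies the Milnor rule if
`x (u v) = ∑ x'(u) x''(v)` whenever `Δ x = ∑ x' ⊗ x''`. -/
def MilnorRule (R : Type*) {X M : Type*} [CommRing R] [Ring X] [HopfAlgebra R X] [Ring M]
    (act : X → M → M) : Prop :=
  ∀ (x : X) (u v : M) (ι : Type) (r : Coalgebra.Repr R x ι),
    act x (u * v) = ∑ i ∈ r.index, act (r.left i) u * act (r.right i) v

/-! ### The free Leibnitz-Hopf algebra `R⟨Z₁, Z₂, …⟩` -/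

/-- The free associative algebra `R⟨Z₁, Z₂, …⟩`; the letter `n : ℕ` stands for `Z_{n+1}`. -/
abbrev FreeLH (R : Type*) [CommRing R] : Type _ := FreeAlgebra R ℕ

namespace FreeLH

variable (R : Type*) [CommRing R]

/-- The generators `Z_k`, with `Z_0 = 1`. -/
noncomputable def Z : ℕ → FreeLH R
  | 0 => 1
  | n + 1 => FreeAlgebra.ι R n

/-- The comultiplication, `Δ Z_n = ∑_{i + j = n} Z_i ⊗ Z_j`. -/
noncomputable def comulHom : FreeLH R →ₐ[R] (FreeLH R) ⊗[R] FreeLH R :=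
  FreeAlgebra.lift R fun n => ∑ p ∈ antidiagonal (n + 1), Z R p.1 ⊗ₜ[R] Z R p.2

/-- The counit, `ε Z_n = 0` for `n ≥ 1`. -/
noncomputable def counitHom : FreeLH R →ₐ[R] R := FreeAlgebra.lift R fun _ => 0

theorem comulHom_Z (n : ℕ) :
    comulHom R (Z R n) = ∑ p ∈ antidiagonal n, Z R p.1 ⊗ₜ[R] Z R p.2 := by
  cases n with
  | zero => simp [Z, Algebra.TensorProduct.one_def]
  | succ n => simp [Z, comulHom]

theorem counitHom_Z (n : ℕ) : counitHom R (Z R n) = if n = 0 then 1 else 0 := by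
  cases n <;> simp [Z, counitHom]

theorem algHom_ext_Z {B : Type*} [Semiring B] [Algebra R B] {f g : FreeLH R →ₐ[R] B}
    (h : ∀ n, f (Z R n) = g (Z R n)) : f = g := by
  apply FreeAlgebra.hom_ext
  funext n
  exact h (n + 1)

noncomputable instance : Bialgebra R (FreeLH R) :=
  Bialgebra.ofAlgHom (comulHom R) (counitHom R)
    (by
      apply algHom_ext_Z R
      intro n
      simp only [AlgHom.comp_apply, comulHom_Z, map_sum, Algebra.TensorProduct.map_tmul,
        TensorProduct.sum_tmul, TensorProduct.tmul_sum, AlgHom.coe_id, id]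
      simp only [AlgEquiv.coe_toAlgHom, Algebra.TensorProduct.assoc_tmul]
      rw [Finset.sum_sigma', Finset.sum_sigma']
      refine Finset.sum_nbij' (fun x => ⟨(x.2.1, x.2.2 + x.1.2), (x.2.2, x.1.2)⟩)
        (fun x => ⟨(x.1.1 + x.2.1, x.2.2), (x.1.1, x.2.1)⟩) ?_ ?_ ?_ ?_ ?_
      · rintro ⟨⟨a, b⟩, c, d⟩ h
        simp only [Finset.mem_sigma, Finset.HasAntidiagonal.mem_antidiagonal] at h ⊢
        obtain ⟨h1, h2⟩ := h
        exact ⟨by omega, trivial⟩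
      · rintro ⟨⟨a, b⟩, c, d⟩ h
        simp only [Finset.mem_sigma, Finset.HasAntidiagonal.mem_antidiagonal] at h ⊢
        obtain ⟨h1, h2⟩ := h
        exact ⟨by omega, trivial⟩
      · rintro ⟨⟨a, b⟩, c, d⟩ h
        simp only [Finset.mem_sigma, Finset.HasAntidiagonal.mem_antidiagonal] at h
        obtain ⟨-, rfl⟩ := h
        rfl
      · rintro ⟨⟨a, b⟩, c, d⟩ h
        simp only [Finset.mem_sigma, Finset.HasAntidiagonal.mem_antidiagonal] at h
        obtain ⟨-, rfl⟩ := h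
        rfl
      · rintro ⟨⟨a, b⟩, c, d⟩ h
        rfl)
    (by
      apply algHom_ext_Z R
      intro n
      simp only [AlgHom.comp_apply, comulHom_Z, map_sum, Algebra.TensorProduct.map_tmul,
        counitHom_Z]
      rw [Finset.sum_eq_single (0, n)]
      · simp
      · rintro ⟨i, j⟩ hij hne
        have : i ≠ 0 := by
          rintro rfl
          simp at hij
          exact hne (by simp [hij])
        simp [this]
      · simp)
    (by
      apply algHom_ext_Z R
      intro n
      simp only [AlgHom.comp_apply, comulHom_Z, map_sum, Algebra.TensorProduct.map_tmul,
        counitHom_Z]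
      rw [Finset.sum_eq_single (n, 0)]
      · simp
      · rintro ⟨i, j⟩ hij hne
        have : j ≠ 0 := by
          rintro rfl
          simp at hij
          exact hne (by simp [hij])
        simp [this]
      · simp)

theorem comul_Z (n : ℕ) : Coalgebra.comul (R := R) (Z R n) =
    ∑ p ∈ antidiagonal n, Z R p.1 ⊗ₜ[R] Z R p.2 := comulHom_Z R n

/-- The generating series `Φ(t) = ∑ Z_n t^n`. -/
noncomputable def Phi : PowerSeries (FreeLH R) := PowerSeries.mk (Z R)

/-- The images `χ(Z_n)` of the generators under the antipode, i.e. the coefficients of the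
inverse of the series `Φ(t)`. -/
noncomputable def chiZ (n : ℕ) : FreeLH R := PowerSeries.coeff n (PowerSeries.invOfUnit (Phi R) 1)

theorem sum_chiZ_mul (n : ℕ) :
    ∑ p ∈ antidiagonal n, chiZ R p.1 * Z R p.2 = if n = 0 then 1 else 0 := by
  have h := congrArg (PowerSeries.coeff n) (PowerSeries.invOfUnit_mul (Phi R) 1 (by simp [Phi, Z]))
  simpa [PowerSeries.coeff_mul, PowerSeries.coeff_one, Phi, chiZ] using h

theorem sum_mul_chiZ (n : ℕ) :
    ∑ p ∈ antidiagonal n, Z R p.1 * chiZ R p.2 = if n = 0 then 1 else 0 := by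
  have h := congrArg (PowerSeries.coeff n) (PowerSeries.mul_invOfUnit (Phi R) 1 (by simp [Phi, Z]))
  simpa [PowerSeries.coeff_mul, PowerSeries.coeff_one, Phi, chiZ] using h

theorem chiZ_zero : chiZ R 0 = 1 := by simp [chiZ]

/-- The antipode as an algebra homomorphism to the opposite algebra. -/
noncomputable def chiHom : FreeLH R →ₐ[R] (FreeLH R)ᵐᵒᵖ :=
  FreeAlgebra.lift R fun n => MulOpposite.op (chiZ R (n + 1))

/-- The antipode as a linear map. -/
noncomputable def chi : FreeLH R →ₗ[R] FreeLH R :=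
  (MulOpposite.opLinearEquiv R).symm.toLinearMap ∘ₗ (chiHom R).toLinearMap

theorem chiHom_apply (x : FreeLH R) : chiHom R x = MulOpposite.op (chi R x) := rfl

theorem chi_Z (n : ℕ) : chi R (Z R n) = chiZ R n := by
  cases n with
  | zero => simp [chi, Z, chiZ_zero]
  | succ n => simp [chi, Z, chiHom]

theorem chi_one : chi R 1 = 1 := by simp [chi]

theorem chi_mul (x y : FreeLH R) : chi R (x * y) = chi R y * chi R x := by simp [chi]

theorem induction_Z {p : FreeLH R → Prop} (hz : ∀ n, p (Z R n)) (hc : ∀ a : R, p (algebraMap R _ a))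
    (hm : ∀ x y, p x → p y → p (x * y)) (ha : ∀ x y, p x → p y → p (x + y)) (x : FreeLH R) : p x :=
  FreeAlgebra.induction (R := R) (X := ℕ) (motive := p) hc (fun n => hz (n + 1)) hm ha x

theorem mul_chi_aux (x : FreeLH R) :
    LinearMap.mul' R (FreeLH R) ((chi R).rTensor (FreeLH R) (Coalgebra.comul x)) =
      algebraMap R (FreeLH R) (Coalgebra.counit x) := by
  induction x using induction_Z R with
  | hz n =>
    rw [comul_Z]
    change _ = algebraMap R (FreeLH R) (counitHom R (Z R n))
    simp only [map_sum, LinearMap.rTensor_tmul, LinearMap.mul'_apply, chi_Z, sum_chiZ_mul,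
      counitHom_Z]
    split_ifs <;> simp
  | hc a =>
    simp [Algebra.TensorProduct.one_def, chi_one, Algebra.algebraMap_eq_smul_one]
  | ha x y hx hy => simp [hx, hy]
  | hm x y hx hy =>
    have key : ∀ t u : FreeLH R ⊗[R] (FreeLH R), ∀ c : R,
        LinearMap.mul' R (FreeLH R) ((chi R).rTensor (FreeLH R) t) = algebraMap R (FreeLH R) c →
        LinearMap.mul' R (FreeLH R) ((chi R).rTensor (FreeLH R) (t * u)) =
          c • LinearMap.mul' R (FreeLH R) ((chi R).rTensor (FreeLH R) u) := by
      intro t u c htc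
      induction u using TensorProduct.induction_on with
      | zero => simp
      | add u v hu hv => simp [mul_add, hu, hv]
      | tmul a b =>
        have : ∀ t : FreeLH R ⊗[R] (FreeLH R),
            LinearMap.mul' R (FreeLH R) ((chi R).rTensor (FreeLH R) (t * a ⊗ₜ b)) =
              chi R a * LinearMap.mul' R (FreeLH R) ((chi R).rTensor (FreeLH R) t) * b := by
          intro t
          induction t using TensorProduct.induction_on with
          | zero => simp
          | add u v hu hv => simp [mul_add, add_mul, hu, hv]
          | tmul c d => simp [chi_mul, mul_assoc]
        rw [this, htc]
        simp [Algebra.algebraMap_eq_smul_one]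
    rw [Bialgebra.comul_mul, key _ _ _ hx, hy, Bialgebra.counit_mul]
    simp [Algebra.algebraMap_eq_smul_one, mul_smul]

theorem mul_chi_aux' (x : FreeLH R) :
    LinearMap.mul' R (FreeLH R) ((chi R).lTensor (FreeLH R) (Coalgebra.comul x)) =
      algebraMap R (FreeLH R) (Coalgebra.counit x) := by
  induction x using induction_Z R with
  | hz n =>
    rw [comul_Z]
    change _ = algebraMap R (FreeLH R) (counitHom R (Z R n))
    simp only [map_sum, LinearMap.lTensor_tmul, LinearMap.mul'_apply, chi_Z, sum_mul_chiZ,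
      counitHom_Z]
    split_ifs <;> simp
  | hc a =>
    simp [Algebra.TensorProduct.one_def, chi_one, Algebra.algebraMap_eq_smul_one]
  | ha x y hx hy => simp [hx, hy]
  | hm x y hx hy =>
    have key : ∀ t u : FreeLH R ⊗[R] (FreeLH R), ∀ c : R,
        LinearMap.mul' R (FreeLH R) ((chi R).lTensor (FreeLH R) u) = algebraMap R (FreeLH R) c →
        LinearMap.mul' R (FreeLH R) ((chi R).lTensor (FreeLH R) (t * u)) =
          c • LinearMap.mul' R (FreeLH R) ((chi R).lTensor (FreeLH R) t) := by
      intro t u c huc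
      induction t using TensorProduct.induction_on with
      | zero => simp
      | add u v hu hv => simp [add_mul, hu, hv]
      | tmul a b =>
        have : ∀ t : FreeLH R ⊗[R] (FreeLH R),
            LinearMap.mul' R (FreeLH R) ((chi R).lTensor (FreeLH R) (a ⊗ₜ b * t)) =
              a * LinearMap.mul' R (FreeLH R) ((chi R).lTensor (FreeLH R) t) * chi R b := by
          intro t
          induction t using TensorProduct.induction_on with
          | zero => simp
          | add u v hu hv => simp [mul_add, add_mul, hu, hv]
          | tmul c d => simp [chi_mul, mul_assoc]
        rw [this, huc]
        simp [Algebra.algebraMap_eq_smul_one]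
    rw [Bialgebra.comul_mul, key _ _ _ hy, hx, Bialgebra.counit_mul]
    rw [Algebra.algebraMap_eq_smul_one, Algebra.algebraMap_eq_smul_one, smul_smul, mul_comm]

/-- The Hopf algebra structure on `R⟨Z₁, Z₂, …⟩`. -/
noncomputable instance : HopfAlgebra R (FreeLH R) where
  antipode := chi R
  mul_antipode_rTensor_comul := LinearMap.ext (mul_chi_aux R)
  mul_antipode_lTensor_comul := LinearMap.ext (mul_chi_aux' R)

/-! ### The ideal `J` generated by `Φ(-t) Φ(t) = 1` -/

/-- The coefficient of `t^n` in `Φ(-t) Φ(t)`, that is `∑_{i + j = n} (-1)^i Z_i Z_j`. -/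
noncomputable def rel (n : ℕ) : FreeLH R :=
  ∑ p ∈ antidiagonal n, (-1) ^ p.1 * (Z R p.1 * Z R p.2)

/-- The two-sided ideal of `R⟨Z₁, Z₂, …⟩` generated by the elements
`∑_{i + j = n} (-1)^i Z_i Z_j`, `n ≥ 1`. -/
noncomputable def J : Ideal (FreeLH R) := (TwoSidedIdeal.span (rel R '' {n | 1 ≤ n})).asIdeal

instance : (J R).IsTwoSided := inferInstanceAs (TwoSidedIdeal.asIdeal _).IsTwoSided

theorem J_le_ker {B : Type*} [Ring B] (f : FreeLH R →+* B) (h : ∀ n, 1 ≤ n → f (rel R n) = 0)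
    {x : FreeLH R} (hx : x ∈ J R) : f x = 0 := by
  have h1 : TwoSidedIdeal.span (rel R '' {n | 1 ≤ n}) ≤ TwoSidedIdeal.ker f := by
    rw [TwoSidedIdeal.span_le]
    rintro _ ⟨n, hn, rfl⟩
    exact (TwoSidedIdeal.mem_ker f).2 (h n hn)
  exact (TwoSidedIdeal.mem_ker f).1 (h1 (TwoSidedIdeal.mem_asIdeal.1 hx))

theorem rel_mem_J {n : ℕ} (hn : 1 ≤ n) : rel R n ∈ J R :=
  TwoSidedIdeal.mem_asIdeal.2 (TwoSidedIdeal.subset_span ⟨n, hn, rfl⟩)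

/-- The sequence `a` satisfies `Φ(-t) Φ(t) = 1`, where `Φ(t) = ∑ a_n t^n`. -/
def IsOdd {B : Type*} [Ring B] (a : ℕ → B) : Prop :=
  PowerSeries.mk (fun n => (-1) ^ n * a n) * PowerSeries.mk a = 1

theorem isOdd_iff {B : Type*} [Ring B] (a : ℕ → B) : IsOdd a ↔
    ∀ n, ∑ p ∈ antidiagonal n, (-1) ^ p.1 * (a p.1 * a p.2) = if n = 0 then 1 else 0 := by
  simp [IsOdd, PowerSeries.ext_iff, PowerSeries.coeff_mul, PowerSeries.coeff_one, mul_assoc]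

theorem rel_zero : rel R 0 = 1 := by simp [rel, Z]

theorem isOdd_mk : IsOdd fun n => Ideal.Quotient.mk (J R) (Z R n) := by
  rw [isOdd_iff]
  intro n
  have : ∑ p ∈ antidiagonal n, (-1) ^ p.1 *
      (Ideal.Quotient.mk (J R) (Z R p.1) * Ideal.Quotient.mk (J R) (Z R p.2)) = Ideal.Quotient.mk (J R) (rel R n) := by
    simp [rel]
  rw [this]
  split_ifs with h
  · subst h; simp [rel_zero]
  · exact Ideal.Quotient.eq_zero_iff_mem.2 (rel_mem_J R (by omega))

theorem IsOdd.map {B C : Type*} [Ring B] [Ring C] {a : ℕ → B} (h : IsOdd a) (f : B →+* C) :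
    IsOdd fun n => f (a n) := by
  rw [isOdd_iff] at h ⊢
  intro n
  have := congrArg f (h n)
  split_ifs at this ⊢ <;> simpa using this

theorem IsOdd.conv {B : Type*} [Ring B] {a b : ℕ → B} (ha : IsOdd a) (hb : IsOdd b)
    (hab : ∀ i j, Commute (a i) (b j)) :
    IsOdd fun n => ∑ p ∈ antidiagonal n, a p.1 * b p.2 := by
  have e1 : PowerSeries.mk (fun n => ∑ p ∈ antidiagonal n, a p.1 * b p.2) =
      PowerSeries.mk a * PowerSeries.mk b := by
    ext n; simp [PowerSeries.coeff_mul]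
  have e2 : PowerSeries.mk (fun n => (-1) ^ n * ∑ p ∈ antidiagonal n, a p.1 * b p.2) =
      PowerSeries.mk (fun n => (-1) ^ n * a n) * PowerSeries.mk (fun n => (-1) ^ n * b n) := by
    ext n
    simp only [PowerSeries.coeff_mul, PowerSeries.coeff_mk, Finset.mul_sum]
    refine Finset.sum_congr rfl fun p hp => ?_
    have e : (-1 : B) ^ n = (-1) ^ p.1 * (-1) ^ p.2 := by rw [← Finset.HasAntidiagonal.mem_antidiagonal.1 hp, pow_add]
    rw [e]
    have := ((Commute.neg_one_left (a p.1)).pow_left p.2).eq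
    rw [mul_assoc, mul_assoc, ← mul_assoc _ (a p.1), this, mul_assoc]
  have e3 : Commute (PowerSeries.mk (fun n => (-1) ^ n * b n)) (PowerSeries.mk a) := by
    ext n
    simp only [PowerSeries.coeff_mul, PowerSeries.coeff_mk]
    conv_rhs => rw [← Finset.Nat.sum_antidiagonal_swap]
    refine Finset.sum_congr rfl fun p hp => ?_
    exact (((Commute.neg_one_left (a p.2)).pow_left _).mul_left (hab _ _).symm).eq
  unfold IsOdd at *
  rw [e1, e2, mul_assoc, ← mul_assoc _ (PowerSeries.mk a), e3.eq, mul_assoc, hb, mul_one, ha]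

/-- The canonical map from `R⟨Z₁, Z₂, …⟩` to a ring in which `Φ(-t) Φ(t) = 1` kills `J`. -/
theorem eq_zero_of_isOdd {B : Type*} [Ring B] (f : FreeLH R →+* B) (h : IsOdd fun n => f (Z R n))
    {x : FreeLH R} (hx : x ∈ J R) : f x = 0 := by
  refine J_le_ker R f (fun n hn => ?_) hx
  have := (isOdd_iff _).1 h n
  rw [if_neg (by omega)] at this
  simpa [rel] using this

theorem mk_chiZ (n : ℕ) :
    Ideal.Quotient.mk (J R) (chiZ R n) = (-1) ^ n * Ideal.Quotient.mk (J R) (Z R n) := by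
  have h1 : PowerSeries.mk (fun n => Ideal.Quotient.mk (J R) (Z R n)) *
      PowerSeries.mk (fun n => Ideal.Quotient.mk (J R) (chiZ R n)) = 1 := by
    ext n
    have := congrArg (Ideal.Quotient.mk (J R)) (sum_mul_chiZ R n)
    simp only [PowerSeries.coeff_mul, PowerSeries.coeff_mk, PowerSeries.coeff_one]
    split_ifs at this ⊢ <;> simpa using this
  have h2 := left_inv_eq_right_inv (isOdd_mk R) h1
  simpa using (congrArg (PowerSeries.coeff n) h2).symm

/-- `J` is a Hopf ideal. -/
instance : (J R).IsHopfIdeal R where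
  counit_eq_zero := by
    intro x hx
    refine eq_zero_of_isOdd R (counitHom R : FreeLH R →+* R) ?_ hx
    rw [isOdd_iff]
    intro n
    simp only [RingHom.coe_coe, counitHom_Z]
    split_ifs with h
    · subst h; simp
    · refine Finset.sum_eq_zero fun p hp => ?_
      rw [Finset.HasAntidiagonal.mem_antidiagonal] at hp
      split_ifs <;> simp
      omega
  map_mkQ_comul_eq_zero := by
    intro x hx
    refine eq_zero_of_isOdd R ((Algebra.TensorProduct.map (Ideal.Quotient.mkₐ R (J R))
      (Ideal.Quotient.mkₐ R (J R))).comp (comulHom R)).toRingHom ?_ hx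
    have ha := (isOdd_mk R).map (Algebra.TensorProduct.includeLeft :
      (FreeLH R ⧸ J R) →ₐ[R] (FreeLH R ⧸ J R) ⊗[R] (FreeLH R ⧸ J R)).toRingHom
    have hb := (isOdd_mk R).map (Algebra.TensorProduct.includeRight :
      (FreeLH R ⧸ J R) →ₐ[R] (FreeLH R ⧸ J R) ⊗[R] (FreeLH R ⧸ J R)).toRingHom
    convert ha.conv hb (fun i j => by simp [Commute, SemiconjBy]) using 2 with n
    simp [comulHom_Z]
  antipode_mem := by
    intro x hx
    rw [← Ideal.Quotient.eq_zero_iff_mem]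
    have := eq_zero_of_isOdd R (((RingHom.op (Ideal.Quotient.mk (J R))).comp
      (chiHom R : FreeLH R →+* (FreeLH R)ᵐᵒᵖ))) ?_ hx
    · exact MulOpposite.op_injective this
    · rw [isOdd_iff]
      intro n
      have h := (isOdd_iff _).1 (isOdd_mk R) n
      apply MulOpposite.unop_injective
      trans (if n = 0 then 1 else 0)
      swap
      · split_ifs <;> rfl
      rw [← h]
      conv_rhs => rw [← Finset.Nat.sum_antidiagonal_swap]
      rw [← MulOpposite.opAddEquiv_symm_apply, map_sum]
      refine Finset.sum_congr rfl fun p hp => ?_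
      simp [chiHom_apply, chi_Z, mk_chiZ]
      rcases neg_one_pow_eq_or (FreeLH R ⧸ J R) p.1 with e | e <;> simp [e, mul_assoc]

end FreeLH

/-! ### Convex polytopes and their faces -/

/-- A nonempty convex polytope in some `ℝ^m`: the convex hull of a nonempty finite set. -/
structure Polytope where
  /-- The dimension of the ambient space. -/
  ambient : ℕ
  /-- The underlying set of points. -/
  carrier : Set (Fin ambient → ℝ)
  exists_hull : ∃ S : Finset (Fin ambient → ℝ), S.Nonempty ∧ convexHull ℝ (S : Set _) = carrier

/-- The dimension of a set: the dimension of its affine span. -/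
noncomputable def affDim {m : ℕ} (s : Set (Fin m → ℝ)) : ℕ := Module.finrank ℝ (vectorSpan ℝ s)

/-- `F` is a nonempty face of the convex set `P`: the nonempty set of maximisers on `P` of some
linear functional. The functional may be zero, so `P` is a face of itself. -/
def IsFace {m : ℕ} (P F : Set (Fin m → ℝ)) : Prop := F.Nonempty ∧ IsExposed ℝ P F

theorem IsFace.exists {m : ℕ} {P F : Set (Fin m → ℝ)} (h : IsFace P F) :
    ∃ (l : StrongDual ℝ (Fin m → ℝ)) (c : ℝ), (∀ x ∈ P, l x ≤ c) ∧ F = {x ∈ P | l x = c} := by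
  obtain ⟨⟨x₀, hx₀⟩, h2⟩ := h
  obtain ⟨l, rfl⟩ := h2 ⟨x₀, hx₀⟩
  refine ⟨l, l x₀, hx₀.2, Set.ext fun x => ⟨fun hx => ⟨hx.1, le_antisymm (hx₀.2 x hx.1)
    (hx.2 x₀ hx₀.1)⟩, fun hx => ⟨hx.1, fun y hy => hx.2 ▸ hx₀.2 y hy⟩⟩⟩

theorem isFace_of {m : ℕ} {P F : Set (Fin m → ℝ)} (hF : F.Nonempty)
    (l : StrongDual ℝ (Fin m → ℝ)) (c : ℝ) (h1 : ∀ x ∈ P, l x ≤ c) (h2 : F = {x ∈ P | l x = c}) :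
    IsFace P F := by
  refine ⟨hF, fun _ => ⟨l, ?_⟩⟩
  subst h2
  obtain ⟨x₀, hx₀⟩ := hF
  exact Set.ext fun x => ⟨fun hx => ⟨hx.1, fun y hy => hx.2 ▸ h1 y hy⟩,
    fun hx => ⟨hx.1, le_antisymm (h1 x hx.1) (hx₀.2 ▸ hx.2 x₀ hx₀.1)⟩⟩

theorem IsFace.subset {m : ℕ} {P F : Set (Fin m → ℝ)} (h : IsFace P F) : F ⊆ P := h.2.subset

/-- A face of `conv S` is the convex hull of the points of `S` it contains. -/
theorem IsFace.eq_hull {m : ℕ} {S F : Set (Fin m → ℝ)} (h : IsFace (convexHull ℝ S) F) :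
    F = convexHull ℝ (S ∩ F) := by
  obtain ⟨l, c, h1, h2⟩ := h.exists
  have hle : ∀ s ∈ S, l s ≤ c := fun s hs => h1 s (subset_convexHull ℝ S hs)
  have hmem : ∀ s ∈ S, l s = c → s ∈ F := fun s hs he => by
    rw [h2]; exact ⟨subset_convexHull ℝ S hs, he⟩
  have hFc : Convex ℝ F := h.2.convex (convex_convexHull ℝ S)
  apply Set.Subset.antisymm
  · intro x hx
    have hx' : x ∈ convexHull ℝ (S ∩ F ∪ S \ F) := by
      rw [Set.inter_union_sdiff]; exact h.subset hx
    have hxc : l x = c := by rw [h2] at hx; exact hx.2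
    have hlt : ∀ y ∈ convexHull ℝ (S \ F), l y < c := by
      intro y hy
      have hconv : Convex ℝ {y : Fin m → ℝ | l y < c} := convex_halfSpace_lt l.isLinear c
      refine convexHull_min (fun s hs => ?_) hconv hy
      exact lt_of_le_of_ne (hle s hs.1) fun he => hs.2 (hmem s hs.1 he)
    rcases (S ∩ F).eq_empty_or_nonempty with hA | hA
    · rw [hA, Set.empty_union] at hx'
      exact absurd hxc (hlt x hx').ne
    rcases (S \ F).eq_empty_or_nonempty with hB | hB
    · rwa [hB, Set.union_empty] at hx'
    rw [convexHull_union hA hB, mem_convexJoin] at hx'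
    obtain ⟨a, ha, b, hb, α, β, hα, hβ, hαβ, rfl⟩ := hx'
    have haF : a ∈ F := convexHull_min Set.inter_subset_right hFc ha
    have hac : l a = c := by rw [h2] at haF; exact haF.2
    have hbc := hlt b hb
    simp only [map_add, map_smul, smul_eq_mul, hac] at hxc
    have hβ0 : β = 0 := by
      by_contra hne
      have hpos : 0 < β := lt_of_le_of_ne hβ (Ne.symm hne)
      have : α * c + β * l b < α * c + β * c := by nlinarith
      rw [← add_mul, hαβ, one_mul] at this
      exact absurd hxc this.ne
    have hα1 : α = 1 := by linarith
    simpa [hβ0, hα1] using ha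
  · exact convexHull_min Set.inter_subset_right hFc

/-- A face of a face of a polytope is a face of the polytope. -/
theorem IsFace.trans {m : ℕ} {S : Finset (Fin m → ℝ)} {F G : Set (Fin m → ℝ)}
    (hF : IsFace (convexHull ℝ (S : Set _)) F) (hG : IsFace F G) :
    IsFace (convexHull ℝ (S : Set _)) G := by
  obtain ⟨l, c, h1, h2⟩ := hF.exists
  obtain ⟨l', c', h1', h2'⟩ := hG.exists
  have hle : ∀ s ∈ S, l s ≤ c := fun s hs => h1 s (subset_convexHull ℝ _ hs)
  have hN : ∀ᶠ N : ℝ in Filter.atTop, ∀ s ∈ S, l' s - c' ≤ N * (c - l s) := by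
    rw [Filter.eventually_all_finset]
    intro s hs
    rcases (hle s hs).eq_or_lt with he | hlt
    · refine Filter.Eventually.of_forall fun N => ?_
      have : s ∈ F := by rw [h2]; exact ⟨subset_convexHull ℝ _ hs, he⟩
      have := h1' s this
      rw [he]; linarith
    · filter_upwards [Filter.eventually_ge_atTop ((l' s - c') / (c - l s))] with N hN
      rwa [div_le_iff₀ (by linarith)] at hN
  obtain ⟨N, hN⟩ := hN.exists
  have key : ∀ x ∈ convexHull ℝ (S : Set (Fin m → ℝ)), l' x + N * l x ≤ c' + N * c := by
    intro x hx
    have hconv : Convex ℝ {y : Fin m → ℝ | (l' + N • l) y ≤ c' + N * c} :=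
      convex_halfSpace_le (l' + N • l).isLinear _
    refine convexHull_min (fun s hs => ?_) hconv hx
    have := hN s hs
    simp only [Set.mem_ofPred_eq, add_apply, smul_apply, smul_eq_mul]
    linarith
  refine isFace_of hG.1 (l' + (N + 1) • l) (c' + (N + 1) * c) (fun x hx => ?_) ?_
  · have := key x hx
    have := h1 x hx
    simp only [add_apply, smul_apply, smul_eq_mul]
    linarith
  · ext x
    simp only [add_apply, smul_apply, smul_eq_mul,
      Set.mem_ofPred_eq]
    constructor
    · intro hx
      have hxF := hG.subset hx
      rw [h2'] at hx
      rw [h2] at hxF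
      refine ⟨hxF.1, ?_⟩
      rw [hx.2, hxF.2]
    · rintro ⟨hx, he⟩
      have k := key x hx
      have k' := h1 x hx
      have e1 : l x = c := by linarith
      rw [h2', h2]
      exact ⟨⟨hx, e1⟩, by rw [e1] at he; linarith⟩

theorem IsFace.mono {m : ℕ} {P F G : Set (Fin m → ℝ)} (hG : IsFace P G) (hF : IsFace P F)
    (h : G ⊆ F) : IsFace F G := ⟨hG.1, hG.2.mono hF.subset h⟩

namespace Polytope

/-- The nonempty faces of `P` (including `P` itself), ordered by inclusion. -/
abbrev Face (P : Polytope) : Type := {F : Set (Fin P.ambient → ℝ) // IsFace P.carrier F}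

theorem Face.eq_hull {P : Polytope} {S : Finset (Fin P.ambient → ℝ)}
    (hP : convexHull ℝ (S : Set _) = P.carrier) (F : P.Face) :
    F.1 = convexHull ℝ ((S : Set _) ∩ F.1) := by
  have h : IsFace (convexHull ℝ (S : Set _)) F.1 := by rw [hP]; exact F.2
  exact h.eq_hull

instance (P : Polytope) : Finite P.Face := by
  obtain ⟨S, hS, hP⟩ := P.exists_hull
  have hfin : (S : Set (Fin P.ambient → ℝ)).powerset.Finite := S.finite_toSet.powerset
  have : Finite (S : Set (Fin P.ambient → ℝ)).powerset := hfin
  refine Finite.of_injective (fun F : P.Face =>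
    (⟨(S : Set _) ∩ F.1, Set.inter_subset_left⟩ : (S : Set (Fin P.ambient → ℝ)).powerset)) ?_
  intro F G h
  apply Subtype.ext
  rw [F.eq_hull hP, G.eq_hull hP]
  exact congrArg _ (congrArg Subtype.val h)

noncomputable instance (P : Polytope) : Fintype P.Face := Fintype.ofFinite _

/-- The dimension of a polytope. -/
noncomputable def dim (P : Polytope) : ℕ := affDim P.carrier

namespace Face

variable {P : Polytope}

/-- The dimension of a face. -/
noncomputable def dim (F : P.Face) : ℕ := affDim F.1

/-- A face of a polytope is a polytope. -/
def toPolytope (F : P.Face) : Polytope where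
  ambient := P.ambient
  carrier := F.1
  exists_hull := by
    classical
    obtain ⟨S, hS, hP⟩ := P.exists_hull
    have h := F.eq_hull hP
    refine ⟨S.filter (· ∈ F.1), ?_, ?_⟩
    · rw [← Finset.coe_nonempty, ← convexHull_nonempty_iff (𝕜 := ℝ), Finset.coe_filter]
      have h1 := F.2.1
      rw [h] at h1
      exact h1
    · rw [Finset.coe_filter]
      exact h.symm

/-- The faces of a face `F` are the faces contained in `F`. -/
def facesEquiv (F : P.Face) : F.toPolytope.Face ≃o {G : P.Face // G ≤ F} where
  toFun G := ⟨⟨G.1, by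
    obtain ⟨S, hS, hP⟩ := P.exists_hull
    have h : IsFace (convexHull ℝ (S : Set _)) F.1 := by rw [hP]; exact F.2
    rw [← hP]
    exact h.trans G.2⟩, G.2.subset⟩
  invFun G := ⟨G.1.1, G.1.2.mono F.2 G.2⟩
  left_inv _ := rfl
  right_inv _ := rfl
  map_rel_iff' := Iff.rfl

end Face

/-- Two polytopes are combinatorially equivalent if there is a bijection between their faces
which preserves inclusions (in both directions) and dimensions. (The second condition is implied
by the first, since dimensions are ranks in the face lattice.) -/
def CombEquiv (P Q : Polytope) : Prop := ∃ e : P.Face ≃o Q.Face, ∀ F, (e F).dim = F.dim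

theorem CombEquiv.refl (P : Polytope) : CombEquiv P P := ⟨OrderIso.refl _, fun _ => rfl⟩

theorem CombEquiv.symm {P Q : Polytope} : CombEquiv P Q → CombEquiv Q P := fun ⟨e, he⟩ =>
  ⟨e.symm, fun F => by rw [← he, e.apply_symm_apply]⟩

theorem CombEquiv.trans {P Q T : Polytope} : CombEquiv P Q → CombEquiv Q T → CombEquiv P T :=
  fun ⟨e, he⟩ ⟨e', he'⟩ => ⟨e.trans e', fun F => by rw [OrderIso.trans_apply, he', he]⟩

instance setoid : Setoid Polytope := ⟨CombEquiv, CombEquiv.refl, CombEquiv.symm, CombEquiv.trans⟩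

/-- The polytope `P` as a face of itself. -/
def top (P : Polytope) : P.Face := ⟨P.carrier, by
  obtain ⟨S, hS, hP⟩ := P.exists_hull
  exact ⟨hP ▸ (convexHull_nonempty_iff.2 hS), IsExposed.refl P.carrier⟩⟩

theorem le_top {P : Polytope} (F : P.Face) : F ≤ P.top := F.2.subset

theorem CombEquiv.dim_eq {P Q : Polytope} : CombEquiv P Q → P.dim = Q.dim := by
  rintro ⟨e, he⟩
  have h : e P.top = Q.top := le_antisymm (le_top _) (by
    rw [← e.apply_symm_apply Q.top, e.le_iff_le]; exact le_top _)
  have := he P.top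
  rw [h] at this
  exact this.symm

/-- Corresponding faces of equivalent polytopes are equivalent. -/
theorem CombEquiv.face {P Q : Polytope} (e : P.Face ≃o Q.Face) (he : ∀ F, (e F).dim = F.dim)
    (F : P.Face) : CombEquiv F.toPolytope (e F).toPolytope := by
  let e1 : {G : P.Face // G ≤ F} ≃o {G : Q.Face // G ≤ e F} :=
    { toFun := fun G => ⟨e G.1, e.le_iff_le.2 G.2⟩
      invFun := fun G => ⟨e.symm G.1, by rw [← e.le_iff_le, e.apply_symm_apply]; exact G.2⟩
      left_inv := fun G => by simp
      right_inv := fun G => by simp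
      map_rel_iff' := by intro a b; exact e.le_iff_le }
  exact ⟨F.facesEquiv.trans (e1.trans (e F).facesEquiv.symm), fun G => he (F.facesEquiv G).1⟩

end Polytope

/-! ### The product of polytopes -/

/-- The product `A × B ⊆ ℝ^(m+n)` of `A ⊆ ℝ^m` and `B ⊆ ℝ^n`. -/
def prodSet {m n : ℕ} (A : Set (Fin m → ℝ)) (B : Set (Fin n → ℝ)) : Set (Fin (m + n) → ℝ) :=
  Set.image2 Fin.append A B

/-- Concatenation of vectors as a linear isomorphism. -/
def appendL (m n : ℕ) : ((Fin m → ℝ) × (Fin n → ℝ)) ≃ₗ[ℝ] (Fin (m + n) → ℝ) where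
  toEquiv := Fin.appendEquiv m n
  map_add' x y := by
    ext i
    refine Fin.addCases (fun i => ?_) (fun i => ?_) i <;> simp [Fin.appendEquiv]
  map_smul' c x := by
    ext i
    refine Fin.addCases (fun i => ?_) (fun i => ?_) i <;> simp [Fin.appendEquiv]

theorem prodSet_eq {m n : ℕ} (A : Set (Fin m → ℝ)) (B : Set (Fin n → ℝ)) :
    prodSet A B = (appendL m n) '' (A ×ˢ B) := by
  rw [prodSet, ← Set.image_prod]; rfl

theorem append_mem_prodSet {m n : ℕ} {A : Set (Fin m → ℝ)} {B : Set (Fin n → ℝ)}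
    {x : Fin m → ℝ} {y : Fin n → ℝ} : Fin.append x y ∈ prodSet A B ↔ x ∈ A ∧ y ∈ B := by
  rw [prodSet_eq]
  change appendL m n (x, y) ∈ _ ↔ _
  rw [(appendL m n).injective.mem_set_image, Set.mem_prod]

theorem exists_append {m n : ℕ} (z : Fin (m + n) → ℝ) :
    ∃ (x : Fin m → ℝ) (y : Fin n → ℝ), Fin.append x y = z :=
  ⟨_, _, (appendL m n).apply_symm_apply z⟩

theorem prodSet_subset_iff {m n : ℕ} {A A' : Set (Fin m → ℝ)} {B B' : Set (Fin n → ℝ)}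
    (hA : A.Nonempty) (hB : B.Nonempty) : prodSet A B ⊆ prodSet A' B' ↔ A ⊆ A' ∧ B ⊆ B' := by
  rw [prodSet_eq, prodSet_eq, Set.image_subset_image_iff (appendL m n).injective,
    Set.prod_subset_prod_iff]
  simp [hA.ne_empty, hB.ne_empty]

theorem finrank_prod_submodule {V W : Type*} [AddCommGroup V] [AddCommGroup W] [Module ℝ V]
    [Module ℝ W] (p : Submodule ℝ V) (q : Submodule ℝ W) :
    Module.finrank ℝ (p.prod q) = Module.finrank ℝ (p × q) :=
  LinearEquiv.finrank_eq
    { toFun := fun x => (⟨x.1.1, x.2.1⟩, ⟨x.1.2, x.2.2⟩)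
      invFun := fun x => ⟨(x.1.1, x.2.1), x.1.2, x.2.2⟩
      map_add' := fun _ _ => rfl
      map_smul' := fun _ _ => rfl
      left_inv := fun _ => rfl
      right_inv := fun _ => rfl }

theorem affDim_prodSet {m n : ℕ} {A : Set (Fin m → ℝ)} {B : Set (Fin n → ℝ)}
    (hA : A.Nonempty) (hB : B.Nonempty) : affDim (prodSet A B) = affDim A + affDim B := by
  rw [affDim, prodSet_eq]
  have h' : vectorSpan ℝ ((appendL m n) '' (A ×ˢ B)) =
      (vectorSpan ℝ (A ×ˢ B)).map (appendL m n).toLinearMap :=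
    ((appendL m n).toLinearMap.toAffineMap.map_vectorSpan (s := A ×ˢ B)).symm
  rw [h', LinearEquiv.finrank_map_eq, vectorSpan_prod_eq hA hB,
    finrank_prod_submodule, Module.finrank_prod]
  rfl

theorem convexHull_prodSet {m n : ℕ} (A : Set (Fin m → ℝ)) (B : Set (Fin n → ℝ)) :
    convexHull ℝ (prodSet A B) = prodSet (convexHull ℝ A) (convexHull ℝ B) := by
  rw [prodSet_eq, prodSet_eq, ← convexHull_prod]
  exact ((appendL m n).toLinearMap.image_convexHull _).symm

theorem IsFace.prod {m n : ℕ} {P F : Set (Fin m → ℝ)} {Q G : Set (Fin n → ℝ)}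
    (hF : IsFace P F) (hG : IsFace Q G) : IsFace (prodSet P Q) (prodSet F G) := by
  obtain ⟨l, c, h1, h2⟩ := hF.exists
  obtain ⟨l', c', h1', h2'⟩ := hG.exists
  let e : (Fin (m + n) → ℝ) →ₗ[ℝ] ℝ :=
    (l.toLinearMap.coprod l'.toLinearMap) ∘ₗ (appendL m n).symm.toLinearMap
  have he : ∀ x y, LinearMap.toContinuousLinearMap e (Fin.append x y) = l x + l' y := by
    intro x y
    change (l.toLinearMap.coprod l'.toLinearMap) ((appendL m n).symm (appendL m n (x, y))) = _
    rw [LinearEquiv.symm_apply_apply]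
    rfl
  refine isFace_of (Set.Nonempty.image2 hF.1 hG.1) (LinearMap.toContinuousLinearMap e) (c + c') ?_ ?_
  · rintro _ ⟨x, hx, y, hy, rfl⟩
    rw [he]
    exact add_le_add (h1 x hx) (h1' y hy)
  · ext z
    obtain ⟨x, y, rfl⟩ := exists_append z
    rw [append_mem_prodSet, Set.mem_ofPred_eq, append_mem_prodSet, he, h2, h2']
    constructor
    · rintro ⟨hx, hy⟩
      exact ⟨⟨hx.1, hy.1⟩, by rw [hx.2, hy.2]⟩
    · rintro ⟨⟨hx, hy⟩, h⟩
      have := h1 x hx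
      have := h1' y hy
      exact ⟨⟨hx, by linarith⟩, hy, by linarith⟩

theorem IsFace.exists_prod {m n : ℕ} {P : Set (Fin m → ℝ)} {Q : Set (Fin n → ℝ)}
    {H : Set (Fin (m + n) → ℝ)} (h : IsFace (prodSet P Q) H) :
    ∃ F G, IsFace P F ∧ IsFace Q G ∧ prodSet F G = H := by
  obtain ⟨l, c, h1, h2⟩ := h.exists
  obtain ⟨z, hz⟩ := h.1
  obtain ⟨x₀, y₀, rfl⟩ := exists_append z
  have hz' := h.subset hz
  rw [append_mem_prodSet] at hz'
  let l₁ : StrongDual ℝ (Fin m → ℝ) := LinearMap.toContinuousLinearMap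
    (l.toLinearMap ∘ₗ (appendL m n).toLinearMap ∘ₗ LinearMap.inl ℝ _ _)
  let l₂ : StrongDual ℝ (Fin n → ℝ) := LinearMap.toContinuousLinearMap
    (l.toLinearMap ∘ₗ (appendL m n).toLinearMap ∘ₗ LinearMap.inr ℝ _ _)
  have hl : ∀ x y, l (Fin.append x y) = l₁ x + l₂ y := by
    intro x y
    change l (appendL m n (x, y)) = l (appendL m n (x, 0)) + l (appendL m n (0, y))
    rw [← map_add, ← map_add]
    simp
  have hc : l₁ x₀ + l₂ y₀ = c := by
    rw [h2] at hz
    rw [← hl]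
    exact hz.2
  have a1 : ∀ x ∈ P, l₁ x ≤ l₁ x₀ := fun x hx => by
    have := h1 _ (append_mem_prodSet.2 ⟨hx, hz'.2⟩)
    rw [hl] at this
    linarith
  have a2 : ∀ y ∈ Q, l₂ y ≤ l₂ y₀ := fun y hy => by
    have := h1 _ (append_mem_prodSet.2 ⟨hz'.1, hy⟩)
    rw [hl] at this
    linarith
  refine ⟨{x ∈ P | l₁ x = l₁ x₀}, {y ∈ Q | l₂ y = l₂ y₀},
    isFace_of ⟨x₀, hz'.1, rfl⟩ l₁ _ a1 rfl, isFace_of ⟨y₀, hz'.2, rfl⟩ l₂ _ a2 rfl, ?_⟩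
  ext z
  obtain ⟨x, y, rfl⟩ := exists_append z
  rw [append_mem_prodSet, h2, Set.mem_ofPred_eq, Set.mem_ofPred_eq, Set.mem_ofPred_eq,
    append_mem_prodSet, hl]
  constructor
  · rintro ⟨hx, hy⟩
    exact ⟨⟨hx.1, hy.1⟩, by rw [hx.2, hy.2, hc]⟩
  · rintro ⟨⟨hx, hy⟩, h⟩
    have := a1 x hx
    have := a2 y hy
    exact ⟨⟨hx, by linarith⟩, hy, by linarith⟩

namespace Polytope

/-- The product of two polytopes. -/
def prod (P Q : Polytope) : Polytope where
  ambient := P.ambient + Q.ambient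
  carrier := prodSet P.carrier Q.carrier
  exists_hull := by
    classical
    obtain ⟨S, hS, hP⟩ := P.exists_hull
    obtain ⟨T, hT, hQ⟩ := Q.exists_hull
    refine ⟨Finset.image₂ Fin.append S T, hS.image₂ hT, ?_⟩
    rw [Finset.coe_image₂, ← hP, ← hQ]
    exact convexHull_prodSet _ _

/-- The faces of a product are the products of faces. -/
noncomputable def facesProd (P Q : Polytope) : P.Face × Q.Face ≃o (P.prod Q).Face :=
  RelIso.ofSurjective (OrderEmbedding.ofMapLEIff
    (fun F => (⟨prodSet F.1.1 F.2.1, F.1.2.prod F.2.2⟩ : (P.prod Q).Face))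
    (fun F _ => prodSet_subset_iff F.1.2.1 F.2.2.1)) (by
      rintro ⟨H, hH⟩
      obtain ⟨F, G, hF, hG, rfl⟩ := IsFace.exists_prod hH
      exact ⟨(⟨F, hF⟩, ⟨G, hG⟩), rfl⟩)

theorem dim_facesProd {P Q : Polytope} (F : P.Face × Q.Face) :
    (facesProd P Q F).dim = F.1.dim + F.2.dim := affDim_prodSet F.1.2.1 F.2.2.1

/-- The product of two order isomorphisms. -/
def prodIso {A B C D : Type*} [LE A] [LE B] [LE C] [LE D] (e : A ≃o B) (f : C ≃o D) :
    A × C ≃o B × D where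
  toEquiv := e.toEquiv.prodCongr f.toEquiv
  map_rel_iff' := and_congr e.le_iff_le f.le_iff_le

theorem combEquiv_prod {P P' Q Q' : Polytope} :
    CombEquiv P P' → CombEquiv Q Q' → CombEquiv (P.prod Q) (P'.prod Q') := by
  rintro ⟨e, he⟩ ⟨f, hf⟩
  refine ⟨(facesProd P Q).symm.trans ((prodIso e f).trans (facesProd P' Q')), fun H => ?_⟩
  obtain ⟨F, rfl⟩ := (facesProd P Q).surjective H
  simp only [OrderIso.trans_apply, OrderIso.symm_apply_apply, dim_facesProd]
  exact congrArg₂ _ (he _) (hf _)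

theorem prod_comm (P Q : Polytope) : CombEquiv (P.prod Q) (Q.prod P) := by
  refine ⟨(facesProd P Q).symm.trans (OrderIso.prodComm.trans (facesProd Q P)), fun H => ?_⟩
  obtain ⟨F, rfl⟩ := (facesProd P Q).surjective H
  simp only [OrderIso.trans_apply, OrderIso.symm_apply_apply, dim_facesProd]
  exact add_comm _ _

theorem prod_assoc (P Q T : Polytope) :
    CombEquiv ((P.prod Q).prod T) (P.prod (Q.prod T)) := by
  refine ⟨(facesProd (P.prod Q) T).symm.trans
    ((prodIso (facesProd P Q).symm (OrderIso.refl _)).trans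
      ((OrderIso.prodAssoc _ _ _).trans
        ((prodIso (OrderIso.refl _) (facesProd Q T)).trans (facesProd P (Q.prod T))))),
    fun H => ?_⟩
  obtain ⟨⟨F, C⟩, rfl⟩ := (facesProd (P.prod Q) T).surjective H
  obtain ⟨⟨A, B⟩, rfl⟩ := (facesProd P Q).surjective F
  have h : (prodIso (facesProd P Q).symm (OrderIso.refl T.Face)) (facesProd P Q (A, B), C) =
      ((A, B), C) := Prod.ext ((facesProd P Q).symm_apply_apply _) rfl
  simp only [OrderIso.trans_apply, OrderIso.symm_apply_apply, h, dim_facesProd]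
  change A.dim + (facesProd Q T (B, C)).dim = _
  rw [dim_facesProd, add_assoc]

/-- The point. -/
def point : Polytope where
  ambient := 0
  carrier := Set.univ
  exists_hull := ⟨{0}, by simp, by simp [Set.eq_univ_iff_forall, eq_iff_true_of_subsingleton]⟩

instance : Unique point.Face where
  default := point.top
  uniq F := by
    apply Subtype.ext
    obtain ⟨x, hx⟩ := F.2.1
    refine Set.eq_univ_of_forall fun y => ?_
    have : y = x := funext fun i => i.elim0
    rwa [this]

theorem dim_point (F : point.Face) : F.dim = 0 := by
  have h : Module.finrank ℝ (Fin point.ambient → ℝ) = 0 := Module.finrank_fin_fun ℝ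
  exact Nat.le_zero.1 (h ▸ Submodule.finrank_le _)

theorem prod_point (P : Polytope) : CombEquiv (P.prod point) P := by
  refine ⟨(facesProd P point).symm.trans 
    { toFun := fun F => F.1
      invFun := fun F => (F, default)
      left_inv := fun F => Prod.ext rfl (Subsingleton.elim _ _)
      right_inv := fun _ => rfl
      map_rel_iff' := fun {F G} =>
        ⟨fun h => ⟨h, (Subsingleton.elim F.2 G.2).le⟩, fun h => h.1⟩ }, fun H => ?_⟩
  obtain ⟨⟨F, C⟩, rfl⟩ := (facesProd P point).surjective H
  simp [dim_facesProd, dim_point]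

end Polytope

/-! ### The ring of polytopes and the operators `d_k` -/

/-- Combinatorial polytopes: polytopes up to combinatorial equivalence. -/
def CombPolytope : Type := Quotient Polytope.setoid

namespace CombPolytope

/-- The combinatorial type of a polytope. -/
def mk (P : Polytope) : CombPolytope := Quotient.mk Polytope.setoid P

/-- Multiplication is the product of polytopes; the unit is the point. -/
instance : CommMonoid CombPolytope where
  mul := Quotient.map₂ Polytope.prod fun _ _ h _ _ h' => Polytope.combEquiv_prod h h'
  one := mk Polytope.point
  mul_assoc := by
    rintro ⟨P⟩ ⟨Q⟩ ⟨T⟩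
    exact Quotient.sound (Polytope.prod_assoc P Q T)
  mul_comm := by
    rintro ⟨P⟩ ⟨Q⟩
    exact Quotient.sound (Polytope.prod_comm P Q)
  mul_one := by
    rintro ⟨P⟩
    exact Quotient.sound (Polytope.prod_point P)
  one_mul := by
    rintro ⟨P⟩
    exact Quotient.sound ((Polytope.prod_comm _ _).trans (Polytope.prod_point P))

end CombPolytope

/-- The ring of polytopes: the free abelian group on the combinatorial polytopes, with the
product of polytopes as multiplication. -/
abbrev PolytopeRing : Type := MonoidAlgebra ℤ CombPolytope

/-- The basis element of the ring of polytopes given by a polytope `P`. -/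
noncomputable def cls (P : Polytope) : PolytopeRing := MonoidAlgebra.single (CombPolytope.mk P) 1

open Classical in
/-- The sum of the faces `F` of `P` with `dim F = dim P - k`. -/
noncomputable def faceSum (k : ℕ) (P : Polytope) : PolytopeRing :=
  ∑ F : P.Face with F.dim + k = P.dim, cls F.toPolytope

theorem faceSum_congr (k : ℕ) {P Q : Polytope} (h : P.CombEquiv Q) :
    faceSum k P = faceSum k Q := by
  classical
  obtain ⟨e, he⟩ := id h
  refine Finset.sum_equiv e.toEquiv (fun F => ?_) (fun F _ => ?_)
  · simp only [Finset.mem_filter, Finset.mem_univ, true_and]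
    change _ ↔ (e F).dim + k = Q.dim
    rw [he, h.dim_eq]
  · exact congrArg (fun c => MonoidAlgebra.single c (1 : ℤ))
      (Quotient.sound (Polytope.CombEquiv.face e he F))

/-- The operator `d_k` on the ring of polytopes: it sends a polytope `P` to the sum of all its
faces of dimension `dim P - k`. -/
noncomputable def d (k : ℕ) : Module.End ℤ PolytopeRing :=
  (MonoidAlgebra.basis CombPolytope ℤ).constr ℤ
    (Quotient.lift (faceSum k) fun _ _ h => faceSum_congr k h)

theorem d_cls (k : ℕ) (P : Polytope) : d k (cls P) = faceSum k P :=
  Module.Basis.constr_basis _ ℤ _ (CombPolytope.mk P)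

/-- The ring of operators `𝒟`: the subring of `Hom_ℤ(𝒫, 𝒫)`, with composition as
multiplication, generated by the `d_k`, `k ≥ 1`. -/
noncomputable def OpRing : Subring (Module.End ℤ PolytopeRing) :=
  Subring.closure (d '' {k | 1 ≤ k})

/-- The operators `d_k` as elements of `𝒟`, with `d_0 = 1`. -/
noncomputable def opD : ℕ → OpRing
  | 0 => 1
  | k + 1 => ⟨d (k + 1), Subring.subset_closure ⟨k + 1, Nat.succ_pos k, rfl⟩⟩

end PolytopeAlgebra

open PolytopeAlgebra

/-! The heart of the matter is that the kernel of the action `ev : Z_k ↦ d_k` of the free algebra on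
the ring of polytopes is exactly `J` (`ev_eq_zero_iff`). This identifies `𝒟` with `𝒵/J` as a ring,
and the rest is formal.

The kernel contains `J`. The coefficient of a face `G` in `∑ (-1)^i d_i d_j P` is, up to sign, the
sum of `(-1)^(dim F)` over the faces `F ⊇ G` of `P`, which vanishes for `G ≠ P`
(`sum_faces_ge_eq_zero`). This Euler relation is proved in the dual space: the faces above `G`
correspond to the cells of the closed normal cone of `G`, a cell having the codimension of its face
as dimension, and the alternating sum of cells is zero for a closed cone cut out by inequalities
that some vector satisfies strictly (`cellSum_inter_nonneg`).

The kernel is no larger. Modulo `J` the product `Z_1 Z_{k+1}` is a combination of words starting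
with a letter of index at least 2, so every element is congruent to a combination of words in which
`Z_1` occurs at most as the last letter (`normalFormsAddJ_eq_top`). Such combinations act faithfully
(`eq_zero_of_ev_eq_zero`). The test polytopes are built with the prism operator `I` and the pyramid
operator `C`. With `δ` the derivation `Z_k ↦ Z_{k-1}`, one has `x I = I x + 2 δ(x)` always, and `x C
= C x + δ(x)` as long as the degree of `x` does not exceed the dimension. Hence `I - 2C` commutes
with operators of low degree, and the apex of the pyramid makes this fail in top degree by a
multiple of the number of polytopes: this reads off the first letter. The commutator `IC - CI` gives
zero, after counting, in low degrees and detects the next degree: this separates the first letters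
from one another (`normalForm_eq_zero`).

Formal part: in a Leibnitz-Hopf algebra the counit and antipode on the `h n` are forced, the
antipode being the inverse of the series `Φ(t)`; so `χ(h n) = (-1)^n h n` means `Φ(-t) Φ(t) = 1`,
which is the universal property of `𝒵/J`. The Milnor rule spreads from the generators, where it is
the Leibniz rule for faces of products. -/

namespace PolytopeAlgebra

/-! ### Euler characteristics of unions of cells of a hyperplane arrangement -/

section CellSum

variable {V : Type*} [NormedAddCommGroup V] [NormedSpace ℝ V]

/-- The subspace of `W` on which the functionals `a i` with `σ i = 0` vanish. -/
def cellSpan {n : ℕ} (a : Fin n → V →ₗ[ℝ] ℝ) (W : Submodule ℝ V) (σ : Fin n → SignType) :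
    Submodule ℝ V := W ⊓ ⨅ i, ⨅ (_ : σ i = 0), LinearMap.ker (a i)

/-- `X ∩ W` contains a point of the cell with sign vector `σ`. -/
def MeetsCell {n : ℕ} (a : Fin n → V →ₗ[ℝ] ℝ) (W : Submodule ℝ V) (X : Set V)
    (σ : Fin n → SignType) : Prop := ∃ x ∈ X, x ∈ W ∧ ∀ i, SignType.sign (a i x) = σ i

open Classical in
/-- The sum of `(-1) ^ dim c` over the cells `c` of the arrangement `a` in `W` which meet `X`. -/
noncomputable def cellSum {n : ℕ} (a : Fin n → V →ₗ[ℝ] ℝ) (W : Submodule ℝ V) (X : Set V) : ℤ :=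
  ∑ σ : Fin n → SignType,
    if MeetsCell a W X σ then (-1) ^ Module.finrank ℝ (cellSpan a W σ) else 0

theorem cellSum_eq_zero {n : ℕ} (a : Fin n → V →ₗ[ℝ] ℝ) {W : Submodule ℝ V} {X : Set V}
    (h : ∀ x ∈ X, x ∉ W) : cellSum a W X = 0 :=
  Finset.sum_eq_zero fun _ _ => if_neg fun ⟨x, hx, hW, _⟩ => h x hx hW

/-- On a cell the sign of `a i` is constant, so each cell meeting `X` is counted in exactly one of
the two parts. -/
theorem cellSum_split {n : ℕ} (a : Fin n → V →ₗ[ℝ] ℝ) (W : Submodule ℝ V) (X : Set V) (i : Fin n) :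
    cellSum a W X = cellSum a W (X ∩ {x | 0 ≤ a i x}) + cellSum a W (X ∩ {x | a i x < 0}) := by
  rw [cellSum, cellSum, cellSum, ← Finset.sum_add_distrib]
  refine Finset.sum_congr rfl fun σ _ => ?_
  by_cases hσ : σ i = -1
  · have h1 : ¬ MeetsCell a W (X ∩ {x | 0 ≤ a i x}) σ := by
      rintro ⟨x, ⟨-, hx⟩, -, hs⟩
      have := hs i
      rw [hσ, sign_eq_neg_one_iff] at this
      exact absurd hx (not_le.2 this)
    have h2 : MeetsCell a W X σ ↔ MeetsCell a W (X ∩ {x | a i x < 0}) σ := by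
      refine ⟨fun ⟨x, hx, hW, hs⟩ => ⟨x, ⟨hx, ?_⟩, hW, hs⟩, fun ⟨x, hx, hW, hs⟩ => ⟨x, hx.1, hW, hs⟩⟩
      have := hs i
      rwa [hσ, sign_eq_neg_one_iff] at this
    rw [if_neg h1, zero_add]
    classical exact if_congr h2 rfl rfl
  · have h1 : ¬ MeetsCell a W (X ∩ {x | a i x < 0}) σ := by
      rintro ⟨x, ⟨-, hx⟩, -, hs⟩
      exact hσ ((hs i).symm.trans (sign_eq_neg_one_iff.2 hx))
    have h2 : MeetsCell a W X σ ↔ MeetsCell a W (X ∩ {x | 0 ≤ a i x}) σ := by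
      refine ⟨fun ⟨x, hx, hW, hs⟩ => ⟨x, ⟨hx, ?_⟩, hW, hs⟩, fun ⟨x, hx, hW, hs⟩ => ⟨x, hx.1, hW, hs⟩⟩
      by_contra hlt
      exact hσ ((hs i).symm.trans (sign_eq_neg_one_iff.2 (not_le.1 hlt)))
    rw [if_neg h1, add_zero]
    classical exact if_congr h2 rfl rfl

theorem meetsCell_cons {n : ℕ} (h : V →ₗ[ℝ] ℝ) (a : Fin n → V →ₗ[ℝ] ℝ) (W : Submodule ℝ V)
    (X : Set V) (s : SignType) (σ : Fin n → SignType) :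
    MeetsCell (Fin.cons h a : Fin (n + 1) → V →ₗ[ℝ] ℝ) W X (Fin.cons s σ) ↔
      MeetsCell a W (X ∩ {x | SignType.sign (h x) = s}) σ := by
  simp only [MeetsCell, Fin.forall_fin_succ, Fin.cons_zero, Fin.cons_succ, Set.mem_inter_iff,
    Set.mem_ofPred_eq]
  exact ⟨fun ⟨x, h1, h2, h3, h4⟩ => ⟨x, ⟨h1, h3⟩, h2, h4⟩,
    fun ⟨x, ⟨h1, h3⟩, h2, h4⟩ => ⟨x, h1, h2, h3, h4⟩⟩

theorem cellSpan_cons {n : ℕ} (h : V →ₗ[ℝ] ℝ) (a : Fin n → V →ₗ[ℝ] ℝ) (W : Submodule ℝ V)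
    (s : SignType) (σ : Fin n → SignType) :
    cellSpan (Fin.cons h a : Fin (n + 1) → V →ₗ[ℝ] ℝ) W (Fin.cons s σ) =
      cellSpan a (if s = 0 then W ⊓ LinearMap.ker h else W) σ := by
  ext x
  by_cases hs : s = 0 <;>
  simp [cellSpan, Submodule.mem_inf, Submodule.mem_iInf, Fin.forall_fin_succ, hs, and_assoc]

/-- A new hyperplane `h` cuts `W` into two open halves and the section `W ⊓ ker h`; the cells inside
the section are cells of `a` in that smaller subspace. This is what makes induction on the number of
hyperplanes possible, and why `W` is a parameter. -/
theorem cellSum_cons {n : ℕ} (h : V →ₗ[ℝ] ℝ) (a : Fin n → V →ₗ[ℝ] ℝ) (W : Submodule ℝ V)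
    (X : Set V) : cellSum (Fin.cons h a : Fin (n + 1) → V →ₗ[ℝ] ℝ) W X =
      cellSum a W (X ∩ {x | 0 < h x}) + cellSum a (W ⊓ LinearMap.ker h) X +
        cellSum a W (X ∩ {x | h x < 0}) := by
  have e : ∀ s : SignType, (∑ σ : Fin n → SignType, open Classical in
      if MeetsCell (Fin.cons h a : Fin (n + 1) → V →ₗ[ℝ] ℝ) W X (Fin.cons s σ) then
        (-1 : ℤ) ^ Module.finrank ℝ (cellSpan (Fin.cons h a : Fin (n + 1) → V →ₗ[ℝ] ℝ) W
          (Fin.cons s σ)) else 0) =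
      cellSum a (if s = 0 then W ⊓ LinearMap.ker h else W) (X ∩ {x | SignType.sign (h x) = s}) := by
    intro s
    refine Finset.sum_congr rfl fun σ _ => ?_
    rw [cellSpan_cons]
    have : MeetsCell (Fin.cons h a : Fin (n + 1) → V →ₗ[ℝ] ℝ) W X (Fin.cons s σ) ↔
        MeetsCell a (if s = 0 then W ⊓ LinearMap.ker h else W)
          (X ∩ {x | SignType.sign (h x) = s}) σ := by
      rw [meetsCell_cons]
      split_ifs with hs
      · subst hs
        refine ⟨fun ⟨x, hx, hW, h'⟩ => ⟨x, hx, ⟨hW, sign_eq_zero_iff.1 hx.2⟩, h'⟩,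
          fun ⟨x, hx, hW, h'⟩ => ⟨x, hx, hW.1, h'⟩⟩
      · rfl
    classical exact if_congr this rfl rfl
  have e0 : cellSum a (W ⊓ LinearMap.ker h) (X ∩ {x | SignType.sign (h x) = 0}) =
      cellSum a (W ⊓ LinearMap.ker h) X := by
    refine Finset.sum_congr rfl fun σ _ => ?_
    have : MeetsCell a (W ⊓ LinearMap.ker h) (X ∩ {x | SignType.sign (h x) = 0}) σ ↔
        MeetsCell a (W ⊓ LinearMap.ker h) X σ :=
      ⟨fun ⟨x, hx, hW, h'⟩ => ⟨x, hx.1, hW, h'⟩,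
        fun ⟨x, hx, hW, h'⟩ => ⟨x, ⟨hx, sign_eq_zero_iff.2 hW.2⟩, hW, h'⟩⟩
    classical exact if_congr this rfl rfl
  rw [cellSum, ← Equiv.sum_comp (Fin.consEquiv fun _ => SignType), Fintype.sum_prod_type]
  refine (Finset.sum_congr rfl fun s _ => e s).trans ?_
  have hu : (Finset.univ : Finset SignType) = {0, -1, 1} := rfl
  rw [hu, Finset.sum_insert (by decide), Finset.sum_insert (by decide), Finset.sum_singleton,
    if_pos rfl, if_neg (by decide), if_neg (by decide), e0]
  simp only [sign_eq_one_iff, sign_eq_neg_one_iff]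
  ring

variable [FiniteDimensional ℝ V]

theorem isOpen_pos (h : V →ₗ[ℝ] ℝ) : IsOpen {x | 0 < h x} :=
  isOpen_lt continuous_const h.continuous_of_finiteDimensional

theorem isOpen_neg (h : V →ₗ[ℝ] ℝ) : IsOpen {x | h x < 0} :=
  isOpen_lt h.continuous_of_finiteDimensional continuous_const

theorem finrank_inf_ker {W : Submodule ℝ V} {h : V →ₗ[ℝ] ℝ} {w : V} (hw : w ∈ W) (hne : h w ≠ 0) :
    Module.finrank ℝ W = Module.finrank ℝ (W ⊓ LinearMap.ker h : Submodule ℝ V) + 1 := by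
  have h1 := LinearMap.finrank_range_add_finrank_ker (h.domRestrict W)
  have h2 : LinearMap.range (h.domRestrict W) = ⊤ :=
    LinearMap.range_eq_top.2 (LinearMap.surjective fun h0 => hne (by
      simpa using LinearMap.congr_fun h0 ⟨w, hw⟩))
  have h3 : Module.finrank ℝ (LinearMap.ker (h.domRestrict W)) =
      Module.finrank ℝ (W ⊓ LinearMap.ker h : Submodule ℝ V) := by
    rw [LinearMap.ker_domRestrict, inf_comm, ← Submodule.finrank_map_subtype_eq,
      Submodule.map_comap_subtype]
    rw [inf_comm]
  rw [h2, finrank_top, Module.finrank_self] at h1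
  omega

/-- A relatively open convex set has Euler characteristic `(-1) ^ dim`, whatever the arrangement
that subdivides it. -/
theorem cellSum_of_isOpen {n : ℕ} (a : Fin n → V →ₗ[ℝ] ℝ) (W : Submodule ℝ V) (X : Set V)
    (ho : IsOpen X) (hc : Convex ℝ X) (hne : ∃ x ∈ X, x ∈ W) :
    cellSum a W X = (-1) ^ Module.finrank ℝ W := by
  induction n generalizing W X with
  | zero =>
    obtain ⟨x, hx, hW⟩ := hne
    simp only [cellSum, Finset.univ_unique, Finset.sum_singleton]
    rw [if_pos ⟨x, hx, hW, fun i => i.elim0⟩]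
    rw [cellSpan, iInf_of_empty, inf_top_eq]
  | succ n ih =>
    obtain ⟨h, a, rfl⟩ : ∃ h a', a = Fin.cons h a' := ⟨a 0, Fin.tail a, (Fin.cons_self_tail a).symm⟩
    rw [cellSum_cons]
    have ihp := ih a W (X ∩ {x | 0 < h x}) (ho.inter (isOpen_pos h))
      (hc.inter (convex_halfSpace_gt h.isLinear 0))
    have ihn := ih a W (X ∩ {x | h x < 0}) (ho.inter (isOpen_neg h))
      (hc.inter (convex_halfSpace_lt h.isLinear 0))
    have ih0 := ih a (W ⊓ LinearMap.ker h) X ho hc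
    have zp : (∀ x ∈ X, x ∈ W → ¬ 0 < h x) → cellSum a W (X ∩ {x | 0 < h x}) = 0 :=
      fun H => cellSum_eq_zero a fun x hx hW => H x hx.1 hW hx.2
    have zn : (∀ x ∈ X, x ∈ W → ¬ h x < 0) → cellSum a W (X ∩ {x | h x < 0}) = 0 :=
      fun H => cellSum_eq_zero a fun x hx hW => H x hx.1 hW hx.2
    -- Three cases. If `h` vanishes on `W`, only the middle term survives and nothing changes. If
    -- `h` has a zero on `X ∩ W`, all three terms are present and `(-1)^d + (-1)^(d-1) + (-1)^d =
    -- (-1)^d`. Otherwise `X ∩ W` lies on one side and a single term remains.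
    by_cases hW : W ≤ LinearMap.ker h
    · have h0 : ∀ x ∈ W, h x = 0 := fun x hx => hW hx
      rw [zp fun x _ hx => by rw [h0 x hx]; exact lt_irrefl _,
        zn fun x _ hx => by rw [h0 x hx]; exact lt_irrefl _, inf_eq_left.2 hW]
      rw [ih a W X ho hc hne]; ring
    · obtain ⟨w, hw, hw0⟩ := SetLike.not_le_iff_exists.1 hW
      rw [LinearMap.mem_ker] at hw0
      by_cases hz : ∃ x ∈ X, x ∈ W ∧ h x = 0
      · obtain ⟨x, hx, hxW, hx0⟩ := hz
        -- Since `X` is open, small steps from `x` along `w` and `-w` stay in `X`, and they reach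
        -- both sides of the hyperplane.
        have hcont : Filter.Tendsto (fun t : ℝ => x + t • w) (nhds 0) (nhds x) := by
          have : Continuous fun t : ℝ => x + t • w := by fun_prop
          simpa using this.tendsto 0
        have hev := hcont.eventually (ho.mem_nhds hx)
        obtain ⟨ε, hε, hball⟩ := Metric.eventually_nhds_iff.1 hev
        have key : ∀ t : ℝ, |t| < ε → x + t • w ∈ X := fun t ht => hball (by simpa using ht)
        have hval : ∀ t : ℝ, h (x + t • w) = t * h w := fun t => by simp [hx0]
        have hmemW : ∀ t : ℝ, x + t • w ∈ W := fun t => W.add_mem hxW (W.smul_mem t hw)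
        have hp2 : ε / 2 > 0 := by linarith
        have k1 : x + (ε / 2) • w ∈ X := key _ (by rw [abs_of_pos hp2]; linarith)
        have k2 : x + (-(ε / 2)) • w ∈ X := key _ (by rw [abs_neg, abs_of_pos hp2]; linarith)
        have hpos : ∃ x ∈ X ∩ {x | 0 < h x}, x ∈ W := by
          rcases lt_or_gt_of_ne hw0 with hlt | hlt
          · exact ⟨_, ⟨k2, by rw [Set.mem_ofPred_eq, hval]; nlinarith⟩, hmemW _⟩
          · exact ⟨_, ⟨k1, by rw [Set.mem_ofPred_eq, hval]; positivity⟩, hmemW _⟩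
        have hneg : ∃ x ∈ X ∩ {x | h x < 0}, x ∈ W := by
          rcases lt_or_gt_of_ne hw0 with hlt | hlt
          · exact ⟨_, ⟨k1, by rw [Set.mem_ofPred_eq, hval]; nlinarith⟩, hmemW _⟩
          · exact ⟨_, ⟨k2, by rw [Set.mem_ofPred_eq, hval]; nlinarith⟩, hmemW _⟩
        rw [ihp hpos, ihn hneg, ih0 ⟨x, hx, hxW, hx0⟩, finrank_inf_ker hw hw0]
        ring
      · have hz' : ∀ x ∈ X, x ∉ W ⊓ LinearMap.ker h := fun x hx hxW => hz ⟨x, hx, hxW.1, hxW.2⟩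
        rw [cellSum_eq_zero a hz']
        obtain ⟨x, hx, hxW⟩ := hne
        -- If `h` took both signs, the segment `[y, z]` would cross the hyperplane inside `X ∩ W`;
        -- the coefficients below give the crossing point.
        have hsame : ∀ y ∈ X, y ∈ W → ∀ z ∈ X, z ∈ W → 0 < h y → ¬ h z < 0 := by
          intro y hy hyW z hz₁ hzW hpos hneg
          have hd : 0 < h y - h z := by linarith
          refine hz ⟨(-h z / (h y - h z)) • y + (h y / (h y - h z)) • z,
            hc hy hz₁ (by apply div_nonneg <;> linarith) (by apply div_nonneg <;> linarith)
              (by field_simp; ring), W.add_mem (W.smul_mem _ hyW) (W.smul_mem _ hzW), ?_⟩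
          simp only [map_add, map_smul, smul_eq_mul]
          field_simp
          ring
        rcases lt_trichotomy (h x) 0 with hlt | heq | hgt
        · rw [zp fun y hy hyW hpos => hsame y hy hyW x hx hxW hpos hlt, ihn ⟨x, ⟨hx, hlt⟩, hxW⟩]
          ring
        · exact absurd ⟨x, hx, hxW, heq⟩ hz
        · rw [zn fun y hy hyW hneg => hsame x hx hxW y hy hyW hgt hneg, ihp ⟨x, ⟨hx, hgt⟩, hxW⟩]
          ring

/-- If `X` is stable under translation by `-t v`, `t ≥ 0`, and `a i v > 0` for `i ∈ I`, then the
part of `X` where all `a i`, `i ∈ I`, are nonnegative has Euler characteristic zero. -/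
theorem cellSum_inter_nonneg {n : ℕ} (a : Fin n → V →ₗ[ℝ] ℝ) (W : Submodule ℝ V) {v : V}
    (hv : v ∈ W) (I : Finset (Fin n)) (hI : ∀ i ∈ I, 0 < a i v) (X : Set V) (ho : IsOpen X)
    (hc : Convex ℝ X) (hX : ∀ x ∈ X, ∀ t : ℝ, 0 ≤ t → x - t • v ∈ X) (hne : ∃ x ∈ X, x ∈ W) :
    cellSum a W (X ∩ {x | ∀ i ∈ I, 0 ≤ a i x}) =
      if I = ∅ then (-1) ^ Module.finrank ℝ W else 0 := by
  classical
  -- Adding the constraint `0 ≤ a i` subtracts from the value for `X` the value for `X ∩ {a i < 0}`,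
  -- which is again open, convex and stable under `-t v`. By induction both have the same value, so
  -- the difference is zero. For this `X` must vary in the induction.
  induction I using Finset.induction_on generalizing X with
  | empty => simpa using cellSum_of_isOpen a W X ho hc hne
  | insert i I hi ih =>
    have hI' : ∀ j ∈ I, 0 < a j v := fun j hj => hI j (Finset.mem_insert_of_mem hj)
    have hiv : 0 < a i v := hI i (Finset.mem_insert_self i I)
    have h1 := ih hI' X ho hc hX hne
    have h2 := ih hI' (X ∩ {x | a i x < 0}) (ho.inter (isOpen_neg _))
      (hc.inter (convex_halfSpace_lt (a i).isLinear 0))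
      (fun x hx t ht => ⟨hX x hx.1 t ht, by
        have : a i x < 0 := hx.2
        simp only [Set.mem_ofPred_eq, map_sub, map_smul, smul_eq_mul]
        nlinarith [mul_nonneg ht hiv.le]⟩)
      (by
        obtain ⟨x, hx, hxW⟩ := hne
        -- Moving far enough along `-v` makes `a i` negative: here its value becomes `a i x - |a i
        -- x| - 1`.
        refine ⟨x - ((|a i x| + 1) / a i v) • v, ⟨hX x hx _ (by positivity), ?_⟩,
          W.sub_mem hxW (W.smul_mem _ hv)⟩
        simp only [Set.mem_ofPred_eq, map_sub, map_smul, smul_eq_mul]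
        rw [div_mul_cancel₀ _ hiv.ne']
        linarith [le_abs_self (a i x)])
    rw [cellSum_split a W _ i] at h1
    have e1 : X ∩ {x | ∀ j ∈ I, 0 ≤ a j x} ∩ {x | 0 ≤ a i x} =
        X ∩ {x | ∀ j ∈ insert i I, 0 ≤ a j x} := by
      ext x; simp only [Set.mem_inter_iff, Set.mem_ofPred_eq, Finset.forall_mem_insert]; tauto
    have e2 : X ∩ {x | ∀ j ∈ I, 0 ≤ a j x} ∩ {x | a i x < 0} =
        X ∩ {x | a i x < 0} ∩ {x | ∀ j ∈ I, 0 ≤ a j x} := by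
      ext x; simp only [Set.mem_inter_iff]; tauto
    rw [e1, e2, h2] at h1
    rw [if_neg (Finset.insert_ne_empty i I)]
    linarith

end CellSum

/-! ### The Euler relation for intervals of the face lattice -/

/-- The functionals which are constant on `insert g A`. -/
def constOn {m : ℕ} (g : Fin m → ℝ) (A : Set (Fin m → ℝ)) :
    Submodule ℝ (StrongDual ℝ (Fin m → ℝ)) where
  carrier := {l | ∀ x ∈ A, l x = l g}
  zero_mem' _ _ := rfl
  add_mem' h h' x hx := congrArg₂ (· + ·) (h x hx) (h' x hx)
  smul_mem' c _ h x hx := congrArg (c • ·) (h x hx)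

/-- Being constant on `A` means annihilating the direction space of `A`. This converts the dimension
of a cell of the normal cone into the codimension of a face. -/
theorem finrank_constOn {m : ℕ} {g : Fin m → ℝ} {A : Set (Fin m → ℝ)} (hg : g ∈ A) :
    affDim A + Module.finrank ℝ (constOn g A) = m := by
  have h : constOn g A = (Submodule.dualAnnihilator (vectorSpan ℝ A)).map
      (LinearMap.toContinuousLinearMap (𝕜 := ℝ) (E := Fin m → ℝ) (F' := ℝ)).toLinearMap := by
    rw [vectorSpan_eq_span_vsub_set_right ℝ hg]
    ext l
    constructor
    · intro hl
      refine ⟨l.toLinearMap, ?_, rfl⟩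
      rw [SetLike.mem_coe, Submodule.mem_dualAnnihilator]
      intro w hw
      induction hw using Submodule.span_induction with
      | mem x hx =>
        obtain ⟨y, hy, rfl⟩ := hx
        simpa [sub_eq_zero] using hl y hy
      | zero => simp
      | add x y _ _ hx hy => rw [map_add, hx, hy, add_zero]
      | smul c x _ hx => rw [map_smul, hx, smul_zero]
    · rintro ⟨l, hl, rfl⟩ x hx
      have := (Submodule.mem_dualAnnihilator l).1 hl _ (Submodule.subset_span ⟨x, hx, rfl⟩)
      simpa [sub_eq_zero] using this
  rw [h, LinearEquiv.finrank_map_eq, affDim, Subspace.finrank_add_finrank_dualAnnihilator_eq,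
    Module.finrank_fin_fun]

open Classical in
/-- The Euler relation for the interval `[G, P]` of the face lattice of `P`. -/
theorem sum_faces_ge_eq_zero {P : Polytope} {G : P.Face} (hG : G ≠ P.top) :
    ∑ F : P.Face with G ≤ F, (-1 : ℤ) ^ F.dim = 0 := by
  obtain ⟨S, hS, hP⟩ := P.exists_hull
  obtain ⟨g, hg⟩ := G.2.1
  let s : Fin S.card → (Fin P.ambient → ℝ) := fun i => (S.equivFin.symm i : _)
  have hsS : ∀ i, s i ∈ S := fun i => (S.equivFin.symm i).2
  have hSs : ∀ x ∈ S, ∃ i, s i = x := fun x hx => ⟨S.equivFin ⟨x, hx⟩, by simp [s]⟩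
  have hsP : ∀ i, s i ∈ P.carrier := fun i => hP ▸ subset_convexHull ℝ _ (hsS i)
  -- The arrangement lives in the dual space: `a i` compares the value of a functional at `g ∈ G`
  -- with its value at the point `s i` spanning `P`. A functional attains its maximum on all of `G`
  -- exactly when it lies in `W` and all `a i` are nonnegative on it.
  let a : Fin S.card → StrongDual ℝ (Fin P.ambient → ℝ) →ₗ[ℝ] ℝ := fun i =>
    (ContinuousLinearMap.apply ℝ ℝ (g - s i)).toLinearMap
  have ha : ∀ i l, a i l = l g - l (s i) := fun i l => map_sub l g (s i)
  let W := constOn g G.1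
  let I : Finset (Fin S.card) := Finset.univ.filter fun i => s i ∉ G.1
  have hull : ∀ F : P.Face, F.1 = convexHull ℝ ((S : Set _) ∩ F.1) := fun F => F.eq_hull hP
  -- The functional exposing `G` is the vector strictly inside the cone: `a i v > 0` whenever `s i ∉
  -- G`.
  obtain ⟨v, c, hv1, hv2⟩ := G.2.exists
  have hvg : v g = c := by rw [hv2] at hg; exact hg.2
  have hvW : v ∈ W := fun x hx => by rw [hv2] at hx; rw [hx.2, hvg]
  have hI : ∀ i ∈ I, 0 < a i v := by
    intro i hi
    rw [ha, hvg, sub_pos]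
    refine lt_of_le_of_ne (hv1 _ (hsP i)) fun he => (Finset.mem_filter.1 hi).2 ?_
    rw [hv2]
    exact ⟨hsP i, he⟩
  -- This is where `G ≠ P` enters: otherwise the cone would be the whole subspace `W` and its Euler
  -- characteristic would be `±1`.
  have hIne : I ≠ ∅ := by
    intro h
    refine hG (le_antisymm (Polytope.le_top G) ?_)
    change P.carrier ⊆ G.1
    have hsub : (S : Set (Fin P.ambient → ℝ)) ⊆ S ∩ G.1 := fun x hx => ⟨hx, ?_⟩
    · exact hP.symm.subset.trans ((convexHull_mono hsub).trans (hull G).symm.subset)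
    obtain ⟨i, rfl⟩ := hSs x hx
    by_contra hn
    have : i ∈ I := Finset.mem_filter.2 ⟨Finset.mem_univ i, hn⟩
    simp [h] at this
  have key := cellSum_inter_nonneg a W hvW I hI Set.univ isOpen_univ convex_univ
    (fun _ _ _ _ => trivial) ⟨v, trivial, hvW⟩
  rw [if_neg hIne, cellSum, ← Finset.sum_filter] at key
  have hle : ∀ l ∈ W, (∀ i ∈ I, 0 ≤ a i l) → ∀ x ∈ P.carrier, l x ≤ l g := by
    intro l hl hnn x hx
    rw [← hP] at hx
    have hconv : Convex ℝ {y : Fin P.ambient → ℝ | l y ≤ l g} :=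
      convex_halfSpace_le l.isLinear _
    refine convexHull_min (fun y hy => ?_) hconv hx
    obtain ⟨i, rfl⟩ := hSs y hy
    by_cases hi : s i ∈ G.1
    · exact (hl _ hi).le
    · have := hnn i (Finset.mem_filter.2 ⟨Finset.mem_univ i, hi⟩)
      rw [ha] at this
      exact sub_nonneg.1 this
  have hgP : g ∈ P.carrier := G.2.subset hg
  -- All functionals exposing `F` have the same sign vector, and it determines which of the points
  -- `s i` lie in `F`, hence `F`.
  let σ : P.Face → Fin S.card → SignType := fun F i => if s i ∈ F.1 then 0 else 1
  have hσ : ∀ F i, σ F i = 0 ↔ s i ∈ F.1 := fun F i => by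
    by_cases h : s i ∈ F.1 <;> simp [σ, h]
  -- `F ↦ σ F` is a bijection from the faces above `G` to the cells of the closed cone. The cell has
  -- dimension `ambient - dim F`, which has the parity of `ambient + dim F`; the sum avoids natural
  -- subtraction.
  have hsum : ∑ F : P.Face with G ≤ F, (-1 : ℤ) ^ (P.ambient + F.dim) = 0 := by
    refine Eq.trans ?_ key
    refine Finset.sum_bij (fun F _ => σ F) ?_ ?_ ?_ ?_
    · intro F hF
      have hGF : G.1 ⊆ F.1 := (Finset.mem_filter.1 hF).2
      obtain ⟨l, c, h1, h2⟩ := F.2.exists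
      have hlg : l g = c := by have := hGF hg; rw [h2] at this; exact this.2
      refine Finset.mem_filter.2 ⟨Finset.mem_univ _, l, ⟨trivial, fun i _ => ?_⟩, fun x hx => ?_,
        fun i => ?_⟩
      · rw [ha, hlg]; exact sub_nonneg.2 (h1 _ (hsP i))
      · have := hGF hx; rw [h2] at this; rw [hlg, this.2]
      · rw [ha, hlg]
        by_cases hi : s i ∈ F.1
        · rw [(hσ F i).2 hi, sign_eq_zero_iff]
          rw [h2] at hi
          rw [hi.2, sub_self]
        · have : σ F i = 1 := if_neg hi
          rw [this, sign_eq_one_iff, sub_pos]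
          refine lt_of_le_of_ne (h1 _ (hsP i)) fun he => hi ?_
          rw [h2]
          exact ⟨hsP i, he⟩
    · intro F _ F' _ h
      apply Subtype.ext
      rw [hull F, hull F']
      congr 1
      ext x
      simp only [Set.mem_inter_iff, SetLike.mem_coe, and_congr_right_iff]
      intro hx
      obtain ⟨i, rfl⟩ := hSs x hx
      rw [← hσ F i, ← hσ F' i]
      exact Eq.congr_left (congrFun h i)
    · intro τ hτ
      -- A functional of the cell `τ` exposes the face that maps to `τ`.
      obtain ⟨l, ⟨-, hnn⟩, hlW, hs⟩ := (Finset.mem_filter.1 hτ).2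
      have hll := hle l hlW hnn
      let F : P.Face := ⟨{x ∈ P.carrier | l x = l g}, isFace_of ⟨g, hgP, rfl⟩ l _ hll rfl⟩
      refine ⟨F, Finset.mem_filter.2 ⟨Finset.mem_univ _, fun x hx => ⟨G.2.subset hx, hlW x hx⟩⟩, ?_⟩
      funext i
      rw [← hs i, ha]
      by_cases hi : s i ∈ F.1
      · rw [(hσ F i).2 hi, hi.2, sub_self, sign_zero]
      · have : σ F i = 1 := if_neg hi
        rw [this, eq_comm, sign_eq_one_iff, sub_pos]
        exact lt_of_le_of_ne (hll _ (hsP i)) fun he => hi ⟨hsP i, he⟩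
    · intro F hF
      have hGF : G.1 ⊆ F.1 := (Finset.mem_filter.1 hF).2
      have e : cellSpan a W (σ F) = constOn g F.1 := by
        ext l
        simp only [cellSpan, Submodule.mem_inf, Submodule.mem_iInf, hσ, LinearMap.mem_ker, ha]
        constructor
        · rintro ⟨h1, h2⟩
          have hconv : Convex ℝ {y : Fin P.ambient → ℝ | l y = l g} :=
            convex_hyperplane l.isLinear _
          intro x hx
          rw [hull F] at hx
          refine convexHull_min (fun y hy => ?_) hconv hx
          obtain ⟨i, rfl⟩ := hSs y hy.1
          exact (sub_eq_zero.1 (h2 i hy.2)).symm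
        · intro h
          exact ⟨fun x hx => h x (hGF hx), fun i hi => by rw [h _ hi, sub_self]⟩
      have hd := finrank_constOn (hGF hg)
      rw [e]
      have hFd : F.dim = affDim F.1 := rfl
      have : P.ambient + F.dim = Module.finrank ℝ (constOn g F.1) + 2 * F.dim := by omega
      rw [this, pow_add, pow_mul]
      simp
  simp only [pow_add, ← Finset.mul_sum] at hsum
  exact (mul_eq_zero.1 hsum).resolve_left (pow_ne_zero _ (by norm_num))

/-! ### First properties of the operators `d_k` -/

theorem Polytope.Face.dim_mono {P : Polytope} {F G : P.Face} (h : F ≤ G) : F.dim ≤ G.dim := by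
  have h' : F.1 ⊆ G.1 := h
  exact Submodule.finrank_mono (vectorSpan_mono ℝ h')

theorem Polytope.Face.dim_le {P : Polytope} (F : P.Face) : F.dim ≤ P.dim := by
  have h : F.dim ≤ P.top.dim := Polytope.Face.dim_mono (Polytope.le_top F)
  exact h

/-- The functional exposing `F` kills the directions of `F`; when these are all directions of `P`,
it is constant on `P` and exposes everything. -/
theorem Polytope.Face.eq_top {P : Polytope} {F : P.Face} (h : F.dim = P.dim) : F = P.top := by
  refine le_antisymm (Polytope.le_top F) ?_
  obtain ⟨l, c, h1, h2⟩ := F.2.exists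
  obtain ⟨x₀, hx₀⟩ := F.2.1
  have hs : vectorSpan ℝ F.1 = vectorSpan ℝ P.carrier :=
    Submodule.eq_of_le_of_finrank_eq (vectorSpan_mono ℝ F.2.subset) h
  have hk : vectorSpan ℝ F.1 ≤ LinearMap.ker l.toLinearMap := by
    rw [vectorSpan, Submodule.span_le]
    rintro _ ⟨x, hx, y, hy, rfl⟩
    rw [h2] at hx hy
    change l (x - y) = 0
    rw [map_sub, hx.2, hy.2, sub_self]
  intro x hx
  rw [h2]
  refine ⟨hx, ?_⟩
  have hv : x -ᵥ x₀ ∈ vectorSpan ℝ P.carrier := vsub_mem_vectorSpan ℝ hx (F.2.subset hx₀)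
  rw [← hs] at hv
  have h0 : l (x - x₀) = 0 := hk hv
  rw [h2] at hx₀
  rw [map_sub, hx₀.2, sub_eq_zero] at h0
  exact h0

@[elab_as_elim]
theorem polytopeRing_induction {p : PolytopeRing → Prop} (x : PolytopeRing)
    (cls : ∀ P, p (cls P)) (zero : p 0) (add : ∀ x y, p x → p y → p (x + y))
    (smul : ∀ (c : ℤ) x, p x → p (c • x)) : p x := by
  induction x using MonoidAlgebra.induction_linear with
  | zero => exact zero
  | add x y hx hy => exact add x y hx hy
  | single c n =>
    obtain ⟨P, rfl⟩ := Quotient.exists_rep c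
    have := smul n _ (cls P)
    rwa [PolytopeAlgebra.cls, MonoidAlgebra.smul_single, smul_eq_mul, mul_one] at this

theorem end_ext {M : Type*} [AddCommGroup M] {f g : PolytopeRing →ₗ[ℤ] M}
    (h : ∀ P, f (cls P) = g (cls P)) : f = g := by
  refine LinearMap.ext fun x => ?_
  induction x using polytopeRing_induction with
  | cls P => exact h P
  | zero => simp
  | add x y hx hy => rw [map_add, map_add, hx, hy]
  | smul c x hx => rw [map_smul, map_smul, hx]

theorem faceSum_zero (P : Polytope) : faceSum 0 P = cls P := by
  classical
  rw [faceSum, Finset.sum_eq_single P.top]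
  · rfl
  · intro F hF hne
    exact absurd (Polytope.Face.eq_top (by simpa using hF)) hne
  · intro h
    have h' : P.top.dim + 0 = P.dim := rfl
    exact absurd (Finset.mem_filter.2 ⟨Finset.mem_univ P.top, h'⟩) h

theorem d_zero : d 0 = 1 := end_ext fun P => by
  rw [d_cls, faceSum_zero]; rfl

open Classical in
-- This lets iterated `d_i d_j` be computed inside the single face poset of `P`.
theorem faceSum_face (k : ℕ) {P : Polytope} (F : P.Face) :
    faceSum k F.toPolytope = ∑ G : P.Face with G ≤ F ∧ G.dim + k = F.dim, cls G.toPolytope := by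
  rw [faceSum]
  refine Finset.sum_bij (fun G _ => (F.facesEquiv G).1) ?_ ?_ ?_ ?_
  · intro G hG
    exact Finset.mem_filter.2 ⟨Finset.mem_univ _, (F.facesEquiv G).2, (Finset.mem_filter.1 hG).2⟩
  · intro G _ G' _ h
    exact F.facesEquiv.injective (Subtype.ext h)
  · intro G hG
    obtain ⟨-, h1, h2⟩ := Finset.mem_filter.1 hG
    exact ⟨F.facesEquiv.symm ⟨G, h1⟩, Finset.mem_filter.2 ⟨Finset.mem_univ _, h2⟩, rfl⟩
  · intro G _
    rfl

open Classical in
/-- The relations `∑_{i + j = n} (-1)^i d_i d_j = 0` for `n ≥ 1`. -/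
theorem sum_neg_one_pow_d_mul_d {n : ℕ} (hn : 1 ≤ n) :
    ∑ p ∈ antidiagonal n, (-1 : ℤ) ^ p.1 • (d p.1 * d p.2) = 0 := by
  apply end_ext
  intro P
  -- The face `F` fixes `p`, since `p.2` must be its codimension. Written with this equality as the
  -- outer condition, the later sum over `p` collapses to one term for each pair `G ≤ F`.
  have h1 : ∀ p : ℕ × ℕ, p ∈ antidiagonal n → ((-1 : ℤ) ^ p.1 • (d p.1 * d p.2)) (cls P) =
      ∑ G : P.Face, ∑ F : P.Face, if p.2 = P.dim - F.dim then
        (if G ≤ F ∧ G.dim + n = P.dim then ((-1 : ℤ) ^ (F.dim - G.dim)) • cls G.toPolytope else 0)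
        else 0 := by
    intro p hp
    rw [Finset.HasAntidiagonal.mem_antidiagonal] at hp
    rw [LinearMap.smul_apply, Module.End.mul_apply, d_cls, faceSum, map_sum, Finset.sum_comm,
      Finset.smul_sum, Finset.sum_filter]
    refine Finset.sum_congr rfl fun F _ => ?_
    have hF := F.dim_le
    by_cases h : F.dim + p.2 = P.dim
    · rw [if_pos h, d_cls, faceSum_face, Finset.sum_filter, Finset.smul_sum]
      refine Finset.sum_congr rfl fun G _ => ?_
      have hp2 : p.2 = P.dim - F.dim := by omega
      rw [if_pos hp2]
      have e : (G ≤ F ∧ G.dim + p.1 = F.dim) ↔ (G ≤ F ∧ G.dim + n = P.dim) := by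
        refine and_congr_right fun _ => ?_
        omega
      by_cases h2 : G ≤ F ∧ G.dim + n = P.dim
      · rw [if_pos h2, if_pos (e.2 h2)]
        have : p.1 = F.dim - G.dim := by have := (e.2 h2).2; omega
        rw [this]
      · rw [if_neg h2, if_neg fun h3 => h2 (e.1 h3), smul_zero]
    · rw [if_neg h]
      symm
      refine Finset.sum_eq_zero fun G _ => ?_
      rw [if_neg (by omega)]
  rw [LinearMap.sum_apply, Finset.sum_congr rfl h1, Finset.sum_comm, LinearMap.zero_apply]
  refine Finset.sum_eq_zero fun G _ => ?_
  rw [Finset.sum_comm]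
  by_cases hG : G.dim + n = P.dim
  · have hne : G ≠ P.top := by
      rintro rfl
      have : P.top.dim = P.dim := rfl
      omega
    have h2 : ∀ F : P.Face, (∑ p ∈ antidiagonal n, if p.2 = P.dim - F.dim then
        (if G ≤ F ∧ G.dim + n = P.dim then ((-1 : ℤ) ^ (F.dim - G.dim)) • cls G.toPolytope else 0)
        else 0) = if G ≤ F then ((-1 : ℤ) ^ F.dim) • ((-1 : ℤ) ^ G.dim • cls G.toPolytope)
          else 0 := by
      intro F
      have hF := F.dim_le
      by_cases hGF : G ≤ F
      · have hd := Polytope.Face.dim_mono hGF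
        rw [Finset.sum_eq_single (F.dim - G.dim, P.dim - F.dim), if_pos rfl, if_pos ⟨hGF, hG⟩,
          if_pos hGF, smul_smul]
        · congr 1
          have : F.dim + G.dim = (F.dim - G.dim) + 2 * G.dim := by omega
          rw [← pow_add, this, pow_add, pow_mul]
          simp
        · rintro ⟨i, j⟩ hij hne
          rw [if_neg]
          rintro rfl
          apply hne
          rw [Finset.HasAntidiagonal.mem_antidiagonal] at hij
          ext <;> simp only at hij ⊢; omega
        · intro h
          exact absurd (Finset.HasAntidiagonal.mem_antidiagonal.2 (by simp only; omega)) h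
      · simp [hGF]
    rw [Finset.sum_congr rfl fun F _ => h2 F, ← Finset.sum_filter, ← Finset.sum_smul,
      sum_faces_ge_eq_zero hne, zero_smul]
  · simp [hG]

/-! ### The Leibniz rule on products of polytopes. -/

theorem cls_mul (P Q : Polytope) : cls P * cls Q = cls (P.prod Q) := by
  rw [cls, cls, MonoidAlgebra.single_mul_single, mul_one]; rfl

theorem Polytope.dim_prod (P Q : Polytope) : (P.prod Q).dim = P.dim + Q.dim :=
  affDim_prodSet P.top.2.1 Q.top.2.1

open Classical in
-- The faces of `P × Q` are the products `F × G` with codimensions adding up, so each face of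
-- codimension `k` occurs for exactly one `(i, j)` with `i + j = k`.
theorem faceSum_prod (k : ℕ) (P Q : Polytope) :
    faceSum k (P.prod Q) = ∑ p ∈ antidiagonal k, faceSum p.1 P * faceSum p.2 Q := by
  have h1 : faceSum k (P.prod Q) = ∑ F : P.Face, ∑ G : Q.Face,
      if F.dim + G.dim + k = P.dim + Q.dim then cls F.toPolytope * cls G.toPolytope else 0 := by
    rw [faceSum, Finset.sum_filter, ← Equiv.sum_comp (Polytope.facesProd P Q).toEquiv,
      Fintype.sum_prod_type]
    refine Finset.sum_congr rfl fun F _ => Finset.sum_congr rfl fun G _ => ?_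
    change (if (Polytope.facesProd P Q (F, G)).dim + k = _ then _ else _) = _
    rw [Polytope.dim_facesProd, Polytope.dim_prod, cls_mul]
    rfl
  have h2 : ∀ p ∈ antidiagonal k, faceSum p.1 P * faceSum p.2 Q = ∑ F : P.Face, ∑ G : Q.Face,
      if p = (P.dim - F.dim, Q.dim - G.dim) then
        (if F.dim + G.dim + k = P.dim + Q.dim then cls F.toPolytope * cls G.toPolytope else 0)
      else 0 := by
    intro p hp
    rw [Finset.HasAntidiagonal.mem_antidiagonal] at hp
    rw [faceSum, faceSum, Finset.sum_filter, Finset.sum_filter, Finset.sum_mul_sum]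
    refine Finset.sum_congr rfl fun F _ => Finset.sum_congr rfl fun G _ => ?_
    have hF := F.dim_le
    have hG := G.dim_le
    by_cases h : F.dim + p.1 = P.dim ∧ G.dim + p.2 = Q.dim
    · rw [if_pos h.1, if_pos h.2, if_pos (by ext <;> simp only <;> omega), if_pos (by omega)]
    · have : p ≠ (P.dim - F.dim, Q.dim - G.dim) := by
        rintro rfl
        exact h ⟨by simp only; omega, by simp only; omega⟩
      rw [if_neg this]
      by_cases h' : F.dim + p.1 = P.dim
      · rw [if_neg fun h'' => h ⟨h', h''⟩, mul_zero]
      · rw [if_neg h', zero_mul]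
  rw [h1, Finset.sum_congr rfl h2]
  conv_rhs => rw [Finset.sum_comm]
  refine Finset.sum_congr rfl fun F _ => ?_
  conv_rhs => rw [Finset.sum_comm]
  refine Finset.sum_congr rfl fun G _ => ?_
  have hF := F.dim_le
  have hG := G.dim_le
  rw [Finset.sum_ite_eq']
  by_cases h : F.dim + G.dim + k = P.dim + Q.dim
  · rw [if_pos h, if_pos]
    rw [Finset.HasAntidiagonal.mem_antidiagonal]
    simp only
    omega
  · simp [h]

/-- The Leibniz rule for the operators `d_k`. -/
theorem d_mul (k : ℕ) (x y : PolytopeRing) :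
    d k (x * y) = ∑ p ∈ antidiagonal k, d p.1 x * d p.2 y := by
  induction x using polytopeRing_induction with
  | zero => simp
  | add x x' hx hx' => simp only [add_mul, map_add, hx, hx', Finset.sum_add_distrib]
  | smul c x hx => simp only [smul_mul_assoc, map_smul, hx, Finset.smul_sum]
  | cls P =>
    induction y using polytopeRing_induction with
    | zero => simp
    | add x x' hx hx' => simp only [mul_add, map_add, hx, hx', Finset.sum_add_distrib]
    | smul c x hx => simp only [mul_smul_comm, map_smul, hx, Finset.smul_sum]
    | cls Q => simp only [cls_mul, d_cls, faceSum_prod]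

/-! ### Pyramids -/

/-- The inclusion `x ↦ (0, x)`. -/
def consZero (m : ℕ) : (Fin m → ℝ) →ₗ[ℝ] (Fin (m + 1) → ℝ) where
  toFun x := Fin.cons 0 x
  map_add' x y := by ext i; refine Fin.cases ?_ (fun i => ?_) i <;> simp
  map_smul' c x := by ext i; refine Fin.cases ?_ (fun i => ?_) i <;> simp

/-- The inclusion `x ↦ (1, x)`. -/
def consOne (m : ℕ) : (Fin m → ℝ) →ᵃ[ℝ] (Fin (m + 1) → ℝ) where
  toFun x := Fin.cons 1 x
  linear := consZero m
  map_vadd' x v := by ext i; refine Fin.cases ?_ (fun i => ?_) i <;> simp [consZero]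

theorem consZero_injective (m : ℕ) : Function.Injective (consZero m) := fun _ _ h =>
  funext fun i => congrFun h i.succ

theorem smul_consOne_zero {m : ℕ} (t : ℝ) (x : Fin m → ℝ) : (t • consOne m x) 0 = t := by
  simp [consOne]

theorem consOne_zero {m : ℕ} (x : Fin m → ℝ) : consOne m x 0 = 1 := rfl

theorem consOne_injective (m : ℕ) : Function.Injective (consOne m) := fun _ _ h =>
  funext fun i => congrFun h i.succ

/-- The functional `(t, x) ↦ α t + l x`. -/
noncomputable def consDual {m : ℕ} (l : StrongDual ℝ (Fin m → ℝ)) (α : ℝ) :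
    StrongDual ℝ (Fin (m + 1) → ℝ) :=
  LinearMap.toContinuousLinearMap
    (α • LinearMap.proj 0 + l.toLinearMap ∘ₗ LinearMap.funLeft ℝ ℝ Fin.succ)

theorem consDual_consOne {m : ℕ} (l : StrongDual ℝ (Fin m → ℝ)) (α : ℝ) (x : Fin m → ℝ) :
    consDual l α (consOne m x) = α + l x := by
  change α • consOne m x 0 + l (fun i => consOne m x i.succ) = _
  rw [consOne_zero, smul_eq_mul, mul_one]
  rfl

theorem exists_apply_consOne {m : ℕ} (f : StrongDual ℝ (Fin (m + 1) → ℝ)) :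
    ∃ (l : StrongDual ℝ (Fin m → ℝ)) (α : ℝ), ∀ x, f (consOne m x) = α + l x := by
  refine ⟨LinearMap.toContinuousLinearMap (f.toLinearMap ∘ₗ consZero m), f (consOne m 0),
    fun x => ?_⟩
  change f (consOne m x) = f (consOne m 0) + f (consZero m x)
  rw [← map_add]
  congr 1
  ext i
  refine Fin.cases ?_ (fun i => ?_) i <;> simp [consOne, consZero]

/-- The copy `1 × A` of `A`. -/
def baseSet {m : ℕ} (A : Set (Fin m → ℝ)) : Set (Fin (m + 1) → ℝ) := consOne m '' A

/-- The pyramid with apex `0` over the base `1 × A`. -/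
def coneSet {m : ℕ} (A : Set (Fin m → ℝ)) : Set (Fin (m + 1) → ℝ) :=
  {z | ∃ t : ℝ, 0 ≤ t ∧ t ≤ 1 ∧ ∃ x ∈ A, t • consOne m x = z}

theorem smul_mem_coneSet {m : ℕ} {A : Set (Fin m → ℝ)} {t : ℝ} (ht : 0 ≤ t) (ht' : t ≤ 1)
    {x : Fin m → ℝ} (hx : x ∈ A) : t • consOne m x ∈ coneSet A := ⟨t, ht, ht', x, hx, rfl⟩

theorem consOne_mem_coneSet {m : ℕ} {A : Set (Fin m → ℝ)} {x : Fin m → ℝ} :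
    consOne m x ∈ coneSet A ↔ x ∈ A := by
  constructor
  · rintro ⟨t, -, -, y, hy, h⟩
    have ht := congrFun h 0
    rw [smul_consOne_zero, consOne_zero] at ht
    rw [ht, one_smul] at h
    rwa [← consOne_injective m h]
  · intro hx
    simpa using smul_mem_coneSet zero_le_one le_rfl hx

theorem zero_mem_coneSet {m : ℕ} {A : Set (Fin m → ℝ)} (hA : A.Nonempty) : 0 ∈ coneSet A := by
  obtain ⟨x, hx⟩ := hA
  simpa using smul_mem_coneSet le_rfl zero_le_one hx

theorem zero_notMem_baseSet {m : ℕ} (A : Set (Fin m → ℝ)) : 0 ∉ baseSet A := by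
  rintro ⟨x, -, h⟩
  have := congrFun h 0
  rw [consOne_zero] at this
  exact one_ne_zero this

theorem consOne_mem_baseSet {m : ℕ} {A : Set (Fin m → ℝ)} {x : Fin m → ℝ} :
    consOne m x ∈ baseSet A ↔ x ∈ A := (consOne_injective m).mem_set_image

theorem baseSet_subset_coneSet {m : ℕ} (A : Set (Fin m → ℝ)) : baseSet A ⊆ coneSet A := by
  rintro _ ⟨x, hx, rfl⟩
  exact consOne_mem_coneSet.2 hx

theorem convexHull_insert_baseSet {m : ℕ} {A : Set (Fin m → ℝ)} (hA : A.Nonempty) :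
    convexHull ℝ (insert 0 (baseSet A)) = coneSet (convexHull ℝ A) := by
  rw [baseSet, convexHull_insert (hA.image _), ← (consOne m).image_convexHull,
    convexJoin_singleton_left]
  ext z
  simp only [Set.mem_iUnion, exists_prop, segment_eq_image, Set.mem_image,
    smul_zero, zero_add, Set.mem_Icc]
  constructor
  · rintro ⟨_, ⟨x, hx, rfl⟩, t, ht, rfl⟩
    exact smul_mem_coneSet ht.1 ht.2 hx
  · rintro ⟨t, h0, h1, x, hx, rfl⟩
    exact ⟨_, ⟨x, hx, rfl⟩, t, ⟨h0, h1⟩, rfl⟩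

theorem affDim_baseSet {m : ℕ} (A : Set (Fin m → ℝ)) : affDim (baseSet A) = affDim A := by
  rw [affDim, baseSet, ← AffineMap.map_vectorSpan]
  exact (Submodule.equivMapOfInjective _ (consZero_injective m) _).finrank_eq.symm

theorem affDim_singleton {m : ℕ} (x : Fin m → ℝ) : affDim {x} = 0 := by
  simp [affDim, vectorSpan_singleton]

/-- The directions of the pyramid are those of the base, on which coordinate `0` vanishes, together
with the line from the apex `0` to a point of the base, on which it does not. -/
theorem affDim_coneSet {m : ℕ} {A : Set (Fin m → ℝ)} (hA : A.Nonempty) :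
    affDim (coneSet A) = affDim A + 1 := by
  obtain ⟨x₀, hx₀⟩ := hA
  have h : vectorSpan ℝ (coneSet A) = vectorSpan ℝ (baseSet A) ⊔ ℝ ∙ (consOne m x₀) := by
    apply le_antisymm
    · rw [vectorSpan_eq_span_vsub_set_right ℝ (zero_mem_coneSet ⟨x₀, hx₀⟩), Submodule.span_le]
      rintro _ ⟨_, ⟨t, -, -, x, hx, rfl⟩, rfl⟩
      have e : t • consOne m x -ᵥ 0 = t • (consOne m x -ᵥ consOne m x₀) + t • consOne m x₀ := by
        simp [← smul_add]
      simp only [e]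
      exact Submodule.add_mem_sup
        (Submodule.smul_mem _ _ (vsub_mem_vectorSpan ℝ (consOne_mem_baseSet.2 hx)
          (consOne_mem_baseSet.2 hx₀)))
        (Submodule.smul_mem _ _ (Submodule.mem_span_singleton_self _))
    · refine sup_le (vectorSpan_mono ℝ (baseSet_subset_coneSet A)) ?_
      rw [Submodule.span_singleton_le_iff_mem]
      simpa using vsub_mem_vectorSpan ℝ (consOne_mem_coneSet.2 hx₀) (zero_mem_coneSet ⟨x₀, hx₀⟩)
  have hv : ∀ v ∈ vectorSpan ℝ (baseSet A), v 0 = 0 := by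
    intro v hv
    rw [baseSet, ← AffineMap.map_vectorSpan] at hv
    obtain ⟨w, -, rfl⟩ := hv
    rfl
  have hd : vectorSpan ℝ (baseSet A) ⊓ ℝ ∙ (consOne m x₀) = ⊥ := by
    rw [Submodule.eq_bot_iff]
    rintro v ⟨h1, h2⟩
    obtain ⟨c, rfl⟩ := Submodule.mem_span_singleton.1 h2
    have := hv _ h1
    rw [smul_consOne_zero] at this
    rw [this, zero_smul]
  have h1 : Module.finrank ℝ (ℝ ∙ (consOne m x₀)) = 1 := finrank_span_singleton fun h0 => by
    have := congrFun h0 0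
    rw [consOne_zero] at this
    exact one_ne_zero this
  have := Submodule.finrank_sup_add_finrank_inf_eq (vectorSpan ℝ (baseSet A)) (ℝ ∙ (consOne m x₀))
  rw [hd, finrank_bot, h1, ← h] at this
  have hb := affDim_baseSet A
  unfold affDim at *
  omega

/-- The constant `1 - c` makes the functional equal to `1` on `1 × F` and at most `1` on the base.
It is `0` at the apex, so the maximum `1` is attained only in the base. -/
theorem IsFace.baseSet {m : ℕ} {P F : Set (Fin m → ℝ)} (hF : IsFace P F) :
    IsFace (coneSet P) (baseSet F) := by
  obtain ⟨l, c, h1, h2⟩ := hF.exists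
  refine isFace_of (hF.1.image _) (consDual l (1 - c)) 1 ?_ ?_
  · rintro _ ⟨t, h0, ht, x, hx, rfl⟩
    rw [map_smul, consDual_consOne, smul_eq_mul]
    have := h1 x hx
    nlinarith
  · ext z
    constructor
    · rintro ⟨x, hx, rfl⟩
      rw [h2] at hx
      refine ⟨consOne_mem_coneSet.2 hx.1, ?_⟩
      rw [consDual_consOne, hx.2]
      ring
    · rintro ⟨⟨t, h0, ht, x, hx, rfl⟩, he⟩
      rw [map_smul, consDual_consOne, smul_eq_mul] at he
      have h3 := h1 x hx
      have ht1 : t = 1 := by nlinarith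
      rw [ht1, one_smul]
      refine ⟨x, ?_, rfl⟩
      rw [h2]
      rw [ht1] at he
      exact ⟨hx, by linarith⟩

/-- With the constant `-c` the functional is at most `0` on the base and vanishes both on `1 × F`
and at the apex, so its zeros form the pyramid over `F`. -/
theorem IsFace.coneSet {m : ℕ} {P F : Set (Fin m → ℝ)} (hF : IsFace P F) :
    IsFace (coneSet P) (coneSet F) := by
  obtain ⟨l, c, h1, h2⟩ := hF.exists
  refine isFace_of ⟨0, zero_mem_coneSet hF.1⟩ (consDual l (-c)) 0 ?_ ?_
  · rintro _ ⟨t, h0, ht, x, hx, rfl⟩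
    rw [map_smul, consDual_consOne, smul_eq_mul]
    have := h1 x hx
    nlinarith
  · ext z
    constructor
    · rintro ⟨t, h0, ht, x, hx, rfl⟩
      rw [h2] at hx
      refine ⟨smul_mem_coneSet h0 ht hx.1, ?_⟩
      rw [map_smul, consDual_consOne, hx.2]
      simp
    · rintro ⟨⟨t, h0, ht, x, hx, rfl⟩, he⟩
      rw [map_smul, consDual_consOne, smul_eq_mul, mul_eq_zero] at he
      rcases he with rfl | he
      · rw [zero_smul]
        exact zero_mem_coneSet hF.1
      · refine smul_mem_coneSet h0 ht ?_
        rw [h2]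
        exact ⟨hx, by linarith⟩

theorem isFace_apex {m : ℕ} {P : Set (Fin m → ℝ)} (hP : P.Nonempty) : IsFace (coneSet P) {0} := by
  refine isFace_of ⟨0, rfl⟩ (consDual 0 (-1)) 0 ?_ ?_
  · rintro _ ⟨t, h0, ht, x, hx, rfl⟩
    rw [map_smul, consDual_consOne]
    simpa using h0
  · ext z
    constructor
    · rintro rfl
      exact ⟨zero_mem_coneSet hP, map_zero _⟩
    · rintro ⟨⟨t, h0, ht, x, hx, rfl⟩, he⟩
      rw [map_smul, consDual_consOne] at he
      have : t = 0 := by simpa using he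
      rw [this, zero_smul]
      rfl

/-- The faces of a pyramid. -/
theorem IsFace.of_coneSet {m : ℕ} {P : Set (Fin m → ℝ)} {H : Set (Fin (m + 1) → ℝ)}
    (hP : P.Nonempty) (h : IsFace (PolytopeAlgebra.coneSet P) H) :
    H = {0} ∨ ∃ F, IsFace P F ∧
      (H = PolytopeAlgebra.baseSet F ∨ H = PolytopeAlgebra.coneSet F) := by
  obtain ⟨f, c, h1, h2⟩ := h.exists
  obtain ⟨l, α, hl⟩ := exists_apply_consOne f
  have hle : ∀ x ∈ P, α + l x ≤ c := fun x hx => by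
    rw [← hl]; exact h1 _ (consOne_mem_coneSet.2 hx)
  have hc : 0 ≤ c := by simpa using h1 0 (zero_mem_coneSet hP)
  have hmem : ∀ t x, 0 ≤ t → t ≤ 1 → x ∈ P → (t • consOne m x ∈ H ↔ t * (α + l x) = c) := by
    intro t x h0 ht hx
    rw [h2, Set.mem_ofPred_eq, map_smul, hl, smul_eq_mul]
    exact and_iff_right (smul_mem_coneSet h0 ht hx)
  -- The functional is `0` at the apex, so `c = 0` exactly when `H` contains the apex. Then `H` is
  -- the apex alone or a pyramid, according to whether the maximum is also reached in the base; if
  -- `c > 0`, only points with `t = 1` can reach it.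
  rcases hc.eq_or_lt with rfl | hc
  · by_cases hF : ∃ x ∈ P, α + l x = 0
    · right
      obtain ⟨x₀, hx₀, he⟩ := hF
      refine ⟨{x ∈ P | l x = -α}, isFace_of ⟨x₀, hx₀, by linarith⟩ l (-α)
        (fun x hx => by linarith [hle x hx]) rfl, Or.inr ?_⟩
      ext z
      constructor
      · intro hz
        obtain ⟨t, h0, ht, x, hx, rfl⟩ := h.subset hz
        rw [hmem t x h0 ht hx, mul_eq_zero] at hz
        rcases hz with rfl | hz
        · rw [zero_smul]
          exact zero_mem_coneSet ⟨x₀, hx₀, by linarith⟩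
        · exact smul_mem_coneSet h0 ht ⟨hx, by linarith⟩
      · rintro ⟨t, h0, ht, x, hx, rfl⟩
        rw [hmem t x h0 ht hx.1, hx.2]
        ring
    · left
      ext z
      constructor
      · intro hz
        obtain ⟨t, h0, ht, x, hx, rfl⟩ := h.subset hz
        rw [hmem t x h0 ht hx, mul_eq_zero] at hz
        rw [hz.resolve_right fun h => hF ⟨x, hx, h⟩, zero_smul]
        rfl
      · rintro rfl
        rw [h2]
        exact ⟨zero_mem_coneSet hP, map_zero _⟩
  · right
    have ht1 : ∀ t x, 0 ≤ t → t ≤ 1 → x ∈ P → t * (α + l x) = c → t = 1 := by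
      intro t x h0 ht hx he
      have := hle x hx
      nlinarith
    obtain ⟨z, hz⟩ := h.1
    obtain ⟨t₀, h0, ht, x₀, hx₀, rfl⟩ := h.subset hz
    rw [hmem t₀ x₀ h0 ht hx₀] at hz
    have h3 := ht1 t₀ x₀ h0 ht hx₀ hz
    subst h3
    refine ⟨{x ∈ P | l x = c - α}, isFace_of ⟨x₀, hx₀, by linarith⟩ l (c - α)
        (fun x hx => by linarith [hle x hx]) rfl, Or.inl ?_⟩
    ext z
    constructor
    · intro hz
      obtain ⟨t, h0, ht, x, hx, rfl⟩ := h.subset hz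
      rw [hmem t x h0 ht hx] at hz
      have h3 := ht1 t x h0 ht hx hz
      subst h3
      rw [one_smul]
      exact ⟨x, ⟨hx, by linarith⟩, rfl⟩
    · rintro ⟨x, hx, rfl⟩
      have := (hmem 1 x zero_le_one le_rfl hx.1).2 (by rw [hx.2]; ring)
      rwa [one_smul] at this

/-! ### The face poset of a pyramid. -/

theorem baseSet_subset_baseSet {m : ℕ} {A B : Set (Fin m → ℝ)} :
    baseSet A ⊆ baseSet B ↔ A ⊆ B := Set.image_subset_image_iff (consOne_injective m)

theorem baseSet_subset_coneSet_iff {m : ℕ} {A B : Set (Fin m → ℝ)} :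
    baseSet A ⊆ coneSet B ↔ A ⊆ B :=
  ⟨fun h _ hx => consOne_mem_coneSet.1 (h (consOne_mem_baseSet.2 hx)),
    fun h => (baseSet_subset_baseSet.2 h).trans (baseSet_subset_coneSet B)⟩

theorem coneSet_subset_coneSet {m : ℕ} {A B : Set (Fin m → ℝ)} :
    coneSet A ⊆ coneSet B ↔ A ⊆ B :=
  ⟨fun h => baseSet_subset_coneSet_iff.1 ((baseSet_subset_coneSet A).trans h), fun h => by
    rintro _ ⟨t, h0, ht, x, hx, rfl⟩
    exact smul_mem_coneSet h0 ht (h hx)⟩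

namespace Polytope

/-- The pyramid over a polytope. -/
def pyr (P : Polytope) : Polytope where
  ambient := P.ambient + 1
  carrier := coneSet P.carrier
  exists_hull := by
    classical
    obtain ⟨S, hS, hP⟩ := P.exists_hull
    refine ⟨insert 0 (S.image (consOne P.ambient)), Finset.insert_nonempty _ _, ?_⟩
    rw [Finset.coe_insert, Finset.coe_image, ← hP]
    exact convexHull_insert_baseSet hS

/-- The apex, the faces of the base and the pyramids over them are the faces of a pyramid. -/
def pyrFace {P : Polytope} : Option (P.Face ⊕ P.Face) → P.pyr.Face
  | none => ⟨{0}, isFace_apex P.top.2.1⟩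
  | some (Sum.inl F) => ⟨baseSet F.1, F.2.baseSet⟩
  | some (Sum.inr F) => ⟨coneSet F.1, F.2.coneSet⟩

/-- The inclusion relation between the faces of a pyramid. -/
def pyrLE {P : Polytope} : Option (P.Face ⊕ P.Face) → Option (P.Face ⊕ P.Face) → Prop
  | none, none => True
  | none, some (Sum.inl _) => False
  | none, some (Sum.inr _) => True
  | some _, none => False
  | some (Sum.inl F), some (Sum.inl G) => F ≤ G
  | some (Sum.inl F), some (Sum.inr G) => F ≤ G
  | some (Sum.inr _), some (Sum.inl _) => False
  | some (Sum.inr F), some (Sum.inr G) => F ≤ G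

theorem pyrFace_le {P : Polytope} (x y : Option (P.Face ⊕ P.Face)) :
    pyrFace x ≤ pyrFace y ↔ pyrLE x y := by
  have apex_base : ∀ (F : P.Face) (A : Set (Fin (P.ambient + 1) → ℝ)), A ⊆ baseSet F.1 → 0 ∉ A :=
    fun F A h h0 => zero_notMem_baseSet _ (h h0)
  have base_apex : ∀ (F : P.Face) (A : Set (Fin (P.ambient + 1) → ℝ)), baseSet F.1 ⊆ A →
      ¬ A ⊆ {0} := fun F A h h0 => by
    obtain ⟨x, hx⟩ := F.2.1
    have := h0 (h (consOne_mem_baseSet.2 hx))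
    exact zero_notMem_baseSet _ (this ▸ consOne_mem_baseSet.2 hx)
  rcases x with _ | F | F <;> rcases y with _ | G | G
  · exact iff_of_true le_rfl trivial
  · exact iff_of_false (fun h => apex_base G _ h rfl) id
  · exact iff_of_true (Set.singleton_subset_iff.2 (zero_mem_coneSet G.2.1)) trivial
  · exact iff_of_false (base_apex F _ subset_rfl) id
  · exact baseSet_subset_baseSet
  · exact baseSet_subset_coneSet_iff
  · exact iff_of_false (base_apex F _ (baseSet_subset_coneSet _)) id
  · exact iff_of_false (fun h => apex_base G _ h (zero_mem_coneSet F.2.1)) id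
  · exact coneSet_subset_coneSet

theorem pyrLE_antisymm {P : Polytope} {x y : Option (P.Face ⊕ P.Face)} (h : pyrLE x y)
    (h' : pyrLE y x) : x = y := by
  rcases x with _ | F | F <;> rcases y with _ | G | G
  · rfl
  all_goals first | exact h.elim | exact h'.elim | rw [le_antisymm (a := F) (b := G) h h']

/-- The faces of a pyramid. -/
noncomputable def facesPyr (P : Polytope) : Option (P.Face ⊕ P.Face) ≃ P.pyr.Face :=
  Equiv.ofBijective pyrFace ⟨fun x y h => pyrLE_antisymm ((pyrFace_le x y).1 h.le)
    ((pyrFace_le y x).1 h.ge), by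
      rintro ⟨H, hH⟩
      rcases IsFace.of_coneSet P.top.2.1 hH with rfl | ⟨F, hF, rfl | rfl⟩
      · exact ⟨none, rfl⟩
      · exact ⟨some (Sum.inl ⟨F, hF⟩), rfl⟩
      · exact ⟨some (Sum.inr ⟨F, hF⟩), rfl⟩⟩

theorem facesPyr_le {P : Polytope} (x y : Option (P.Face ⊕ P.Face)) :
    facesPyr P x ≤ facesPyr P y ↔ pyrLE x y := pyrFace_le x y

theorem dim_facesPyr_none (P : Polytope) : (facesPyr P none).dim = 0 :=
  affDim_singleton (0 : Fin (P.ambient + 1) → ℝ)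

theorem dim_facesPyr_inl {P : Polytope} (F : P.Face) :
    (facesPyr P (some (Sum.inl F))).dim = F.dim := affDim_baseSet F.1

theorem dim_facesPyr_inr {P : Polytope} (F : P.Face) :
    (facesPyr P (some (Sum.inr F))).dim = F.dim + 1 := affDim_coneSet F.2.1

theorem dim_pyr (P : Polytope) : P.pyr.dim = P.dim + 1 := affDim_coneSet P.top.2.1

theorem CombEquiv.pyr {P Q : Polytope} : CombEquiv P Q → CombEquiv P.pyr Q.pyr := by
  rintro ⟨e, he⟩
  let f : Option (P.Face ⊕ P.Face) ≃ Option (Q.Face ⊕ Q.Face) :=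
    Equiv.optionCongr (Equiv.sumCongr e.toEquiv e.toEquiv)
  have hf : ∀ x y, pyrLE (f x) (f y) ↔ pyrLE x y := by
    rintro (_ | F | F) (_ | G | G)
    · exact Iff.rfl
    · exact Iff.rfl
    · exact Iff.rfl
    · exact Iff.rfl
    · exact e.le_iff_le
    · exact e.le_iff_le
    · exact Iff.rfl
    · exact Iff.rfl
    · exact e.le_iff_le
  refine ⟨⟨(facesPyr P).symm.trans (f.trans (facesPyr Q)), fun {a b} => ?_⟩, fun H => ?_⟩
  · obtain ⟨x, rfl⟩ := (facesPyr P).surjective a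
    obtain ⟨y, rfl⟩ := (facesPyr P).surjective b
    simp only [Equiv.trans_apply, Equiv.symm_apply_apply]
    rw [facesPyr_le, facesPyr_le, hf]
  · obtain ⟨x, rfl⟩ := (facesPyr P).surjective H
    simp only [RelIso.coe_fn_mk, Equiv.trans_apply, Equiv.symm_apply_apply]
    rcases x with _ | F | F
    · exact (dim_facesPyr_none Q).trans (dim_facesPyr_none P).symm
    · exact (dim_facesPyr_inl (e F)).trans ((he F).trans (dim_facesPyr_inl F).symm)
    · exact (dim_facesPyr_inr (e F)).trans
        ((congrArg (· + 1) (he F)).trans (dim_facesPyr_inr F).symm)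

/-- The faces of the base of a pyramid. -/
theorem combEquiv_base {P : Polytope} (F : P.Face) :
    CombEquiv (facesPyr P (some (Sum.inl F))).toPolytope F.toPolytope := by
  refine CombEquiv.symm ⟨F.facesEquiv.trans (OrderIso.trans ?_
    (facesPyr P (some (Sum.inl F))).facesEquiv.symm), fun G => ?_⟩
  · refine ⟨Equiv.ofBijective (fun G => ⟨facesPyr P (some (Sum.inl G.1)),
      (facesPyr_le _ _).2 G.2⟩) ⟨fun G G' h => ?_, ?_⟩, fun {G G'} => ?_⟩
    · have := (facesPyr P).injective (congrArg Subtype.val h)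
      exact Subtype.ext (Sum.inl_injective (Option.some_injective _ this))
    · rintro ⟨H, hH⟩
      obtain ⟨x, rfl⟩ := (facesPyr P).surjective H
      rw [facesPyr_le] at hH
      rcases x with _ | G | G
      · exact hH.elim
      · exact ⟨⟨G, hH⟩, rfl⟩
      · exact hH.elim
    · exact facesPyr_le _ _
  · exact dim_facesPyr_inl (F.facesEquiv G).1

end Polytope

/-! ### The operators `d_k` on pyramids and prisms -/

/-- The linear extension of an invariant of polytopes. -/
noncomputable def extend {M : Type*} [AddCommGroup M] (f : Polytope → M)
    (hf : ∀ P Q, P.CombEquiv Q → f P = f Q) : PolytopeRing →ₗ[ℤ] M :=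
  (MonoidAlgebra.basis CombPolytope ℤ).constr ℤ (Quotient.lift f hf)

theorem extend_cls {M : Type*} [AddCommGroup M] (f : Polytope → M)
    (hf : ∀ P Q, P.CombEquiv Q → f P = f Q) (P : Polytope) : extend f hf (cls P) = f P :=
  Module.Basis.constr_basis _ ℤ _ (CombPolytope.mk P)

theorem cls_eq {P Q : Polytope} (h : P.CombEquiv Q) : cls P = cls Q :=
  congrArg (fun c => MonoidAlgebra.single c (1 : ℤ)) (Quotient.sound h)

/-- The pyramid as a linear operator on the ring of polytopes. -/
noncomputable def cone : PolytopeRing →ₗ[ℤ] PolytopeRing :=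
  extend (fun P => cls P.pyr) fun _ _ h => cls_eq h.pyr

theorem cone_cls (P : Polytope) : cone (cls P) = cls P.pyr := extend_cls _ _ P

/-- The number of polytopes in a sum of polytopes. -/
noncomputable def aug : PolytopeRing →ₗ[ℤ] ℤ := extend (fun _ => 1) fun _ _ _ => rfl

theorem aug_cls (P : Polytope) : aug (cls P) = 1 := extend_cls _ _ P

/-- The number of points in a sum of polytopes. -/
noncomputable def augZero : PolytopeRing →ₗ[ℤ] ℤ :=
  extend (fun P => if P.dim = 0 then 1 else 0) fun _ _ h => by rw [h.dim_eq]

theorem augZero_cls (P : Polytope) : augZero (cls P) = if P.dim = 0 then 1 else 0 :=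
  extend_cls _ _ P

/-- The segment. -/
noncomputable def segment : PolytopeRing := cls Polytope.point.pyr

/-- The group of combinations of polytopes of dimension `n`. -/
noncomputable def dimSub (n : ℕ) : Submodule ℤ PolytopeRing :=
  Submodule.span ℤ (cls '' {P | P.dim = n})

theorem cls_mem_dimSub (P : Polytope) : cls P ∈ dimSub P.dim := Submodule.subset_span ⟨P, rfl, rfl⟩

theorem cls_face_mem_dimSub {P : Polytope} (F : P.Face) : cls F.toPolytope ∈ dimSub F.dim :=
  cls_mem_dimSub F.toPolytope

@[elab_as_elim]
theorem dimSub_induction {n : ℕ} {p : (x : PolytopeRing) → x ∈ dimSub n → Prop}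
    {x : PolytopeRing} (hx : x ∈ dimSub n)
    (cls : ∀ (P : Polytope) (h : P.dim = n), p (cls P) (Submodule.subset_span ⟨P, h, rfl⟩))
    (zero : p 0 (Submodule.zero_mem _))
    (add : ∀ x y hx hy, p x hx → p y hy → p (x + y) (Submodule.add_mem _ hx hy))
    (smul : ∀ (c : ℤ) x hx, p x hx → p (c • x) (Submodule.smul_mem _ c hx)) : p x hx := by
  induction hx using Submodule.span_induction with
  | mem x hx => obtain ⟨P, hP, rfl⟩ := hx; exact cls P hP
  | zero => exact zero
  | add x y _ _ hx hy => exact add x y _ _ hx hy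
  | smul c x _ hx => exact smul c x _ hx

/-! ### Compatibility of the operators with the grading by dimension. -/

theorem d_mem_dimSub {k m : ℕ} {x : PolytopeRing} (hx : x ∈ dimSub (m + k)) :
    d k x ∈ dimSub m := by
  induction hx using dimSub_induction with
  | cls P hP =>
    rw [d_cls, faceSum]
    refine Submodule.sum_mem _ fun F hF => ?_
    have : F.dim = m := by have := (Finset.mem_filter.1 hF).2; omega
    exact this ▸ cls_face_mem_dimSub F
  | zero => simp
  | add x y _ _ hx hy => rw [map_add]; exact Submodule.add_mem _ hx hy
  | smul c x _ hx => rw [map_smul]; exact Submodule.smul_mem _ c hx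

theorem d_eq_zero {k m : ℕ} (h : m < k) {x : PolytopeRing} (hx : x ∈ dimSub m) : d k x = 0 := by
  induction hx using dimSub_induction with
  | cls P hP =>
    rw [d_cls, faceSum, Finset.filter_false_of_mem, Finset.sum_empty]
    intro F _
    omega
  | zero => simp
  | add x y _ _ hx hy => rw [map_add, hx, hy, add_zero]
  | smul c x _ hx => rw [map_smul, hx, smul_zero]

theorem cone_mem_dimSub {m : ℕ} {x : PolytopeRing} (hx : x ∈ dimSub m) :
    cone x ∈ dimSub (m + 1) := by
  induction hx using dimSub_induction with
  | cls P hP =>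
    rw [cone_cls]
    have : P.pyr.dim = m + 1 := by rw [Polytope.dim_pyr, hP]
    exact this ▸ cls_mem_dimSub P.pyr
  | zero => simp
  | add x y _ _ hx hy => rw [map_add]; exact Submodule.add_mem _ hx hy
  | smul c x _ hx => rw [map_smul]; exact Submodule.smul_mem _ c hx

theorem aug_cone (x : PolytopeRing) : aug (cone x) = aug x := by
  induction x using polytopeRing_induction with
  | cls P => rw [cone_cls, aug_cls, aug_cls]
  | zero => simp
  | add x y hx hy => simp only [map_add, hx, hy]
  | smul c x hx => simp only [map_smul, hx]

theorem Polytope.dim_point' : Polytope.point.dim = 0 := Polytope.dim_point Polytope.point.top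

theorem segment_mul_mem_dimSub {m : ℕ} {x : PolytopeRing} (hx : x ∈ dimSub m) :
    segment * x ∈ dimSub (m + 1) := by
  induction hx using dimSub_induction with
  | cls P hP =>
    rw [segment, cls_mul]
    have : (Polytope.point.pyr.prod P).dim = m + 1 := by
      rw [Polytope.dim_prod, Polytope.dim_pyr, Polytope.dim_point', hP]; omega
    exact this ▸ cls_mem_dimSub _
  | zero => simp
  | add x y _ _ hx hy => rw [mul_add]; exact Submodule.add_mem _ hx hy
  | smul c x _ hx => rw [mul_smul_comm]; exact Submodule.smul_mem _ c hx

theorem aug_segment_mul (x : PolytopeRing) : aug (segment * x) = aug x := by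
  induction x using polytopeRing_induction with
  | cls P => rw [segment, cls_mul, aug_cls, aug_cls]
  | zero => simp
  | add x y hx hy => simp only [mul_add, map_add, hx, hy]
  | smul c x hx => simp only [mul_smul_comm, map_smul, hx]

theorem augZero_eq_aug {x : PolytopeRing} (hx : x ∈ dimSub 0) : augZero x = aug x := by
  induction hx using dimSub_induction with
  | cls P hP => rw [augZero_cls, aug_cls, if_pos hP]
  | zero => simp
  | add x y _ _ hx hy => simp only [map_add, hx, hy]
  | smul c x _ hx => simp only [map_smul, hx]

theorem augZero_eq_zero {m : ℕ} (hm : m ≠ 0) {x : PolytopeRing} (hx : x ∈ dimSub m) :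
    augZero x = 0 := by
  induction hx using dimSub_induction with
  | cls P hP => rw [augZero_cls, if_neg (by omega)]
  | zero => simp
  | add x y _ _ hx hy => rw [map_add, hx, hy, add_zero]
  | smul c x _ hx => rw [map_smul, hx, smul_zero]

theorem combEquiv_apex (P : Polytope) :
    (Polytope.facesPyr P none).toPolytope.CombEquiv Polytope.point := by
  have hu : ∀ F : (Polytope.facesPyr P none).toPolytope.Face,
      F = (Polytope.facesPyr P none).toPolytope.top := by
    intro F
    refine le_antisymm (Polytope.le_top F) ?_
    obtain ⟨x, hx⟩ := F.2.1
    have h0 : x ∈ ({0} : Set (Fin (P.ambient + 1) → ℝ)) := F.2.subset hx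
    intro y hy
    have h1 : y ∈ ({0} : Set (Fin (P.ambient + 1) → ℝ)) := hy
    rw [Set.mem_singleton_iff.1 h1]
    rwa [Set.mem_singleton_iff.1 h0] at hx
  refine ⟨⟨⟨fun _ => default, fun _ => Polytope.top _, fun F => (hu F).symm,
    fun _ => Subsingleton.elim _ _⟩, fun {F G} => ?_⟩, fun F => ?_⟩
  · rw [hu F, hu G]
    exact iff_of_true le_rfl le_rfl
  · rw [Polytope.dim_point, hu F]
    exact (affDim_singleton (0 : Fin (P.ambient + 1) → ℝ)).symm

open Classical in
-- Faces of codimension `k + 1` in the pyramid come in three kinds: pyramids over faces of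
-- codimension `k + 1` of `P`, faces of codimension `k` of the base, and the apex when `k = dim P`.
theorem d_cone_cls (k : ℕ) (P : Polytope) : d (k + 1) (cone (cls P)) =
    cone (d (k + 1) (cls P)) + d k (cls P) + if k = P.dim then 1 else 0 := by
  rw [cone_cls, d_cls, d_cls, d_cls, faceSum, faceSum, faceSum, Finset.sum_filter,
    Finset.sum_filter, Finset.sum_filter, ← Equiv.sum_comp (Polytope.facesPyr P),
    Fintype.sum_option, Fintype.sum_sum_type, map_sum]
  simp only [Polytope.dim_facesPyr_none, Polytope.dim_facesPyr_inl, Polytope.dim_facesPyr_inr,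
    Polytope.dim_pyr]
  have e0 : cls (Polytope.facesPyr P none).toPolytope = 1 := cls_eq (combEquiv_apex P)
  have e1 : ∀ F : P.Face, cls (Polytope.facesPyr P (some (Sum.inl F))).toPolytope =
      cls F.toPolytope := fun F => cls_eq (Polytope.combEquiv_base F)
  have e2 : ∀ F : P.Face, cls (Polytope.facesPyr P (some (Sum.inr F))).toPolytope =
      cone (cls F.toPolytope) := fun F => (cone_cls F.toPolytope).symm
  rw [e0, add_comm, add_comm (∑ _, _) (∑ _, _)]
  refine congrArg₂ (· + ·) (congrArg₂ (· + ·) ?_ ?_) ?_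
  · refine Finset.sum_congr rfl fun F _ => ?_
    rw [e2, apply_ite cone, map_zero]
    exact if_congr (by omega) rfl rfl
  · refine Finset.sum_congr rfl fun F _ => ?_
    rw [e1]
    exact if_congr (by omega) rfl rfl
  · exact if_congr (by omega) rfl rfl

theorem d_cone {k m : ℕ} (h : k + 1 ≤ m) {x : PolytopeRing} (hx : x ∈ dimSub m) :
    d (k + 1) (cone x) = cone (d (k + 1) x) + d k x := by
  induction hx using dimSub_induction with
  | cls P hP => rw [d_cone_cls, if_neg (by omega), add_zero]
  | zero => simp
  | add x y _ _ hx hy => simp only [map_add, hx, hy]; abel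
  | smul c x _ hx => simp only [map_smul, hx, smul_add]

/-- In top degree the apex appears, once for each polytope. This exceptional term is what makes the
action detect anything beyond the derivation rule. -/
theorem d_cone_top {m : ℕ} {x : PolytopeRing} (hx : x ∈ dimSub m) :
    d (m + 1) (cone x) = d m x + aug x • (1 : PolytopeRing) := by
  have h := d_eq_zero (Nat.lt_succ_self m) hx
  have key : d (m + 1) (cone x) = cone (d (m + 1) x) + d m x + aug x • (1 : PolytopeRing) := by
    clear h
    induction hx using dimSub_induction with
    | cls P hP => rw [d_cone_cls, if_pos hP.symm, aug_cls, one_smul]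
    | zero => simp
    | add x y _ _ hx hy => simp only [map_add, hx, hy, add_smul]; abel
    | smul c x _ hx => simp only [map_smul, hx, smul_add, smul_assoc]
  rw [key, h, map_zero, zero_add]

theorem one_mem_dimSub : (1 : PolytopeRing) ∈ dimSub 0 :=
  Polytope.dim_point' ▸ cls_mem_dimSub Polytope.point

theorem aug_one : aug (1 : PolytopeRing) = 1 := aug_cls Polytope.point

theorem segment_eq_cone : segment = cone 1 := (cone_cls Polytope.point).symm

theorem d_one_segment : d 1 segment = 2 := by
  rw [segment_eq_cone, d_cone_top one_mem_dimSub, aug_one, d_zero, one_smul, Module.End.one_apply,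
    one_add_one_eq_two]

theorem d_segment (k : ℕ) : d (k + 2) segment = 0 := by
  rw [segment_eq_cone]
  exact d_eq_zero (by omega) (cone_mem_dimSub one_mem_dimSub)

/-- The segment has two end points and no faces of codimension 2 or more, so only two terms of the
Leibniz rule survive. -/
theorem d_segment_mul (k : ℕ) (x : PolytopeRing) :
    d (k + 1) (segment * x) = segment * d (k + 1) x + 2 * d k x := by
  rw [d_mul, Finset.Nat.sum_antidiagonal_succ, d_zero, Module.End.one_apply]
  congr 1
  cases k with
  | zero => simp [d_one_segment]
  | succ k =>
    rw [Finset.Nat.sum_antidiagonal_succ, zero_add, d_one_segment, Finset.sum_eq_zero, add_zero]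
    intro p _
    rw [d_segment, zero_mul]

open PolytopeAlgebra.FreeLH (Z)

/-! ### The action of the free Leibnitz-Hopf algebra on the ring of polytopes -/

/-- The action `Z_k ↦ d_k` of the free Leibnitz-Hopf algebra on the ring of polytopes. -/
noncomputable def ev : FreeLH ℤ →ₐ[ℤ] Module.End ℤ PolytopeRing :=
  FreeAlgebra.lift ℤ fun n => d (n + 1)

theorem ev_Z (k : ℕ) : ev (Z ℤ k) = d k := by
  cases k with
  | zero => rw [d_zero]; exact map_one ev
  | succ k => exact FreeAlgebra.lift_ι_apply _ _

theorem ev_Z_mul (k : ℕ) (x : FreeLH ℤ) (p : PolytopeRing) :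
    ev (Z ℤ k * x) p = d k (ev x p) := by
  rw [map_mul, ev_Z, Module.End.mul_apply]

theorem ev_mul_apply (x y : FreeLH ℤ) (p : PolytopeRing) : ev (x * y) p = ev x (ev y p) := by
  rw [map_mul, Module.End.mul_apply]

theorem ev_one_apply (p : PolytopeRing) : ev 1 p = p := by
  rw [map_one, Module.End.one_apply]

/-- The algebra homomorphism `x ↦ x + δ x` to the dual numbers. -/
noncomputable def shiftHom : FreeLH ℤ →ₐ[ℤ] TrivSqZeroExt (FreeLH ℤ) (FreeLH ℤ) :=
  FreeAlgebra.lift ℤ fun n => TrivSqZeroExt.inl (Z ℤ (n + 1)) + TrivSqZeroExt.inr (Z ℤ n)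

theorem fst_shiftHom (x : FreeLH ℤ) : (shiftHom x).fst = x := by
  induction x using FreeLH.induction_Z with
  | hz k =>
    cases k with
    | zero => rw [FreeLH.Z, map_one, TrivSqZeroExt.fst_one]
    | succ k =>
      change (shiftHom (FreeAlgebra.ι ℤ k)).fst = _
      rw [shiftHom, FreeAlgebra.lift_ι_apply]
      simp
  | hc c => rw [AlgHom.commutes]; rfl
  | hm x y hx hy => rw [map_mul, TrivSqZeroExt.fst_mul, hx, hy]
  | ha x y hx hy => rw [map_add, TrivSqZeroExt.fst_add, hx, hy]

/-- The derivation `Z_k ↦ Z_{k-1}` of the free Leibnitz-Hopf algebra. -/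
noncomputable def shift (x : FreeLH ℤ) : FreeLH ℤ := (shiftHom x).snd

theorem shift_zero : shift 0 = 0 := by simp [shift]

theorem shift_one : shift 1 = 0 := by simp [shift]

theorem shift_algebraMap (c : ℤ) : shift (algebraMap ℤ (FreeLH ℤ) c) = 0 := by
  rw [shift, AlgHom.commutes]; rfl

theorem shift_add (x y : FreeLH ℤ) : shift (x + y) = shift x + shift y := by simp [shift]

theorem shift_smul (c : ℤ) (x : FreeLH ℤ) : shift (c • x) = c • shift x := by
  rw [shift, map_smul]; rfl

theorem shift_mul (x y : FreeLH ℤ) : shift (x * y) = x * shift y + shift x * y := by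
  simp [shift, fst_shiftHom]

theorem shift_Z (k : ℕ) : shift (Z ℤ (k + 1)) = Z ℤ k := by
  change (shiftHom (FreeAlgebra.ι ℤ k)).snd = _
  rw [shiftHom, FreeAlgebra.lift_ι_apply]
  simp

/-- The rule holds on generators by `d_segment_mul` and passes to products because `shift` is a
derivation. In contrast with the pyramid, no bound on the degree is needed. -/
theorem ev_segment_mul (x : FreeLH ℤ) (p : PolytopeRing) :
    ev x (segment * p) = segment * ev x p + (2 : ℤ) • ev (shift x) p := by
  induction x using FreeLH.induction_Z generalizing p with
  | hz k =>
    cases k with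
    | zero =>
      rw [FreeLH.Z, shift_one]
      simp
    | succ k => rw [shift_Z, ev_Z, ev_Z, d_segment_mul, two_mul, two_smul]
  | hc c =>
    rw [shift_algebraMap, AlgHom.commutes, Module.algebraMap_end_apply,
      Module.algebraMap_end_apply, mul_smul_comm, map_zero, LinearMap.zero_apply, smul_zero,
      add_zero]
  | hm x y hx hy =>
    rw [shift_mul, ev_mul_apply, hy, map_add, hx, map_smul, map_add, LinearMap.add_apply,
      ev_mul_apply, ev_mul_apply, ev_mul_apply, smul_add]
    abel
  | ha x y hx hy =>
    rw [shift_add, map_add, map_add, LinearMap.add_apply, hx, hy, LinearMap.add_apply,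
      LinearMap.add_apply, mul_add, smul_add]
    abel

/-- Homogeneous elements, for the grading in which `Z_k` has degree `k`. -/
inductive IsHomog : ℕ → FreeLH ℤ → Prop
  | one : IsHomog 0 1
  | zero (n : ℕ) : IsHomog n 0
  | add {n : ℕ} {x y : FreeLH ℤ} (hx : IsHomog n x) (hy : IsHomog n y) : IsHomog n (x + y)
  | smul {n : ℕ} (c : ℤ) {x : FreeLH ℤ} (hx : IsHomog n x) : IsHomog n (c • x)
  | mul {n : ℕ} (k : ℕ) {x : FreeLH ℤ} (hx : IsHomog n x) :
      IsHomog (n + (k + 1)) (Z ℤ (k + 1) * x)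

theorem IsHomog.sum {ι : Type*} {n : ℕ} (s : Finset ι) (f : ι → FreeLH ℤ)
    (h : ∀ i ∈ s, IsHomog n (f i)) : IsHomog n (∑ i ∈ s, f i) :=
  Finset.sum_induction f (IsHomog n) (fun _ _ => IsHomog.add) (IsHomog.zero n) h

theorem IsHomog.mul' {n k : ℕ} {x : FreeLH ℤ} (hx : IsHomog n x) : IsHomog (n + k) (Z ℤ k * x) := by
  cases k with
  | zero => rw [FreeLH.Z, one_mul]; exact hx
  | succ k => exact hx.mul k

theorem IsHomog.ev_mem {n : ℕ} {x : FreeLH ℤ} (hx : IsHomog n x) {m : ℕ} {p : PolytopeRing}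
    (hp : p ∈ dimSub (m + n)) : ev x p ∈ dimSub m := by
  induction hx generalizing m with
  | one => simpa using hp
  | zero n => simp
  | add _ _ hx hy => rw [map_add]; exact Submodule.add_mem _ (hx hp) (hy hp)
  | smul c _ hx => rw [map_smul]; exact Submodule.smul_mem _ c (hx hp)
  | mul k _ hx =>
    rw [ev_Z_mul]
    refine d_mem_dimSub (hx ?_)
    rwa [add_assoc, add_comm (k + 1)]

theorem IsHomog.ev_eq_zero {n : ℕ} {x : FreeLH ℤ} (hx : IsHomog n x) {m : ℕ} (hm : m < n)
    {p : PolytopeRing} (hp : p ∈ dimSub m) : ev x p = 0 := by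
  induction hx with
  | one => omega
  | zero n => simp
  | add _ _ hx hy => rw [map_add, LinearMap.add_apply, hx hm, hy hm, add_zero]
  | smul c _ hx => rw [map_smul, LinearMap.smul_apply, hx hm, smul_zero]
  | @mul n k x hx' hx =>
    rw [ev_Z_mul]
    by_cases h : m < n
    · rw [hx h, map_zero]
    · obtain ⟨j, rfl⟩ := Nat.exists_eq_add_of_le' (not_lt.1 h)
      exact d_eq_zero (by omega) (hx'.ev_mem hp)

theorem IsHomog.shift_eq_zero {x : FreeLH ℤ} (hx : IsHomog 0 x) : shift x = 0 := by
  generalize h0 : 0 = n at hx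
  induction hx with
  | one => exact shift_one
  | zero n => exact shift_zero
  | add _ _ hx hy => rw [shift_add, hx h0, hy h0, add_zero]
  | smul c _ hx => rw [shift_smul, hx h0, smul_zero]
  | mul k _ _ => omega

theorem IsHomog.shift {n : ℕ} {x : FreeLH ℤ} (hx : IsHomog (n + 1) x) :
    IsHomog n (PolytopeAlgebra.shift x) := by
  generalize h0 : n + 1 = m at hx
  induction hx generalizing n with
  | one => omega
  | zero => rw [shift_zero]; exact IsHomog.zero _
  | add _ _ hx hy => rw [shift_add]; exact (hx h0).add (hy h0)
  | smul c _ hx => rw [shift_smul]; exact (hx h0).smul c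
  | @mul m k x hx' hx =>
    rw [shift_mul, shift_Z]
    obtain rfl : n = m + k := by omega
    refine IsHomog.add ?_ hx'.mul'
    cases m with
    | zero => rw [hx'.shift_eq_zero, mul_zero]; exact IsHomog.zero _
    | succ m =>
      have := (hx rfl).mul' (k := k + 1)
      rwa [← add_assoc, add_right_comm] at this

/-- As for the prism, with `1` in place of `2`. The bound `n ≤ m` keeps the apex term out at every
letter of the word. -/
theorem IsHomog.ev_cone {n : ℕ} {x : FreeLH ℤ} (hx : IsHomog n x) {m : ℕ} (h : n ≤ m)
    {p : PolytopeRing} (hp : p ∈ dimSub m) :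
    ev x (cone p) = cone (ev x p) + ev (PolytopeAlgebra.shift x) p := by
  induction hx with
  | one => simp [shift_one]
  | zero n => simp [shift_zero]
  | add _ _ hx hy =>
    rw [shift_add, map_add, map_add, LinearMap.add_apply, hx h, hy h, LinearMap.add_apply,
      LinearMap.add_apply, map_add]
    abel
  | smul c _ hx =>
    rw [shift_smul, map_smul, map_smul, LinearMap.smul_apply, hx h, LinearMap.smul_apply,
      LinearMap.smul_apply, map_smul, smul_add]
  | @mul n k x hx' hx =>
    obtain ⟨j, rfl⟩ := Nat.exists_eq_add_of_le h
    have hmem : ev x p ∈ dimSub (k + 1 + j) := hx'.ev_mem (by convert hp using 2; omega)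
    rw [ev_Z_mul, hx (by omega), map_add, d_cone (by omega) hmem, shift_mul, shift_Z, map_add,
      LinearMap.add_apply, ev_Z_mul, ev_Z_mul, ev_Z_mul]
    abel

/-! ### Detecting elements by their action on pyramids and prisms -/

/-- The difference of the prism and twice the pyramid. -/
noncomputable def prismSubCone (p : PolytopeRing) : PolytopeRing :=
  segment * p - (2 : ℤ) • cone p

theorem prismSubCone_mem {m : ℕ} {p : PolytopeRing} (hp : p ∈ dimSub m) :
    prismSubCone p ∈ dimSub (m + 1) :=
  Submodule.sub_mem _ (segment_mul_mem_dimSub hp) (Submodule.smul_mem _ _ (cone_mem_dimSub hp))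

/-- Here `d (m + 1)` sends the prism to `2 d m p` and the pyramid to `d m p` plus one apex for each
polytope; only the apexes survive in the difference. -/
theorem aug_d_prismSubCone {m : ℕ} {p : PolytopeRing} (hp : p ∈ dimSub m) :
    aug (d (m + 1) (prismSubCone p)) = -2 * aug p := by
  rw [prismSubCone, map_sub, map_smul, d_segment_mul, d_cone_top hp,
    d_eq_zero (Nat.lt_succ_self m) hp, mul_zero, zero_add, two_mul, ← two_smul ℤ, ← smul_sub,
    sub_add_cancel_left, map_smul, map_neg, map_smul, aug_one]
  simp

/-- The `shift` terms, `2` from the prism and twice `1` from the pyramid, cancel. -/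
theorem IsHomog.ev_prismSubCone {n : ℕ} {x : FreeLH ℤ} (hx : IsHomog n x) {m : ℕ} (h : n ≤ m)
    {p : PolytopeRing} (hp : p ∈ dimSub m) :
    ev x (prismSubCone p) = prismSubCone (ev x p) := by
  rw [prismSubCone, prismSubCone, map_sub, map_smul, hx.ev_cone h hp, ev_segment_mul, smul_add]
  abel

/-- The commutator of the prism and the pyramid operators. -/
noncomputable def prismCone (p : PolytopeRing) : PolytopeRing :=
  segment * cone p - cone (segment * p)

theorem prismCone_mem {m : ℕ} {p : PolytopeRing} (hp : p ∈ dimSub m) :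
    prismCone p ∈ dimSub (m + 2) :=
  Submodule.sub_mem _ (segment_mul_mem_dimSub (cone_mem_dimSub hp))
    (cone_mem_dimSub (segment_mul_mem_dimSub hp))

theorem IsHomog.aug_ev_prismCone {n : ℕ} {x : FreeLH ℤ} (hx : IsHomog n x) {m : ℕ} (h : n ≤ m + 1)
    {p : PolytopeRing} (hp : p ∈ dimSub m) :
    aug (ev x (prismCone p)) = aug (ev x (cone p)) - aug (ev x p) - aug (ev (PolytopeAlgebra.shift x) p) := by
  -- With `n ≤ m + 1` the pyramid rule applies to `x` on `segment * p` and to `shift x` on `p`, but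
  -- not to `x` on `p` when `n = m + 1`. So `ev x (cone p)` stays in the formula.
  have h1 : ev (PolytopeAlgebra.shift x) (cone p) = cone (ev (PolytopeAlgebra.shift x) p) +
      ev (PolytopeAlgebra.shift (PolytopeAlgebra.shift x)) p := by
    cases n with
    | zero => simp [hx.shift_eq_zero, shift_zero]
    | succ n => exact hx.shift.ev_cone (by omega) hp
  rw [prismCone, map_sub, ev_segment_mul, hx.ev_cone h (segment_mul_mem_dimSub hp), h1,
    ev_segment_mul, ev_segment_mul]
  simp only [map_sub, map_add, map_smul, aug_cone, aug_segment_mul, smul_add]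
  simp only [smul_eq_mul]
  ring

/-- With the next lemma: `prismCone` is a filter, invisible in degrees up to `m`, and in degree `m +
1` equivalent to testing on `prismSubCone`, but on a polytope one dimension higher. -/
theorem IsHomog.aug_ev_prismCone_eq_zero {n : ℕ} {x : FreeLH ℤ} (hx : IsHomog n x) {m : ℕ}
    (h : n ≤ m) {p : PolytopeRing} (hp : p ∈ dimSub m) : aug (ev x (prismCone p)) = 0 := by
  rw [hx.aug_ev_prismCone (by omega) hp, hx.ev_cone h hp, map_add, aug_cone]
  ring

theorem IsHomog.two_mul_aug_ev_prismCone {m : ℕ} {x : FreeLH ℤ} (hx : IsHomog (m + 1) x)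
    {p : PolytopeRing} (hp : p ∈ dimSub m) :
    2 * aug (ev x (prismCone p)) = -aug (ev x (prismSubCone p)) := by
  rw [hx.aug_ev_prismCone le_rfl hp, prismSubCone, map_sub, map_smul, ev_segment_mul,
    hx.ev_eq_zero (Nat.lt_succ_self m) hp]
  simp only [mul_zero, map_sub, map_add, map_zero, map_smul, smul_eq_mul]
  ring

theorem segment_pow_mul_mem {m : ℕ} {p : PolytopeRing} (hp : p ∈ dimSub m) (a : ℕ) :
    segment ^ a * p ∈ dimSub (m + a) := by
  induction a with
  | zero => simpa using hp
  | succ a ih => rw [pow_succ', mul_assoc]; exact segment_mul_mem_dimSub ih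

theorem aug_segment_pow_mul (a : ℕ) (p : PolytopeRing) : aug (segment ^ a * p) = aug p := by
  induction a with
  | zero => simp
  | succ a ih => rw [pow_succ', mul_assoc, aug_segment_mul, ih]

/-- Each prism adds a correction by `shift x`, whose degree is at most `m`, and this is killed by
`prismCone`. So prisms can be used to adjust the dimension freely. -/
theorem IsHomog.aug_ev_segment_pow_mul {n : ℕ} {x : FreeLH ℤ} (hx : IsHomog n x) {m : ℕ}
    (h : n ≤ m + 1) {p : PolytopeRing} (hp : p ∈ dimSub m) (a : ℕ) :
    aug (ev x (segment ^ a * prismCone p)) = aug (ev x (prismCone p)) := by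
  induction a generalizing n x with
  | zero => simp
  | succ a ih =>
    rw [pow_succ', mul_assoc, ev_segment_mul, map_add, aug_segment_mul, ih hx h, map_smul]
    cases n with
    | zero => simp [hx.shift_eq_zero]
    | succ n =>
      rw [ih hx.shift (by omega), hx.shift.aug_ev_prismCone_eq_zero (by omega) hp, smul_zero,
        add_zero]

/-! ### Normal forms modulo the ideal `J` -/

/-- The span of the monomials of degree `n` in which `Z_1` only occurs as the last factor. -/
noncomputable def normalForms : ℕ → Submodule ℤ (FreeLH ℤ)
  | 0 => ℤ ∙ (1 : FreeLH ℤ)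
  | 1 => ℤ ∙ (Z ℤ 1)
  | n + 2 => ⨆ k : Fin (n + 1),
      (normalForms (n - k)).map (LinearMap.mulLeft ℤ (Z ℤ (k + 2)))
termination_by n => n

theorem mem_normalForms {n : ℕ} {x : FreeLH ℤ} (hx : x ∈ normalForms (n + 2)) :
    ∃ y : Fin (n + 1) → FreeLH ℤ, (∀ k : Fin (n + 1), y k ∈ normalForms (n - k)) ∧
      x = ∑ k : Fin (n + 1), Z ℤ (k + 2) * y k := by
  rw [normalForms] at hx
  obtain ⟨f, hf, rfl⟩ := (Submodule.mem_iSup_iff_exists_finsupp _ _).1 hx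
  choose y hy hy' using hf
  refine ⟨y, hy, ?_⟩
  rw [Finsupp.sum_fintype _ _ fun _ => rfl]
  exact Finset.sum_congr rfl fun k _ => (hy' k).symm

theorem Z_mul_mem_normalForms {n k : ℕ} {x : FreeLH ℤ} (hx : x ∈ normalForms n) :
    Z ℤ (k + 2) * x ∈ normalForms (n + k + 2) := by
  rw [normalForms]
  refine Submodule.mem_iSup_of_mem (⟨k, by omega⟩ : Fin (n + k + 1)) ⟨x, ?_, rfl⟩
  have : n + k - k = n := by omega
  simpa [this] using hx

theorem isHomog_of_mem_normalForms {n : ℕ} {x : FreeLH ℤ} (hx : x ∈ normalForms n) :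
    IsHomog n x := by
  induction n using Nat.strong_induction_on generalizing x with
  | _ n ih =>
    match n, ih, hx with
    | 0, _, hx =>
      rw [normalForms] at hx
      obtain ⟨c, rfl⟩ := Submodule.mem_span_singleton.1 hx
      exact IsHomog.one.smul c
    | 1, _, hx =>
      rw [normalForms] at hx
      obtain ⟨c, rfl⟩ := Submodule.mem_span_singleton.1 hx
      have := (IsHomog.one.mul 0).smul c
      rwa [mul_one] at this
    | n + 2, ih, hx =>
      obtain ⟨y, hy, rfl⟩ := mem_normalForms hx
      refine IsHomog.sum _ _ fun k _ => ?_
      have := (ih (n - k) (by omega) (hy k)).mul' (k := k + 2)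
      convert this using 1
      omega

/-- Write `x = ∑ Z_{k+2} y_k`. On `prismSubCone p` the `y_k` commute past `prismSubCone`, and the
first letter then acts in top degree, which leaves `-2 ∑ aug (y_k p)`. This sum vanishes for all `p`
of the right dimension; since the `y_k` have distinct degrees, `prismCone` isolates them one after
another, and the induction hypothesis applies to each. -/
theorem normalForm_eq_zero {n : ℕ} {x : FreeLH ℤ} (hx : x ∈ normalForms (n + 1))
    (h : ∀ p ∈ dimSub n, aug (ev x (prismSubCone p)) = 0) : x = 0 := by
  induction n using Nat.strong_induction_on generalizing x with
  | _ n ih =>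
    match n, ih, hx, h with
    | 0, _, hx, h =>
      rw [normalForms] at hx
      obtain ⟨c, rfl⟩ := Submodule.mem_span_singleton.1 hx
      have := h 1 one_mem_dimSub
      rw [map_smul, LinearMap.smul_apply, map_smul, ev_Z, aug_d_prismSubCone one_mem_dimSub,
        aug_one, smul_eq_mul] at this
      have hc : c = 0 := by omega
      rw [hc, zero_smul]
    | n + 1, ih, hx, h =>
      obtain ⟨y, hy, rfl⟩ := mem_normalForms hx
      have hhom : ∀ k : Fin (n + 1), IsHomog (n - k) (y k) := fun k =>
        isHomog_of_mem_normalForms (hy k)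
      have hsum : ∀ p ∈ dimSub (n + 1), ∑ k, aug (ev (y k) p) = 0 := by
        intro p hp
        have e : aug (ev (∑ k : Fin (n + 1), Z ℤ (k + 2) * y k) (prismSubCone p)) =
            ∑ k, -2 * aug (ev (y k) p) := by
          rw [map_sum, LinearMap.sum_apply, map_sum]
          refine Finset.sum_congr rfl fun k _ => ?_
          have hmem : ev (y k) p ∈ dimSub (k + 1) :=
            (hhom k).ev_mem (by convert hp using 2; omega)
          rw [ev_Z_mul, (hhom k).ev_prismSubCone (by omega) hp]
          exact aug_d_prismSubCone hmem
        rw [h p hp, ← Finset.mul_sum] at e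
        omega
      -- The `y_k` are killed for increasing `k`, that is, from the highest degree `n - k`
      -- downwards.
      have hzero : ∀ k : ℕ, ∀ hk : k < n + 1, y ⟨k, hk⟩ = 0 := by
        intro k
        induction k using Nat.strong_induction_on with
        | _ k ihk =>
          intro hk
          -- The last `y_k` is a constant, and any single polytope of dimension `n + 1`, such as a
          -- cube, shows that it is zero.
          rcases (Nat.lt_succ_iff.1 hk).eq_or_lt with rfl | hlt
          · have hyk := hy ⟨k, hk⟩
            simp only [Nat.sub_self] at hyk
            rw [normalForms] at hyk
            obtain ⟨c, hc⟩ := Submodule.mem_span_singleton.1 hyk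
            have hp := segment_pow_mul_mem one_mem_dimSub (k + 1)
            rw [zero_add] at hp
            have := hsum _ hp
            rw [Finset.sum_eq_single ⟨k, hk⟩] at this
            · rw [← hc, map_smul, map_one, LinearMap.smul_apply, map_smul, Module.End.one_apply,
                aug_segment_pow_mul, aug_one, smul_eq_mul, mul_one] at this
              rw [← hc, this, zero_smul]
            · intro j _ hj
              have hjk : (j : ℕ) < k := lt_of_le_of_ne (Nat.lt_succ_iff.1 j.2) fun h =>
                hj (Fin.ext h)
              rw [ihk j hjk j.2, map_zero, LinearMap.zero_apply, map_zero]
            · intro h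
              exact absurd (Finset.mem_univ _) h
          · obtain ⟨m, hm⟩ := Nat.exists_eq_add_of_lt hlt
            have hd : n - k = m + 1 := by omega
            have hyk := hy ⟨k, hk⟩
            have hyh := hhom ⟨k, hk⟩
            simp only [hd] at hyk hyh
            refine ih m (by omega) hyk fun r hr => ?_
            -- The test element has dimension `m + 2 + k = n + 1`. Terms with `j < k` are already
            -- zero, and those with `j > k` have degree at most `m` and are invisible to
            -- `prismCone`; only `y_k`, of degree `m + 1`, is left.
            have hp := segment_pow_mul_mem (prismCone_mem hr) k
            have := hsum _ (by convert hp using 2; omega)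
            rw [Finset.sum_eq_single ⟨k, hk⟩] at this
            · rw [hyh.aug_ev_segment_pow_mul le_rfl hr] at this
              have h2 := hyh.two_mul_aug_ev_prismCone hr
              rw [this] at h2
              omega
            · intro j _ hj
              have hne : (j : ℕ) ≠ k := fun h => hj (Fin.ext h)
              rcases lt_or_gt_of_ne hne with hjk | hjk
              · rw [ihk j hjk j.2, map_zero, LinearMap.zero_apply, map_zero]
              · rw [(hhom j).aug_ev_segment_pow_mul (by omega) hr,
                  (hhom j).aug_ev_prismCone_eq_zero (by omega) hr]
            · intro h
              exact absurd (Finset.mem_univ _) h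
      exact Finset.sum_eq_zero fun k _ => by rw [hzero k k.2, mul_zero]

/-- Normal forms act faithfully on the ring of polytopes. -/
theorem eq_zero_of_ev_eq_zero {x : FreeLH ℤ} (hx : x ∈ ⨆ n, normalForms n) (h : ev x = 0) :
    x = 0 := by
  obtain ⟨f, hf, rfl⟩ := (Submodule.mem_iSup_iff_exists_finsupp _ _).1 hx
  -- On `p` of dimension `n`, only the component of degree `n` lands in dimension `0`: lower ones
  -- land in positive dimension and higher ones vanish. So `augZero` separates the degrees.
  have key : ∀ n, ∀ p ∈ dimSub n, aug (ev (f n) p) = 0 := by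
    intro n p hp
    have h1 : augZero (ev (f.sum fun _ xi => xi) p) = 0 := by
      rw [h, LinearMap.zero_apply, map_zero]
    rw [Finsupp.sum, map_sum, LinearMap.sum_apply, map_sum, Finset.sum_eq_single n] at h1
    · rwa [augZero_eq_aug ((isHomog_of_mem_normalForms (hf n)).ev_mem (by rwa [zero_add]))] at h1
    · intro i _ hi
      have hh := isHomog_of_mem_normalForms (hf i)
      rcases lt_or_gt_of_ne hi with hlt | hlt
      · obtain ⟨j, rfl⟩ := Nat.exists_eq_add_of_le' hlt.le
        exact augZero_eq_zero (by omega) (hh.ev_mem hp)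
      · rw [hh.ev_eq_zero hlt hp, map_zero]
    · intro hn
      rw [Finsupp.notMem_support_iff.1 hn, map_zero, LinearMap.zero_apply, map_zero]
  refine Finset.sum_eq_zero fun n _ => ?_
  cases n with
  | zero =>
    have h0 := hf 0
    rw [normalForms] at h0
    obtain ⟨c, hc⟩ := Submodule.mem_span_singleton.1 h0
    have := key 0 1 one_mem_dimSub
    rw [← hc, map_smul, LinearMap.smul_apply, map_smul, ev_one_apply, aug_one,
      smul_eq_mul, mul_one] at this
    rw [← hc, this, zero_smul]
  | succ n => exact normalForm_eq_zero (hf (n + 1)) fun p hp => key _ _ (prismSubCone_mem hp)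

/-- The combinations of normal forms and elements of `J`. -/
noncomputable def normalFormsAddJ : Submodule ℤ (FreeLH ℤ) :=
  (⨆ n, normalForms n) ⊔ (FreeLH.J ℤ).restrictScalars ℤ

theorem normalForms_le (n : ℕ) : normalForms n ≤ normalFormsAddJ :=
  (le_iSup normalForms n).trans le_sup_left

theorem mem_normalFormsAddJ_of_mem_J {x : FreeLH ℤ} (hx : x ∈ FreeLH.J ℤ) :
    x ∈ normalFormsAddJ :=
  (le_sup_right : (FreeLH.J ℤ).restrictScalars ℤ ≤ normalFormsAddJ) hx

theorem mul_mem_normalFormsAddJ {z : FreeLH ℤ}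
    (h : ∀ n, ∀ x ∈ normalForms n, z * x ∈ normalFormsAddJ) {x : FreeLH ℤ}
    (hx : x ∈ normalFormsAddJ) : z * x ∈ normalFormsAddJ := by
  have h1 : normalFormsAddJ ≤ normalFormsAddJ.comap (LinearMap.mulLeft ℤ z) :=
    sup_le (iSup_le fun n x hx => h n x hx) fun x hx =>
      mem_normalFormsAddJ_of_mem_J (Ideal.mul_mem_left _ z hx)
  exact h1 hx

theorem Z_add_two_mul_mem {k : ℕ} {x : FreeLH ℤ} (hx : x ∈ normalFormsAddJ) :
    Z ℤ (k + 2) * x ∈ normalFormsAddJ :=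
  mul_mem_normalFormsAddJ (fun _ _ hx => normalForms_le _ (Z_mul_mem_normalForms hx)) hx

/-- Splitting off `i = 0` and `i = 1` isolates `Z_1 Z_{k+1}`; all other terms begin with a letter of
index at least 2. -/
theorem rel_add_two (k : ℕ) : FreeLH.rel ℤ (k + 2) = Z ℤ (k + 2) - Z ℤ 1 * Z ℤ (k + 1) +
    ∑ p ∈ antidiagonal k, (-1) ^ p.1 * (Z ℤ (p.1 + 2) * Z ℤ p.2) := by
  rw [FreeLH.rel, Finset.Nat.sum_antidiagonal_succ, Finset.Nat.sum_antidiagonal_succ]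
  simp only [pow_succ, pow_zero, one_mul, FreeLH.Z, zero_add]
  simp only [mul_neg, neg_mul, mul_one, one_mul, neg_neg]
  abel

/-- The rewriting step. Among the terms that replace `Z_1 Z_{k+1} y` are `Z_j y` with `j = 1`,
whence the hypothesis on `Z_1 y`; it concerns a shorter word. -/
theorem Z_one_mul_Z_mul_mem {k : ℕ} {y : FreeLH ℤ} (hy : y ∈ normalFormsAddJ)
    (h1 : Z ℤ 1 * y ∈ normalFormsAddJ) : Z ℤ 1 * (Z ℤ (k + 1) * y) ∈ normalFormsAddJ := by
  have hZ : ∀ j, Z ℤ j * y ∈ normalFormsAddJ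
    | 0 => by rwa [FreeLH.Z, one_mul]
    | 1 => h1
    | j + 2 => Z_add_two_mul_mem hy
  have e : Z ℤ 1 * (Z ℤ (k + 1) * y) = Z ℤ (k + 2) * y +
      ∑ p ∈ antidiagonal k, (-1 : ℤ) ^ p.1 • (Z ℤ (p.1 + 2) * (Z ℤ p.2 * y)) -
        FreeLH.rel ℤ (k + 2) * y := by
    rw [rel_add_two, add_mul, sub_mul, Finset.sum_mul, mul_assoc (Z ℤ 1)]
    have : ∀ p : ℕ × ℕ, (-1) ^ p.1 * (Z ℤ (p.1 + 2) * Z ℤ p.2) * y =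
        (-1 : ℤ) ^ p.1 • (Z ℤ (p.1 + 2) * (Z ℤ p.2 * y)) := by
      intro p
      rcases Nat.even_or_odd p.1 with h | h <;> rw [h.neg_one_pow, h.neg_one_pow] <;>
        simp [mul_assoc]
    rw [Finset.sum_congr rfl fun p _ => this p]
    abel
  rw [e]
  refine Submodule.sub_mem _ (Submodule.add_mem _ (hZ _) (Submodule.sum_mem _ fun p _ =>
    Submodule.smul_mem _ _ (Z_add_two_mul_mem (hZ _)))) (mem_normalFormsAddJ_of_mem_J
      (Ideal.mul_mem_right _ _ (FreeLH.rel_mem_J ℤ (by omega))))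

theorem Z_one_mul_mem {n : ℕ} {x : FreeLH ℤ} (hx : x ∈ normalForms n) :
    Z ℤ 1 * x ∈ normalFormsAddJ := by
  have h1 : Z ℤ 1 ∈ normalFormsAddJ := normalForms_le 1 (by
    rw [normalForms]; exact Submodule.mem_span_singleton_self _)
  have h0 : 1 ∈ normalFormsAddJ := normalForms_le 0 (by
    rw [normalForms]; exact Submodule.mem_span_singleton_self _)
  induction n using Nat.strong_induction_on generalizing x with
  | _ n ih =>
    match n, ih, hx with
    | 0, _, hx =>
      rw [normalForms] at hx
      obtain ⟨c, rfl⟩ := Submodule.mem_span_singleton.1 hx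
      rw [mul_smul_comm, mul_one]
      exact Submodule.smul_mem _ c h1
    | 1, _, hx =>
      rw [normalForms] at hx
      obtain ⟨c, rfl⟩ := Submodule.mem_span_singleton.1 hx
      rw [mul_smul_comm]
      refine Submodule.smul_mem _ c ?_
      have := Z_one_mul_Z_mul_mem (k := 0) h0 (by rwa [mul_one])
      rwa [mul_one] at this
    | n + 2, ih, hx =>
      obtain ⟨y, hy, rfl⟩ := mem_normalForms hx
      rw [Finset.mul_sum]
      exact Submodule.sum_mem _ fun k _ => Z_one_mul_Z_mul_mem (normalForms_le _ (hy k))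
        (ih (n - k) (by omega) (hy k))

/-- The sum contains `1` and is stable under left multiplication by every `Z_k`, so it is
everything. -/
theorem normalFormsAddJ_eq_top : normalFormsAddJ = ⊤ := by
  rw [eq_top_iff]
  rintro x -
  suffices h : ∀ y ∈ normalFormsAddJ, x * y ∈ normalFormsAddJ by
    have := h 1 (normalForms_le 0 (by rw [normalForms]; exact Submodule.mem_span_singleton_self _))
    rwa [mul_one] at this
  induction x using FreeLH.induction_Z with
  | hz k =>
    intro y hy
    match k with
    | 0 => rwa [FreeLH.Z, one_mul]
    | 1 => exact mul_mem_normalFormsAddJ (fun _ _ => Z_one_mul_mem) hy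
    | k + 2 => exact Z_add_two_mul_mem hy
  | hc c =>
    intro y hy
    rw [← Algebra.smul_def]
    exact Submodule.smul_mem _ c hy
  | hm x x' hx hx' =>
    intro y hy
    rw [mul_assoc]
    exact hx _ (hx' y hy)
  | ha x x' hx hx' =>
    intro y hy
    rw [add_mul]
    exact Submodule.add_mem _ (hx y hy) (hx' y hy)

theorem ev_eq_zero_of_mem_J {x : FreeLH ℤ} (hx : x ∈ FreeLH.J ℤ) : ev x = 0 := by
  refine FreeLH.J_le_ker ℤ (ev : FreeLH ℤ →+* Module.End ℤ PolytopeRing) (fun n hn => ?_) hx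
  rw [← sum_neg_one_pow_d_mul_d hn, FreeLH.rel, map_sum]
  refine Finset.sum_congr rfl fun p _ => ?_
  rw [RingHom.coe_coe, map_mul, map_mul, ev_Z, ev_Z, map_pow, map_neg, map_one]
  rcases Nat.even_or_odd p.1 with h | h <;> simp [h.neg_one_pow]

/-- The kernel of the action of the free Leibnitz-Hopf algebra on the ring of polytopes. -/
theorem ev_eq_zero_iff {x : FreeLH ℤ} : ev x = 0 ↔ x ∈ FreeLH.J ℤ := by
  refine ⟨fun h => ?_, ev_eq_zero_of_mem_J⟩
  have hx : x ∈ normalFormsAddJ := normalFormsAddJ_eq_top ▸ Submodule.mem_top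
  obtain ⟨y, hy, z, hz, rfl⟩ := Submodule.mem_sup.1 hx
  have hz' : z ∈ FreeLH.J ℤ := hz
  rw [map_add, ev_eq_zero_of_mem_J hz', add_zero] at h
  rwa [eq_zero_of_ev_eq_zero hy h, zero_add]

/-! ### Leibnitz-Hopf algebras with `Φ(-t) Φ(t) = 1` -/

namespace IsLeibnitzHopf

variable {R H K : Type*} [CommRing R] [Ring H] [HopfAlgebra R H] [Ring K] [HopfAlgebra R K]
  {h : ℕ → H} {k : ℕ → K}

/-- The counit is forced by the comultiplication. In `∑ ε(h i) h j = h n` the terms with `0 < i < n`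
vanish by induction, which leaves `h n + ε(h n) • 1 = h n`. -/
theorem counit_eq (hh : IsLeibnitzHopf R H h) (n : ℕ) :
    Coalgebra.counit (R := R) (h n) = if n = 0 then 1 else 0 := by
  induction n using Nat.strong_induction_on with
  | _ n ih =>
    cases n with
    | zero => rw [hh.zero, Bialgebra.counit_one, if_pos rfl]
    | succ n =>
      have h1 := congrArg (TensorProduct.lid R H) (Coalgebra.rTensor_counit_comul (R := R) (h (n + 1)))
      rw [hh.comul, map_sum, map_sum, Finset.Nat.sum_antidiagonal_succ, hh.zero] at h1
      simp only [LinearMap.rTensor_tmul, TensorProduct.lid_tmul, Bialgebra.counit_one,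
        one_smul] at h1
      rw [add_eq_left, Finset.sum_eq_single (n, 0)] at h1
      · have h2 := congrArg (Coalgebra.counit (R := R)) h1
        rw [hh.zero, map_smul, Bialgebra.counit_one, smul_eq_mul, mul_one, map_zero] at h2
        rw [h2, if_neg (Nat.succ_ne_zero n)]
      · rintro ⟨i, j⟩ hij hne
        rw [Finset.HasAntidiagonal.mem_antidiagonal] at hij
        have hi : i < n := by
          refine lt_of_le_of_ne (by simp only at hij; omega) fun he => hne ?_
          subst he
          simp only [add_eq_left] at hij
          rw [hij]
        simp only
        rw [ih (i + 1) (by omega), if_neg (Nat.succ_ne_zero i), zero_smul]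
      · intro h'
        exact absurd (Finset.HasAntidiagonal.mem_antidiagonal.2 (add_zero n)) h'

theorem mk_antipode_mul (hh : IsLeibnitzHopf R H h) :
    PowerSeries.mk (fun n => HopfAlgebra.antipode R (h n)) * PowerSeries.mk h = 1 := by
  ext n
  have h1 := HopfAlgebra.mul_antipode_rTensor_comul_apply (R := R) (h n)
  rw [hh.comul, map_sum, map_sum, hh.counit_eq] at h1
  simp only [LinearMap.rTensor_tmul, LinearMap.mul'_apply] at h1
  rw [PowerSeries.coeff_mul, PowerSeries.coeff_one]
  simp only [PowerSeries.coeff_mk]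
  rw [h1]
  split_ifs <;> simp

theorem mul_mk_antipode (hh : IsLeibnitzHopf R H h) :
    PowerSeries.mk h * PowerSeries.mk (fun n => HopfAlgebra.antipode R (h n)) = 1 := by
  ext n
  have h1 := HopfAlgebra.mul_antipode_lTensor_comul_apply (R := R) (h n)
  rw [hh.comul, map_sum, map_sum, hh.counit_eq] at h1
  simp only [LinearMap.lTensor_tmul, LinearMap.mul'_apply] at h1
  rw [PowerSeries.coeff_mul, PowerSeries.coeff_one]
  simp only [PowerSeries.coeff_mk]
  rw [h1]
  split_ifs <;> simp

/-- The antipode axioms say that the series of the `χ(h n)` is the two-sided inverse of `Φ(t)`;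
`IsOdd` says that `Φ(-t)` is a left inverse. Inverses are unique. -/
theorem isOdd_iff_antipode (hh : IsLeibnitzHopf R H h) :
    FreeLH.IsOdd h ↔ ∀ n, HopfAlgebra.antipode R (h n) = (-1) ^ n * h n := by
  constructor
  · intro ho n
    have := left_inv_eq_right_inv ho hh.mul_mk_antipode
    simpa using (congrArg (PowerSeries.coeff n) this).symm
  · intro ha
    have := hh.mk_antipode_mul
    simp only [ha] at this
    exact this

theorem algHom_ext (hh : IsLeibnitzHopf R H h) {B : Type*} [Semiring B] [Algebra R B]
    {f g : H →ₐ[R] B} (hfg : ∀ n, f (h n) = g (h n)) : f = g := by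
  refine AlgHom.ext_of_adjoin_eq_top hh.adjoin_eq_top ?_
  rintro _ ⟨n, -, rfl⟩
  exact hfg n

theorem counit_comp (hh : IsLeibnitzHopf R H h) (hk : IsLeibnitzHopf R K k) {f : H →ₐ[R] K}
    (hf : ∀ n, f (h n) = k n) :
    (Bialgebra.counitAlgHom R K).comp f = Bialgebra.counitAlgHom R H := by
  refine hh.algHom_ext fun n => ?_
  rw [AlgHom.comp_apply, hf, Bialgebra.counitAlgHom_apply, Bialgebra.counitAlgHom_apply,
    hh.counit_eq, hk.counit_eq]

theorem map_comp_comul (hh : IsLeibnitzHopf R H h) (hk : IsLeibnitzHopf R K k) {f : H →ₐ[R] K}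
    (hf : ∀ n, f (h n) = k n) :
    (Algebra.TensorProduct.map f f).comp (Bialgebra.comulAlgHom R H) =
      (Bialgebra.comulAlgHom R K).comp f := by
  refine hh.algHom_ext fun n => ?_
  rw [AlgHom.comp_apply, AlgHom.comp_apply, hf, Bialgebra.comulAlgHom_apply,
    Bialgebra.comulAlgHom_apply, hh.comul, hk.comul, map_sum]
  refine Finset.sum_congr rfl fun p _ => ?_
  rw [Algebra.TensorProduct.map_tmul, hf, hf]

/-- An algebra homomorphism which respects the sequences is a homomorphism of Hopf algebras. -/
noncomputable def hopfHom (hh : IsLeibnitzHopf R H h) (hk : IsLeibnitzHopf R K k) (f : H →ₐ[R] K)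
    (hf : ∀ n, f (h n) = k n) : HopfHom R H K :=
  BialgHom.ofAlgHom f (hh.counit_comp hk hf) (hh.map_comp_comul hk hf)

/-- An isomorphism of algebras which respects the sequences is an isomorphism of Hopf algebras. -/
noncomputable def hopfEquiv (hh : IsLeibnitzHopf R H h) (hk : IsLeibnitzHopf R K k)
    (f : H ≃ₐ[R] K) (hf : ∀ n, f (h n) = k n) : HopfEquiv R H K :=
  BialgEquiv.ofAlgEquiv f (hh.counit_comp (f := f.toAlgHom) hk hf)
    (hh.map_comp_comul (f := f.toAlgHom) hk hf)

theorem hopfHom_ext (hh : IsLeibnitzHopf R H h) {f g : HopfHom R H K}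
    (hfg : ∀ n, f (h n) = g (h n)) : f = g := by
  have h1 : (f : H →ₐ[R] K) = (g : H →ₐ[R] K) := hh.algHom_ext hfg
  exact DFunLike.ext _ _ fun x => AlgHom.congr_fun h1 x

end IsLeibnitzHopf

namespace FreeLH

variable (R : Type*) [CommRing R]

theorem adjoin_Z_eq_top : Algebra.adjoin R (Z R '' {n | 1 ≤ n}) = ⊤ := by
  rw [eq_top_iff, ← FreeAlgebra.adjoin_range_ι R ℕ]
  refine Algebra.adjoin_mono ?_
  rintro _ ⟨n, rfl⟩
  exact ⟨n + 1, Nat.succ_pos n, rfl⟩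

theorem isLeibnitzHopf_quotient :
    IsLeibnitzHopf R (FreeLH R ⧸ J R) fun n => Ideal.Quotient.mk (J R) (Z R n) where
  zero := map_one _
  adjoin_eq_top := by
    have h := (AlgHom.map_adjoin (Ideal.Quotient.mkₐ R (J R)) (Z R '' {n | 1 ≤ n})).symm
    rw [adjoin_Z_eq_top, Algebra.map_top, (AlgHom.range_eq_top _).2
      (Ideal.Quotient.mkₐ_surjective R (J R)), Set.image_image] at h
    exact h
  comul n := by
    have h := (CoalgHomClass.map_comp_comul_apply
      (Bialgebra.Quotient.mkBialgHom (R := R) (J R)) (Z R n)).symm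
    rw [comul_Z, map_sum] at h
    exact h

variable {R}

/-- The universal property of the quotient by `J`. -/
noncomputable def liftOfIsOdd {B : Type*} [Ring B] [Algebra R B] {b : ℕ → B} (h0 : b 0 = 1)
    (hb : IsOdd b) : (FreeLH R ⧸ J R) →ₐ[R] B :=
  Ideal.Quotient.liftₐ (J R) (FreeAlgebra.lift R fun n => b (n + 1)) fun x hx =>
    eq_zero_of_isOdd R (FreeAlgebra.lift R fun n => b (n + 1) : FreeLH R →ₐ[R] B).toRingHom (by
      convert hb using 2 with n
      cases n with
      | zero => rw [Z, map_one, h0]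
      | succ n => exact FreeAlgebra.lift_ι_apply _ _) hx

theorem liftOfIsOdd_mk {B : Type*} [Ring B] [Algebra R B] {b : ℕ → B} (h0 : b 0 = 1)
    (hb : IsOdd b) (n : ℕ) :
    liftOfIsOdd (R := R) h0 hb (Ideal.Quotient.mk (J R) (Z R n)) = b n := by
  change FreeAlgebra.lift R (fun n => b (n + 1)) (Z R n) = b n
  cases n with
  | zero => rw [Z, map_one, h0]
  | succ n => exact FreeAlgebra.lift_ι_apply _ _

end FreeLH

/-! ### Transport of Hopf algebra structures -/

section Transport

variable {R A B : Type*} [CommRing R] [Ring A] [HopfAlgebra R A] [Ring B] [Algebra R B]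

/-- The comultiplication carried along an isomorphism of algebras. -/
noncomputable def transportComul (e : A ≃ₐ[R] B) : B →ₐ[R] B ⊗[R] B :=
  (Algebra.TensorProduct.map e.toAlgHom e.toAlgHom).comp
    ((Bialgebra.comulAlgHom R A).comp e.symm.toAlgHom)

theorem transportComul_apply (e : A ≃ₐ[R] B) (a : A) : transportComul e (e a) =
    Algebra.TensorProduct.map e.toAlgHom e.toAlgHom (Coalgebra.comul (R := R) a) := by
  simp [transportComul]

/-- The counit carried along an isomorphism of algebras. -/
noncomputable def transportCounit (e : A ≃ₐ[R] B) : B →ₐ[R] R :=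
  (Bialgebra.counitAlgHom R A).comp e.symm.toAlgHom

theorem transportCounit_apply (e : A ≃ₐ[R] B) (a : A) : transportCounit e (e a) =
    Coalgebra.counit (R := R) a := by
  simp [transportCounit]

/-- The bialgebra structure carried along an isomorphism of algebras. -/
noncomputable abbrev transportBialgebra (e : A ≃ₐ[R] B) : Bialgebra R B :=
  Bialgebra.ofAlgHom (transportComul e) (transportCounit e)
    (by
      -- Both sides of coassociativity for `B`, evaluated at `e a`, are images under `e ⊗ e ⊗ e` of
      -- the two sides for `A` at `a`.
      have h1 : ∀ (s : A ⊗[R] A) (y : A), Algebra.TensorProduct.assoc R R R B B B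
          (Algebra.TensorProduct.map e.toAlgHom e.toAlgHom s ⊗ₜ e y) =
          Algebra.TensorProduct.map e.toAlgHom
            (Algebra.TensorProduct.map e.toAlgHom e.toAlgHom)
            (Algebra.TensorProduct.assoc R R R A A A (s ⊗ₜ y)) := by
        intro s y
        induction s using TensorProduct.induction_on with
        | zero => simp
        | add s t hs ht => simp only [map_add, TensorProduct.add_tmul, hs, ht]
        | tmul u v => simp
      have h2 : ∀ t : A ⊗[R] A, Algebra.TensorProduct.assoc R R R B B B
          (Algebra.TensorProduct.map (transportComul e) (.id R B)
            (Algebra.TensorProduct.map e.toAlgHom e.toAlgHom t)) =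
          Algebra.TensorProduct.map e.toAlgHom
            (Algebra.TensorProduct.map e.toAlgHom e.toAlgHom)
            (TensorProduct.assoc R A A A (Coalgebra.comul.rTensor A t)) := by
        intro t
        induction t using TensorProduct.induction_on with
        | zero => simp
        | add s t hs ht => simp only [map_add, hs, ht]
        | tmul u v =>
          rw [Algebra.TensorProduct.map_tmul, Algebra.TensorProduct.map_tmul, LinearMap.rTensor_tmul]
          change Algebra.TensorProduct.assoc R R R B B B (transportComul e (e u) ⊗ₜ e v) = _
          rw [transportComul_apply, h1]
          rfl
      have h3 : ∀ t : A ⊗[R] A, Algebra.TensorProduct.map (.id R B) (transportComul e)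
            (Algebra.TensorProduct.map e.toAlgHom e.toAlgHom t) =
          Algebra.TensorProduct.map e.toAlgHom
            (Algebra.TensorProduct.map e.toAlgHom e.toAlgHom) (Coalgebra.comul.lTensor A t) := by
        intro t
        induction t using TensorProduct.induction_on with
        | zero => simp
        | add s t hs ht => simp only [map_add, hs, ht]
        | tmul u v =>
          rw [Algebra.TensorProduct.map_tmul, Algebra.TensorProduct.map_tmul,
            LinearMap.lTensor_tmul, Algebra.TensorProduct.map_tmul]
          change e u ⊗ₜ transportComul e (e v) = _
          rw [transportComul_apply]
          rfl
      ext b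
      obtain ⟨a, rfl⟩ := e.surjective b
      simp only [AlgHom.comp_apply, transportComul_apply]
      rw [h3, ← Coalgebra.coassoc_apply, ← h2]
      rfl)
    (by
      have h1 : ∀ t : A ⊗[R] A, Algebra.TensorProduct.map (transportCounit e) (.id R B)
            (Algebra.TensorProduct.map e.toAlgHom e.toAlgHom t) =
          Algebra.TensorProduct.map (.id R R) e.toAlgHom (Coalgebra.counit.rTensor A t) := by
        intro t
        induction t using TensorProduct.induction_on with
        | zero => simp
        | add s t hs ht => simp only [map_add, hs, ht]
        | tmul u v =>
          rw [Algebra.TensorProduct.map_tmul, Algebra.TensorProduct.map_tmul,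
            LinearMap.rTensor_tmul, Algebra.TensorProduct.map_tmul]
          change transportCounit e (e u) ⊗ₜ e v = _
          rw [transportCounit_apply]
          rfl
      ext b
      obtain ⟨a, rfl⟩ := e.surjective b
      rw [AlgHom.comp_apply, transportComul_apply, h1, Coalgebra.rTensor_counit_comul,
        Algebra.TensorProduct.map_tmul]
      rfl)
    (by
      have h1 : ∀ t : A ⊗[R] A, Algebra.TensorProduct.map (.id R B) (transportCounit e)
            (Algebra.TensorProduct.map e.toAlgHom e.toAlgHom t) =
          Algebra.TensorProduct.map e.toAlgHom (.id R R) (Coalgebra.counit.lTensor A t) := by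
        intro t
        induction t using TensorProduct.induction_on with
        | zero => simp
        | add s t hs ht => simp only [map_add, hs, ht]
        | tmul u v =>
          rw [Algebra.TensorProduct.map_tmul, Algebra.TensorProduct.map_tmul,
            LinearMap.lTensor_tmul, Algebra.TensorProduct.map_tmul]
          change e u ⊗ₜ transportCounit e (e v) = _
          rw [transportCounit_apply]
          rfl
      ext b
      obtain ⟨a, rfl⟩ := e.surjective b
      rw [AlgHom.comp_apply, transportComul_apply, h1, Coalgebra.lTensor_counit_comul,
        Algebra.TensorProduct.map_tmul]
      rfl)

/-- The Hopf algebra structure carried along an isomorphism of algebras. -/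
noncomputable abbrev transportHopf (e : A ≃ₐ[R] B) : HopfAlgebra R B :=
  letI : HopfAlgebraStruct R B :=
    { transportBialgebra e with
      antipode := e.toLinearMap ∘ₗ HopfAlgebra.antipode R ∘ₗ e.symm.toLinearMap }
  -- The antipode identities are inherited through `e`, a surjective bialgebra homomorphism that
  -- commutes with the antipodes.
  HopfAlgebra.ofSurjective
    (BialgHom.ofAlgHom e.toAlgHom
      (AlgHom.ext fun a => transportCounit_apply e a)
      (AlgHom.ext fun a => (transportComul_apply e a).symm))
    e.surjective
    (LinearMap.ext fun a => congrArg (fun x => e (HopfAlgebra.antipode R x)) (e.symm_apply_apply a))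

theorem isLeibnitzHopf_transport (e : A ≃ₐ[R] B) {h : ℕ → A} (hh : IsLeibnitzHopf R A h) :
    letI := transportHopf e
    IsLeibnitzHopf R B fun n => e (h n) := by
  let := transportHopf e
  refine ⟨?_, ?_, fun n => ?_⟩
  · rw [hh.zero, map_one]
  · have h1 := (AlgHom.map_adjoin e.toAlgHom (h '' {n | 1 ≤ n})).symm
    rw [hh.adjoin_eq_top, Algebra.map_top, (AlgHom.range_eq_top _).2 e.surjective,
      Set.image_image] at h1
    exact h1
  · refine (transportComul_apply e (h n)).trans ?_
    rw [hh.comul, map_sum]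
    rfl

end Transport

/-! ### The Milnor rule -/

section Milnor

variable {R X M : Type*} [CommRing R] [Ring X] [HopfAlgebra R X] [Ring M] [Algebra R M]

/-- The map `a ⊗ b ↦ a(u) b(v)`. -/
noncomputable def actTensor (φ : X →ₐ[R] Module.End R M) (u v : M) : X ⊗[R] X →ₗ[R] M :=
  LinearMap.mul' R M ∘ₗ TensorProduct.map (LinearMap.applyₗ u ∘ₗ φ.toLinearMap)
    (LinearMap.applyₗ v ∘ₗ φ.toLinearMap)

theorem actTensor_tmul (φ : X →ₐ[R] Module.End R M) (u v : M) (a b : X) :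
    actTensor φ u v (a ⊗ₜ b) = φ a u * φ b v := rfl

/-- The elements satisfying the rule form a subalgebra, because `Δ` and the action are
multiplicative; it contains the generators. -/
theorem IsLeibnitzHopf.apply_mul_eq_actTensor {h : ℕ → X} (hh : IsLeibnitzHopf R X h)
    (φ : X →ₐ[R] Module.End R M)
    (hφ : ∀ n u v, φ (h n) (u * v) = ∑ p ∈ antidiagonal n, φ (h p.1) u * φ (h p.2) v)
    (x : X) (u v : M) : φ x (u * v) = actTensor φ u v (Coalgebra.comul (R := R) x) := by
  have hx : x ∈ Algebra.adjoin R (h '' {n | 1 ≤ n}) := hh.adjoin_eq_top ▸ Algebra.mem_top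
  induction hx using Algebra.adjoin_induction generalizing u v with
  | mem x hx =>
    obtain ⟨n, -, rfl⟩ := hx
    rw [hh.comul, map_sum, hφ]
    rfl
  | algebraMap c =>
    rw [Bialgebra.comul_algebraMap, Algebra.TensorProduct.algebraMap_apply, actTensor_tmul,
      map_one, AlgHom.commutes, Module.algebraMap_end_apply, Module.algebraMap_end_apply,
      Module.End.one_apply, smul_mul_assoc]
  | add x y _ _ hx hy =>
    rw [map_add, map_add, map_add, ← hx, ← hy]
    rfl
  | mul x y _ _ hx hy =>
    -- Multiplying by `Δ x` on the left amounts to applying `x` to the result. On pure tensors this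
    -- is the rule for `x` at the vectors `a(u)`, `b(v)`, so `u` and `v` must be general in the
    -- induction.
    have h1 : ∀ s : X ⊗[R] X, actTensor φ u v (Coalgebra.comul (R := R) x * s) =
        φ x (actTensor φ u v s) := by
      intro s
      induction s using TensorProduct.induction_on with
      | zero => simp
      | add s t hs ht => rw [mul_add, map_add, map_add, map_add, hs, ht]
      | tmul a b =>
        rw [actTensor_tmul, hx]
        generalize Coalgebra.comul (R := R) x = t
        induction t using TensorProduct.induction_on with
        | zero => simp
        | add s t hs ht => rw [add_mul, map_add, map_add, hs, ht]
        | tmul a' b' =>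
          rw [Algebra.TensorProduct.tmul_mul_tmul, actTensor_tmul, actTensor_tmul, map_mul φ,
            map_mul φ, Module.End.mul_apply, Module.End.mul_apply]
    rw [Bialgebra.comul_mul, h1, ← hy, map_mul φ, Module.End.mul_apply]

/-- A Leibnitz-Hopf algebra satisfies the Milnor rule as soon as its generators do. -/
theorem IsLeibnitzHopf.milnorRule {h : ℕ → X} (hh : IsLeibnitzHopf R X h)
    (φ : X →ₐ[R] Module.End R M)
    (hφ : ∀ n u v, φ (h n) (u * v) = ∑ p ∈ antidiagonal n, φ (h p.1) u * φ (h p.2) v) :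
    MilnorRule R fun x u => φ x u := by
  intro x u v ι r
  change φ x (u * v) = _
  rw [hh.apply_mul_eq_actTensor φ hφ, ← r.eq, map_sum]
  rfl

end Milnor

/-! ### The universal property -/

section Universal

variable {R D : Type*} [CommRing R] [Ring D] [HopfAlgebra R D] {δ : ℕ → D}

/-- A Leibnitz-Hopf algebra which is the quotient of the free one by `J` is universal among the
Leibnitz-Hopf algebras with antipode `h n ↦ (-1)^n h n`. -/
theorem IsLeibnitzHopf.existsUnique_hopfHom (hD : IsLeibnitzHopf R D δ)
    (e : (FreeLH R ⧸ FreeLH.J R) ≃ₐ[R] D)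
    (he : ∀ n, e (Ideal.Quotient.mk (FreeLH.J R) (Z R n)) = δ n)
    {H : Type*} [Ring H] [HopfAlgebra R H] {h : ℕ → H} (hh : IsLeibnitzHopf R H h)
    (ha : ∀ n, HopfAlgebra.antipode R (h n) = (-1) ^ n * h n) :
    ∃! f : HopfHom R D H, ∀ n, f (δ n) = h n := by
  have ho := hh.isOdd_iff_antipode.2 ha
  have hf : ∀ n, ((FreeLH.liftOfIsOdd (R := R) hh.zero ho).comp e.symm.toAlgHom) (δ n) = h n := by
    intro n
    rw [← he n]
    exact (congrArg _ (e.symm_apply_apply _)).trans (FreeLH.liftOfIsOdd_mk hh.zero ho n)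
  exact ⟨hD.hopfHom hh _ hf, hf, fun g hg => hD.hopfHom_ext fun n => (hg n).trans (hf n).symm⟩

end Universal

/-! ### The ring of operators as a quotient of the free Leibnitz-Hopf algebra -/

/-- A ring homomorphism is a homomorphism of `ℤ`-algebras, for all algebra structures. -/
def intAlgHom {A B : Type*} [Ring A] [Ring B] {_ : Algebra ℤ A} {_ : Algebra ℤ B}
    (f : A →+* B) : A →ₐ[ℤ] B where
  toRingHom := f
  commutes' c := by
    change f (algebraMap ℤ A c) = _
    rw [eq_intCast (algebraMap ℤ A), eq_intCast (algebraMap ℤ B), map_intCast]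

/-- A ring isomorphism is an isomorphism of `ℤ`-algebras, for all algebra structures. -/
def intAlgEquiv {A B : Type*} [Ring A] [Ring B] {_ : Algebra ℤ A} {_ : Algebra ℤ B}
    (f : A ≃+* B) : A ≃ₐ[ℤ] B :=
  AlgEquiv.ofRingEquiv (f := f) (intAlgHom f.toRingHom).commutes

theorem coe_opD (n : ℕ) : (opD n : Module.End ℤ PolytopeRing) = d n := by
  cases n with
  | zero => exact d_zero.symm
  | succ n => rfl

theorem ev_mem_opRing (x : FreeLH ℤ) : ev x ∈ OpRing := by
  induction x using FreeLH.induction_Z with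
  | hz n => rw [ev_Z, ← coe_opD]; exact (opD n).2
  | hc c => rw [AlgHom.commutes, eq_intCast]; exact intCast_mem _ c
  | hm x y hx hy => rw [map_mul]; exact mul_mem hx hy
  | ha x y hx hy => rw [map_add]; exact add_mem hx hy

/-- The homomorphism `Z_k ↦ d_k` onto the ring of operators. -/
noncomputable def evOp : FreeLH ℤ →+* OpRing :=
  (ev : FreeLH ℤ →+* Module.End ℤ PolytopeRing).codRestrict OpRing ev_mem_opRing

theorem evOp_Z (n : ℕ) : evOp (Z ℤ n) = opD n := Subtype.ext ((ev_Z n).trans (coe_opD n).symm)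

theorem evOp_eq_zero_iff {x : FreeLH ℤ} : evOp x = 0 ↔ x ∈ FreeLH.J ℤ := by
  rw [← ev_eq_zero_iff]
  exact Subtype.ext_iff

/-- `𝒟` is the subring generated by the `d_k`, and the range of `ev` is a subring that contains
them. -/
theorem evOp_surjective : Function.Surjective evOp := by
  rintro ⟨x, hx⟩
  have hle : OpRing ≤ (ev : FreeLH ℤ →+* Module.End ℤ PolytopeRing).range := by
    refine Subring.closure_le.2 ?_
    rintro _ ⟨n, -, rfl⟩
    exact ⟨Z ℤ n, ev_Z n⟩
  obtain ⟨y, hy⟩ := hle hx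
  exact ⟨y, Subtype.ext hy⟩

/-- The isomorphism `Z_k ↦ d_k`. -/
noncomputable def quotientEquiv : FreeLH ℤ ⧸ FreeLH.J ℤ ≃+* OpRing :=
  RingEquiv.ofBijective
    (Ideal.Quotient.lift (FreeLH.J ℤ) evOp fun _ hx => evOp_eq_zero_iff.2 hx) (by
      constructor
      · rw [injective_iff_map_eq_zero]
        intro x hx
        obtain ⟨x, rfl⟩ := Ideal.Quotient.mk_surjective x
        exact Ideal.Quotient.eq_zero_iff_mem.2 (evOp_eq_zero_iff.1 hx)
      · intro y
        obtain ⟨x, rfl⟩ := evOp_surjective y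
        exact ⟨Ideal.Quotient.mk _ x, rfl⟩)

theorem quotientEquiv_mk (n : ℕ) :
    quotientEquiv (Ideal.Quotient.mk (FreeLH.J ℤ) (Z ℤ n)) = opD n := evOp_Z n

theorem isOdd_opD : FreeLH.IsOdd opD := by
  have h := (FreeLH.isOdd_mk ℤ).map (quotientEquiv : FreeLH ℤ ⧸ FreeLH.J ℤ →+* OpRing)
  simpa only [RingHom.coe_coe, quotientEquiv_mk] using h

end PolytopeAlgebra

theorem theorem1 :
    (∃ _ : HopfAlgebra ℤ OpRing, IsLeibnitzHopf ℤ OpRing opD) ∧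
    ∀ _ : HopfAlgebra ℤ OpRing, IsLeibnitzHopf ℤ OpRing opD →
      MilnorRule ℤ (fun (D : OpRing) (p : PolytopeRing) => (D : Module.End ℤ PolytopeRing) p) ∧
      (∃ e : HopfEquiv ℤ (FreeLH ℤ ⧸ FreeLH.J ℤ) OpRing,
        ∀ k, e (Ideal.Quotient.mk (FreeLH.J ℤ) (FreeLH.Z ℤ k)) = opD k) ∧
      (∀ k, HopfAlgebra.antipode ℤ (opD k) = (-1) ^ k * opD k) ∧
      ∀ (H : Type*) [Ring H] [HopfAlgebra ℤ H] (h : ℕ → H), IsLeibnitzHopf ℤ H h →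
        (∀ k, HopfAlgebra.antipode ℤ (h k) = (-1) ^ k * h k) →
        ∃! f : HopfHom ℤ OpRing H, ∀ k, f (opD k) = h k := by
  -- Existence is transport from `𝒵/J`. Claims (a) to (d) concern an arbitrary Leibnitz-Hopf
  -- structure on `𝒟`, which brings its own `ℤ`-algebra structure; `intAlgHom` and `intAlgEquiv`
  -- bridge the difference.
  refine ⟨⟨transportHopf (intAlgEquiv quotientEquiv), ?_⟩, fun _ hD => ⟨?_, ?_, ?_, ?_⟩⟩
  · have h := isLeibnitzHopf_transport (intAlgEquiv quotientEquiv)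
      (FreeLH.isLeibnitzHopf_quotient ℤ)
    exact (funext quotientEquiv_mk) ▸ h
  · refine hD.milnorRule (intAlgHom OpRing.subtype) fun n u v => ?_
    change (opD n : Module.End ℤ PolytopeRing) (u * v) = _
    rw [coe_opD, d_mul]
    refine Finset.sum_congr rfl fun p _ => ?_
    rw [← coe_opD, ← coe_opD]
    rfl
  · exact ⟨(FreeLH.isLeibnitzHopf_quotient ℤ).hopfEquiv hD (intAlgEquiv quotientEquiv)
      quotientEquiv_mk, quotientEquiv_mk⟩
  · exact hD.isOdd_iff_antipode.1 isOdd_opD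
  · intro H _ _ h hh ha
    exact hD.existsUnique_hopfHom (intAlgEquiv quotientEquiv) quotientEquiv_mk hh ha
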